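/- **Setting.** Let $(V,\sigma)$ be a real symplectic vector space of finite dimension $2n\ge 0$ with a compatible complex structure $J$; equivalently, $V$ is a finite-dimensional complex inner product space with $J=i$, $\sigma=\operatorname{Im}\langle\cdot,\cdot\rangle$ and $\sigma(v,Jv)=\|v\|^2$. Let $S\in Sp(V,\sigma)$ and $T>0$. (For a periodic point $\zeta$ of the geodesic flow $g^t_\tau$ on the boundary $\partial M_\tau$ of a Grauert tube one takes $V=H_\zeta(\partial M_\tau)$, the CR subspace with its Kähler form and complex structure $J_\zeta$, $S=S_\zeta=D_\zeta g_\tau^{T(\zeta)}|_{H_\zeta}$ and $T=T(\zeta)$, the primitive period; the objects $W,\mu,Q$ below are then $W_{J_\zeta}(S_\zeta),\mu_\zeta,Q_\zeta$.) Let $dL$ be Lebesgue measure on $V$, normalized so that the ground state $\Omega(v)=e^{-\frac12\sigma(v,Jv)}$ has norm $1$ in $L^2(V,dL)$. The Bargmann–Fock space is $\mathcal H_J=\{f\,\Omega\in L^2(V,dL): f \text{ entire } J\text{-holomorphic}\}$, with orthogonal projection $\Pi_J:L^2(V,dL)\to\mathcal H_J$. Put $U_SF=F\circ S^{-1}$,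 let $P_JSP_J$, $P_J=\frac12(I-iJ)$, be the holomorphic block of $S$ (as a complex-linear map of $V$: $v\mapsto\frac12(Sv-JSJv)$), and let $\eta$ be one of the two complex numbers with $\eta^2=\overline{\det P_JSP_J}$ (they correspond to the two lifts of $S$ to the metaplectic group). There is exactly one unitary operator $W=W_J(S)$ on $\mathcal H_J$ with $WF=\eta\,\Pi_JU_SF$ for all $F\in\mathcal H_J$; it is the metaplectic operator. There is exactly one finite measure $\mu$ on $S^1=\mathbb R/2\pi\mathbb Z$, the spectral measure of $W$ in the ground state, with $\langle W^n\Omega,\Omega\rangle=\int_{S^1}e^{in\theta}\,d\mu(\theta)$ for all $n\in\mathbb Z$. Define $$Q(\lambda)=\frac1{2i}\sum_{n=1}^\infty\frac{e^{i\lambda nT}\langle W^n\Omega,\Omega\rangle-e^{-i\lambda nT}\langle W^{-n}\Omega,\Omega\rangle}{nT}=\sum_{n=1}^\infty\frac{\operatorname{Im}\big(e^{i\lambda nT}\langle W^n\Omega,\Omega\rangle\big)}{nT}\qquad(\lambda\in\mathbb R).$$ Let $\{y\}_{2\pi}$ be the representative of $y$ modulo $2\pi$ in $(-\pi,\pi)$,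 with $\{y\}_{2\pi}=0$ for $y\in\pi+2\pi\mathbb Z$; thus $\{x-\pi\}_{2\pi}=-2\sum_{n\ge1}\frac{\sin nx}{n}$ for all real $x$. Let $\pi_\Omega=\Omega\otimes\Omega^*$ be the orthogonal projection of $\mathcal H_J$ onto the ground state. Let $(v_\ell)_\ell$ be any orthonormal family of eigenvectors of $W$, $Wv_\ell=e^{is_\ell}v_\ell$ with $s_\ell\in\mathbb R$, whose closed linear span contains all eigenvectors of $W$, and put $$\Lambda_{\ell,j}=\frac{2\pi j-s_\ell}{T}\qquad(j\in\mathbb Z).$$ **Proposition 1.5.** 1. For every $\lambda\in\mathbb R$ the series $Q(\lambda)$ converges, and $$Q(\lambda)=-\frac1{2T}\int_0^{2\pi}\{\theta+\lambda T-\pi\}_{2\pi}\,d\mu(\theta).$$ 2. $Q$ is uniformly continuous on $\mathbb R$ if and only if $\mu$ is absolutely continuous with respect to Lebesgue measure on $S^1$. 3. The atoms of $\mu$ occur at the eigenvalues $e^{is_\ell}$ of $W$ (every atom is one of the points $e^{is_\ell}$), and for every $\ell$ $$\mu(\{e^{is_\ell}\})=\sum_{k:\,e^{is_k}=e^{is_\ell}}\|\pi_\Omega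 v_k\|^2;$$ in particular the mass is $\|\pi_\Omega v_\ell\|^2$ if the eigenvalue $e^{is_\ell}$ is simple. 4. The jump set $\{\lambda\in\mathbb R:\ Q(\lambda\pm0)\text{ exist and }Q(\lambda+0)-Q(\lambda-0)>0\}$ is exactly $\{\Lambda_{\ell,j}:\ \pi_\Omega v_\ell\ne0,\ j\in\mathbb Z\}$. -/

import Mathlib

open MeasureTheory Filter Topology

noncomputable section

namespace BargmannFock

/-- The circle `S¹` is used in the form `ℝ / 2πℤ`, the class of `θ` standing for `e^{iθ}`. -/
instance twoPiPos : Fact (0 < 2 * Real.pi) := ⟨Real.two_pi_pos⟩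

/-! ### Symplectic linear algebra

A finite-dimensional real symplectic vector space `(V, σ)` with a compatible complex structure `J`
is the same thing as a finite-dimensional complex inner product space `V`: `J` is multiplication
by `i`, `σ` is the imaginary part of the inner product, and `‖v‖² = σ(v, J v)`. -/

section Symplectic

variable {V : Type*} [NormedAddCommGroup V] [InnerProductSpace ℂ V]

/-- The symplectic form `σ(v, w) = Im ⟨v, w⟩`. -/
def sigma (v w : V) : ℝ := (inner ℂ v w : ℂ).im

/-- The complex structure `J`. -/
def cxJ (v : V) : V := Complex.I • v

theorem sigma_cxJ_self (v : V) : sigma v (cxJ v) = ‖v‖ ^ 2 := by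
  rw [sigma, cxJ, inner_smul_right, inner_self_eq_norm_sq_to_K]
  norm_cast
  simp [-Complex.ofReal_pow]

/-- `S` belongs to the symplectic group `Sp(V, σ)`. -/
def IsSymplectic (S : V ≃ₗ[ℝ] V) : Prop :=
  ∀ v w : V, sigma (S v) (S w) = sigma v w

/-- The holomorphic block `P_J S P_J`, `P_J = (I - iJ)/2`, of a real linear map `S`. Under the
identification of `V` with the `+i` eigenspace of `J` on `V ⊗ ℂ`, it is the complex-linear part
`v ↦ (S v - J S J v) / 2` of `S`; for a block matrix `S = (A B; C D)` in a symplectic basis it is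
`(A + D + i (C - B)) / 2`. -/
def holoBlock (S : V →ₗ[ℝ] V) : V →ₗ[ℂ] V where
  toFun v := (2⁻¹ : ℂ) • (S v - cxJ (S (cxJ v)))
  map_add' v w := by
    simp only [cxJ, smul_add, map_add, smul_sub]
    abel
  map_smul' c v := by
    have h : ∀ (a : ℝ) (w : V), S ((a : ℂ) • w) = (a : ℂ) • S w := fun a w => by
      rw [Complex.coe_smul, map_smul, Complex.coe_smul]
    have h1 : S (c • v) = (c.re : ℂ) • S v + (c.im : ℂ) • S (Complex.I • v) := by
      rw [← h, ← h, ← map_add, smul_smul, ← add_smul, Complex.re_add_im]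
    have h2 : S (Complex.I • c • v) = (c.re : ℂ) • S (Complex.I • v) - (c.im : ℂ) • S v := by
      rw [← h, ← h, ← map_sub, smul_smul, smul_smul, ← sub_smul]
      congr 2
      apply Complex.ext <;> simp
    simp only [cxJ, RingHom.id_apply, h1, h2]
    have hc : c = (c.re : ℂ) + (c.im : ℂ) * Complex.I := (Complex.re_add_im c).symm
    generalize S v = x
    generalize S (Complex.I • v) = y
    conv_rhs => rw [hc]
    match_scalars
    · ring
    · linear_combination ((2⁻¹ : ℂ) * (c.im : ℂ)) * Complex.I_mul_I

/-- The ground state `Ω_J(v) = exp(-σ(v, J v) / 2)` as a function. -/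
def groundFun (v : V) : ℂ := ((Real.exp (-(1 / 2) * sigma v (cxJ v)) : ℝ) : ℂ)

theorem groundFun_continuous : Continuous (groundFun (V := V)) := by
  unfold groundFun
  simp only [sigma_cxJ_self]
  fun_prop

end Symplectic

/-! ### Bargmann-Fock space -/

section Fock

variable (V : Type*) [NormedAddCommGroup V] [InnerProductSpace ℂ V] [FiniteDimensional ℂ V]
  [MeasurableSpace V] [BorelSpace V]

/-- Lebesgue measure of the Euclidean space `V` (inner product `Re ⟨v, w⟩ = σ(v, J w)`). -/
def lebesgue : Measure V :=
  letI := InnerProductSpace.rclikeToReal ℂ V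
  volume

/-- Normalized Lebesgue measure `dL = π⁻ⁿ dx dy`, `n = dim_ℂ V`. With this normalization the square
of the symplectic Fourier transform `f ↦ ∫ e^{2iσ(v, w)} f(w) dL(w)` is the identity and the
ground state below has norm `1`. -/
def dL : Measure V :=
  ENNReal.ofReal ((Real.pi ^ Module.finrank ℂ V)⁻¹) • lebesgue V

variable {V}

theorem groundFun_memLp : MemLp (groundFun (V := V)) 2 (dL V) := by
  refine MemLp.smul_measure ?_ ENNReal.ofReal_ne_top
  rw [memLp_two_iff_integrable_sq_norm groundFun_continuous.aestronglyMeasurable]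
  let _ := InnerProductSpace.rclikeToReal ℂ V
  have h := (GaussianFourier.integrable_cexp_neg_mul_sq_norm_add (V := V) (b := 1)
    (by simp) 0 0).norm
  refine h.congr (Eventually.of_forall fun v => ?_)
  simp only [groundFun, sigma_cxJ_self, zero_mul, add_zero, Complex.norm_exp, Complex.norm_real,
    Real.norm_eq_abs, Real.abs_exp]
  rw [← Real.exp_nat_mul]
  congr 1
  norm_cast
  ring_nf
  simp

variable (V)

/-- The Bargmann-Fock space `H_J`: the elements of `L²(V, dL)` of the form `f Ω_J` with
`f : V → ℂ` entire holomorphic. -/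
def fock : Submodule ℂ (Lp ℂ 2 (dL V)) where
  carrier := {F | ∃ f : V → ℂ, Differentiable ℂ f ∧ F =ᵐ[dL V] fun v => f v * groundFun v}
  zero_mem' := ⟨fun _ => 0, differentiable_const 0, by
    filter_upwards [Lp.coeFn_zero ℂ 2 (dL V)] with v hv
    rw [hv]
    simp⟩
  add_mem' := by
    rintro F G ⟨f, hf, hF⟩ ⟨g, hg, hG⟩
    refine ⟨fun v => f v + g v, hf.add hg, ?_⟩
    filter_upwards [Lp.coeFn_add F G, hF, hG] with v h h1 h2
    rw [h, Pi.add_apply, h1, h2, add_mul]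
  smul_mem' := by
    rintro c F ⟨f, hf, hF⟩
    refine ⟨fun v => c * f v, hf.const_mul c, ?_⟩
    filter_upwards [Lp.coeFn_smul c F, hF] with v h h1
    rw [h, Pi.smul_apply, h1, smul_eq_mul, mul_assoc]

/-- The ground state `Ω_J` as an element of Bargmann-Fock space. -/
def ground : fock V :=
  ⟨groundFun_memLp.toLp groundFun, fun _ => 1, differentiable_const 1, by
    filter_upwards [groundFun_memLp.coeFn_toLp (μ := dL V)] with v hv
    rw [hv, one_mul]⟩

variable {V}

/-- The orthogonal projection `π_Ω = Ω_J ⊗ Ω_J^*` onto the ground state. -/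
def groundProj (v : fock V) : fock V := (inner ℂ (ground V) v : ℂ) • ground V

/-- `η` is a square root of the complex conjugate of `det (P_J S P_J)`, which is the same number as
`2⁻²ⁿ det ((I - iJ) + S (I + iJ))` (determinant on `V ⊗ ℂ`). The two values of `η` correspond to the
two elements of the double cover `Mp(V, σ)` that lie above `S`. -/
def IsMetaplecticFactor (S : V ≃ₗ[ℝ] V) (η : ℂ) : Prop :=
  η ^ 2 = (starRingEnd ℂ) (LinearMap.det (holoBlock S.toLinearMap))

/-- The unitary operator `W` on `H_J` is the metaplectic operator `W_J(S) = η Π_J U_S Π_J`, where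
`U_S F = F ∘ S⁻¹` and `Π_J` is the orthogonal projection of `L²(V, dL)` onto `H_J`: for `F ∈ H_J`,
`W F` is the element of `H_J` with `⟨G, W F⟩ = η ⟨G, U_S F⟩` for all `G ∈ H_J`. -/
def IsMetaplectic (S : V ≃ₗ[ℝ] V) (η : ℂ) (W : fock V ≃ₗᵢ[ℂ] fock V) : Prop :=
  ∀ F G : fock V, (inner ℂ G (W F) : ℂ) =
    η * ∫ v, (starRingEnd ℂ) ((G : Lp ℂ 2 (dL V)) v) * (F : Lp ℂ 2 (dL V)) (S.symm v) ∂(dL V)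

end Fock

/-! ### Spectral measures and eigenvectors of a unitary operator -/

section Spectral

variable {H : Type*} [NormedAddCommGroup H] [InnerProductSpace ℂ H]

/-- `μ` is the spectral measure of the unitary operator `W` with respect to the vector `x`: the
finite measure on the circle whose moments `∫ e^{inθ} dμ`, `n ∈ ℤ`, are `⟨Wⁿ x, x⟩` (inner
product linear in the first variable; Mathlib's is linear in the second). -/
def IsSpectralMeasure (W : H ≃ₗᵢ[ℂ] H) (x : H) (μ : Measure (AddCircle (2 * Real.pi))) : Prop :=
  IsFiniteMeasure μ ∧ ∀ n : ℤ, ∫ θ, fourier n θ ∂μ = (inner ℂ x ((W ^ n) x) : ℂ)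

/-- `(s_ℓ, v_ℓ)` is a complete system of eigenvalues `e^{i s_ℓ}` and orthonormal eigenvectors `v_ℓ`
of `W`: every eigenvector of `W` lies in the closed span of the `v_ℓ`. -/
def IsEigenSystem (W : H ≃ₗᵢ[ℂ] H) {ι : Type*} (s : ι → ℝ) (v : ι → H) : Prop :=
  Orthonormal ℂ v ∧
  (∀ l, W (v l) = Complex.exp (Complex.I * s l) • v l) ∧
  ∀ (z : ℂ) (x : H), W x = z • x → x ∈ closure (Submodule.span ℂ (Set.range v) : Set H)

end Spectral

/-! ### The function `Q` -/

/-- Partial sums of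
`Q(λ) = (1/2i) (∑_{n ≥ 1} e^{iλnT}/(nT) ⟨Wⁿ x, x⟩ - ∑_{n ≥ 1} e^{-iλnT}/(nT) ⟨W⁻ⁿ x, x⟩)`.
For unitary `W` the two summands with the same `n` are complex conjugate, so that their
contribution is the imaginary part of `e^{iλnT} ⟨Wⁿ x, x⟩`, divided by `nT`. -/
def QPartial {H : Type*} [NormedAddCommGroup H] [InnerProductSpace ℂ H]
    (W : H ≃ₗᵢ[ℂ] H) (x : H) (T lam : ℝ) (N : ℕ) : ℝ :=
  ∑ n ∈ Finset.Icc 1 N,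
    (Complex.exp (Complex.I * (lam * n * T)) * (inner ℂ x ((W ^ n) x) : ℂ)).im / (n * T)

/-- `Q(λ)`, the (conditionally convergent) sum of the series. -/
def Qfun {H : Type*} [NormedAddCommGroup H] [InnerProductSpace ℂ H]
    (W : H ≃ₗᵢ[ℂ] H) (x : H) (T lam : ℝ) : ℝ :=
  limUnder atTop (QPartial W x T lam)

/-- `{y}_{2π}`: the representative of `y` modulo `2π` in `(-π, π)`, with the midpoint value `0` at
the discontinuities `y ∈ π + 2πℤ`. -/
def residue (y : ℝ) : ℝ :=
  if Int.fract (y / (2 * Real.pi) + 1 / 2) = 0 then 0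
  else 2 * Real.pi * Int.fract (y / (2 * Real.pi) + 1 / 2) - Real.pi

/-- The jump set of a function `f` on the line: the points `t` at which the one-sided limits exist
and `f(t + 0) - f(t - 0) > 0`. -/
def jumpSet (f : ℝ → ℝ) : Set ℝ :=
  {t | ∃ a b : ℝ, Tendsto f (𝓝[>] t) (𝓝 a) ∧ Tendsto f (𝓝[<] t) (𝓝 b) ∧ 0 < a - b}

end BargmannFock

end

open BargmannFock

noncomputable section
namespace BargmannFock

/-! ### The sawtooth series -/

/-! Each term of Q is the integral against μ of a term of the sawtooth series Σ sin(nx)/n. The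
partial sums of that series converge everywhere and are bounded uniformly in x and N
(`abs_sum_sin_div_le`), so dominated convergence gives the integral formula. The sawtooth jumps only
at multiples of 2π, so one-sided limits under the integral show that Q jumps at λ by π/T times the
mass of μ at -λT (`IsSpectralMeasure.exists_jump`). The mean ergodic theorem identifies the mass of
an atom with the squared norm of the projection of Ω on the eigenspace
(`IsSpectralMeasure.real_singleton`), and Parseval turns it into a sum over the eigenvectors. Since
Q is periodic, it is uniformly continuous exactly when μ has no atoms.

The substance is that absence of atoms forces absolute continuity. The Heisenberg translations
satisfy W τ_z = τ_{Sz} W, and the projection on Ω is a Gaussian average of translations; hence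
|⟨WⁿΩ, Ω⟩|² is the Gaussian integral `overlap (S ^ n)`. If the powers Sⁿ, n ≥ 0, are bounded, this
stays away from 0 and Wiener's theorem produces an atom. Otherwise S has an eigenvalue off the unit
circle or a nontrivial Jordan block on it (`bounded_or_isSquareSmall`). This gives a vector u ≠ 0
which, for S or for its inverse, splits for every n as Sⁿ⁺¹a + b with a and b bounded by a
square-summable sequence. Moving translations past Wⁿ⁺¹ then shows that Ω - τ_{ru}Ω has
square-summable correlations with every translate of Ω. Averaging over widely spaced r yields
vectors close to Ω with square-summable autocorrelations. Such vectors have absolutely continuous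
spectral measures by Cauchy–Schwarz, and the property survives limits (`Implements.exists_approx`,
`IsSpectralMeasure.absolutelyContinuous`).

The operator W exists because the compression of U_S to Bargmann–Fock space multiplies inner
products by `overlap S` (`inner_compression_compression`), and a Gaussian determinant shows that
this number is 1/|η|² (`norm_factor_sq_mul_overlap`). -/

theorem norm_mul_sum_pow_div_le {w : ℂ} (hw : ‖w‖ = 1) {a b : ℕ} (ha : 0 < a) (hab : a ≤ b) :
    ‖(1 - w) * ∑ n ∈ Finset.Ico a b, w ^ n / n‖ ≤ 2 / a := by
  -- Abel summation: once the boundary term w^b/b is included, each induction step only adds a term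
  -- of norm 1/b - 1/(b+1), and these telescope.
  have key : ∀ b, a ≤ b →
      ‖(1 - w) * (∑ n ∈ Finset.Ico a b, w ^ n / n) + w ^ b / b‖ ≤ 2 / a - 1 / b := by
    intro b hb
    induction b, hb using Nat.le_induction with
    | base => simp [hw]; ring_nf; rfl
    | succ b hb ih =>
      have hb0 : 0 < b := ha.trans_le hb
      have hbc : (b : ℂ) ≠ 0 := by exact_mod_cast hb0.ne'
      have hbc1 : (b : ℂ) + 1 ≠ 0 := by exact_mod_cast b.succ_ne_zero
      have hbr : (0 : ℝ) < b := by exact_mod_cast hb0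
      rw [Finset.sum_Ico_succ_top hb]
      have e : (1 - w) * (∑ n ∈ Finset.Ico a b, w ^ n / n + w ^ b / b)
          + w ^ (b + 1) / ((b + 1 : ℕ) : ℂ)
          = ((1 - w) * (∑ n ∈ Finset.Ico a b, w ^ n / n) + w ^ b / b)
            - w ^ (b + 1) * ((1 / b - 1 / (b + 1) : ℝ) : ℂ) := by
        push_cast
        field_simp
        ring
      rw [e]
      refine (norm_sub_le _ _).trans ?_
      have h2 : ‖w ^ (b + 1) * ((1 / b - 1 / (b + 1) : ℝ) : ℂ)‖ = 1 / b - 1 / (b + 1) := by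
        rw [norm_mul, norm_pow, hw, one_pow, one_mul, Complex.norm_real, Real.norm_of_nonneg]
        rw [sub_nonneg]
        exact one_div_le_one_div_of_le hbr (by linarith)
      rw [h2]
      push_cast
      linarith
  have h := key b hab
  have hb0 : (0 : ℝ) < b := by exact_mod_cast ha.trans_le hab
  calc ‖(1 - w) * ∑ n ∈ Finset.Ico a b, w ^ n / n‖
      = ‖((1 - w) * (∑ n ∈ Finset.Ico a b, w ^ n / n) + w ^ b / b) - w ^ b / b‖ := by
        rw [add_sub_cancel_right]
    _ ≤ _ := norm_sub_le _ _
    _ ≤ (2 / a - 1 / b) + 1 / b := by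
        gcongr
        simp [hw]
    _ = 2 / a := by ring

theorem norm_pow_sub_one_le {w : ℂ} (hw : ‖w‖ = 1) (n : ℕ) : ‖w ^ n - 1‖ ≤ n * ‖w - 1‖ := by
  induction n with
  | zero => simp
  | succ n ih =>
    have e : w ^ (n + 1) - 1 = w * (w ^ n - 1) + (w - 1) := by ring
    rw [e]
    refine (norm_add_le _ _).trans ?_
    rw [norm_mul, hw]
    push_cast
    linarith

theorem exp_pow_im (x : ℝ) (n : ℕ) : (Complex.exp (x * Complex.I) ^ n).im = Real.sin (n * x) := by
  rw [← Complex.exp_nat_mul, ← Complex.exp_ofReal_mul_I_im]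
  push_cast
  ring_nf

theorem sum_sin_div_eq (x : ℝ) (s : Finset ℕ) : ∑ n ∈ s, Real.sin (n * x) / n =
    (∑ n ∈ s, Complex.exp (x * Complex.I) ^ n / (n : ℂ)).im := by
  rw [Complex.im_sum]
  refine Finset.sum_congr rfl fun n _ => ?_
  rw [Complex.div_natCast_im, exp_pow_im]

theorem Icc_one_eq_Ico (N : ℕ) : Finset.Icc 1 N = Finset.Ico 1 (N + 1) := by
  ext n
  simp

/-- This is the dominating constant for the integral formula. The sum is cut at m = ⌊1/‖w - 1‖⌋: up
to m every term is at most ‖w - 1‖, for a total of at most 1; beyond m Abel summation bounds the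
tail by 2/((m+1)‖w - 1‖) ≤ 2. -/
theorem abs_sum_sin_div_le (x : ℝ) (N : ℕ) :
    |∑ n ∈ Finset.Icc 1 N, Real.sin (n * x) / n| ≤ 3 := by
  set w := Complex.exp (x * Complex.I) with hw_def
  have hw : ‖w‖ = 1 := Complex.norm_exp_ofReal_mul_I x
  rcases eq_or_ne w 1 with h1 | h1
  · rw [sum_sin_div_eq, ← hw_def, h1]
    have : (∑ n ∈ Finset.Icc 1 N, (1 : ℂ) ^ n / (n : ℂ)).im = 0 := by
      rw [Complex.im_sum]
      refine Finset.sum_eq_zero fun n _ => ?_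
      rw [Complex.div_natCast_im]
      simp
    rw [this]
    simp
  have hpos : 0 < ‖w - 1‖ := norm_pos_iff.2 (sub_ne_zero.2 h1)
  have head : ∀ m : ℕ, (m : ℝ) * ‖w - 1‖ ≤ 1 →
      |∑ n ∈ Finset.Ico 1 (m + 1), Real.sin (n * x) / n| ≤ 1 := by
    intro m hm
    refine (Finset.abs_sum_le_sum_abs _ _).trans (le_trans ?_ hm)
    have : ∀ n ∈ Finset.Ico 1 (m + 1), |Real.sin (n * x) / n| ≤ ‖w - 1‖ := by
      intro n hn
      have hn0 : (0 : ℝ) < n := by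
        exact_mod_cast (Finset.mem_Ico.1 hn).1
      rw [abs_div, abs_of_pos hn0, div_le_iff₀ hn0]
      refine le_trans ?_ ((norm_pow_sub_one_le hw n).trans_eq (mul_comm _ _))
      rw [← exp_pow_im]
      have : (w ^ n).im = (w ^ n - 1).im := by simp
      rw [← hw_def, this]
      exact Complex.abs_im_le_norm _
    refine (Finset.sum_le_sum this).trans ?_
    simp
  set m := ⌊1 / ‖w - 1‖⌋₊ with hm
  have hm1 : (m : ℝ) * ‖w - 1‖ ≤ 1 := by
    rw [← le_div_iff₀ hpos]
    exact Nat.floor_le (by positivity)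
  have hm2 : 1 < ((m : ℝ) + 1) * ‖w - 1‖ := by
    rw [← div_lt_iff₀ hpos]
    exact Nat.lt_floor_add_one _
  rw [Icc_one_eq_Ico]
  rcases le_total N m with h | h
  · refine (head N (le_trans ?_ hm1)).trans (by norm_num)
    gcongr
  · rw [← Finset.sum_Ico_consecutive _ (by omega : 1 ≤ m + 1) (by omega : m + 1 ≤ N + 1)]
    refine (abs_add_le _ _).trans ?_
    have h2 : |∑ n ∈ Finset.Ico (m + 1) (N + 1), Real.sin (n * x) / n| ≤ 2 := by
      rw [sum_sin_div_eq]
      refine (Complex.abs_im_le_norm _).trans ?_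
      have := norm_mul_sum_pow_div_le hw (Nat.succ_pos m) (by omega : m + 1 ≤ N + 1)
      rw [norm_mul, norm_sub_rev] at this
      have hm3 : (2 : ℝ) / ((m + 1 : ℕ) : ℝ) ≤ 2 * ‖w - 1‖ := by
        push_cast
        rw [div_le_iff₀ (by positivity)]
        nlinarith
      have h3 := this.trans hm3
      rw [mul_comm 2] at h3
      exact le_of_mul_le_mul_left h3 hpos
    linarith [head m hm1]

theorem one_sub_mem_slitPlane {w : ℂ} (hw : ‖w‖ = 1) (h1 : w ≠ 1) : 1 - w ∈ Complex.slitPlane := by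
  left
  have h : w.re ≤ 1 := hw ▸ Complex.re_le_norm w
  have : w.re ≠ 1 := by
    intro h2
    apply h1
    have h3 : w.re * w.re + w.im * w.im = 1 := by
      rw [← Complex.normSq_apply, Complex.normSq_eq_norm_sq, hw, one_pow]
    apply Complex.ext
    · simpa using h2
    · rw [h2] at h3
      simpa using h3
  simp only [Complex.sub_re, Complex.one_re, sub_pos]
  exact lt_of_le_of_ne h this

/-- The logarithm series on the boundary of the disc. -/
theorem tendsto_sum_pow_div {w : ℂ} (hw : ‖w‖ = 1) (h1 : w ≠ 1) :
    Tendsto (fun N : ℕ => ∑ n ∈ Finset.range N, w ^ n / (n : ℂ)) atTop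
      (𝓝 (-Complex.log (1 - w))) := by
  have hpos : 0 < ‖1 - w‖ := norm_pos_iff.2 (sub_ne_zero.2 h1.symm)
  -- Abel's limit theorem identifies the sum but presupposes convergence, which is supplied here by
  -- the tail bound.
  have hc : CauchySeq fun N : ℕ => ∑ n ∈ Finset.range N, w ^ n / (n : ℂ) := by
    rw [Metric.cauchySeq_iff']
    intro ε hε
    obtain ⟨a, ha⟩ := exists_nat_gt (2 / (ε * ‖1 - w‖))
    have ha0 : (0 : ℝ) < a := lt_trans (by positivity) ha
    refine ⟨a, fun b hb => ?_⟩
    rw [dist_eq_norm, ← Finset.sum_Ico_eq_sub _ hb]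
    have := norm_mul_sum_pow_div_le hw (by exact_mod_cast ha0) hb
    rw [norm_mul] at this
    have h2 : 2 / (a : ℝ) < ‖1 - w‖ * ε := by
      rw [div_lt_iff₀ (by positivity)] at ha
      rw [div_lt_iff₀ ha0]
      linarith
    exact lt_of_mul_lt_mul_left (this.trans_lt h2) hpos.le
  obtain ⟨l, hl⟩ := cauchySeq_tendsto_of_complete hc
  have habel := Complex.tendsto_tsum_powerSeries_nhdsWithin_lt hl
  have hlog : Tendsto (fun z : ℂ => ∑' n : ℕ, w ^ n / (n : ℂ) * z ^ n)
      (Filter.map Complex.ofReal (𝓝[<] 1)) (𝓝 (-Complex.log (1 - w))) := by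
    rw [tendsto_map'_iff]
    have hcont : Tendsto (fun r : ℝ => -Complex.log (1 - w * (r : ℂ))) (𝓝[<] 1)
        (𝓝 (-Complex.log (1 - w))) := by
      have : ContinuousAt (fun r : ℝ => -Complex.log (1 - w * (r : ℂ))) 1 := by
        refine ContinuousAt.neg (ContinuousAt.clog (by fun_prop) ?_)
        simpa using one_sub_mem_slitPlane hw h1
      simpa using this.tendsto.mono_left nhdsWithin_le_nhds
    refine hcont.congr' ?_
    have : Set.Ioo (0 : ℝ) 1 ∈ 𝓝[<] (1 : ℝ) := Ioo_mem_nhdsLT (by norm_num)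
    filter_upwards [this] with r hr
    have hz : ‖w * (r : ℂ)‖ < 1 := by
      rw [norm_mul, hw, one_mul, Complex.norm_real, Real.norm_of_nonneg hr.1.le]
      exact hr.2
    rw [← (Complex.hasSum_taylorSeries_neg_log hz).tsum_eq]
    simp only [Function.comp]
    refine tsum_congr fun n => ?_
    rw [mul_pow]
    ring
  rwa [tendsto_nhds_unique habel hlog] at hl

theorem residue_sub_pi (x : ℝ) : residue (x - Real.pi) =
    if Int.fract (x / (2 * Real.pi)) = 0 then 0
    else 2 * Real.pi * Int.fract (x / (2 * Real.pi)) - Real.pi := by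
  have : (x - Real.pi) / (2 * Real.pi) + 1 / 2 = x / (2 * Real.pi) := by
    have := Real.pi_ne_zero
    field_simp
    ring
  rw [residue, this]

theorem exp_mul_I_eq_fract (x : ℝ) : Complex.exp (x * Complex.I) =
    Complex.exp ((2 * Real.pi * Int.fract (x / (2 * Real.pi)) : ℝ) * Complex.I) := by
  rw [Complex.exp_eq_exp_iff_exists_int]
  refine ⟨⌊x / (2 * Real.pi)⌋, ?_⟩
  have h : x = 2 * Real.pi * Int.fract (x / (2 * Real.pi)) + ⌊x / (2 * Real.pi)⌋ * (2 * Real.pi) := by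
    have h1 := Int.self_sub_floor (x / (2 * Real.pi))
    rw [← h1]
    have := Real.pi_ne_zero
    field_simp
    ring
  conv_lhs => rw [h]
  push_cast
  ring

/-- From 1 - e^{iy} = 2 sin(y/2) e^{i(y-π)/2}, where the sine is positive on (0, 2π). The sawtooth
is this argument. -/
theorem arg_one_sub_exp {y : ℝ} (h0 : 0 < y) (h1 : y < 2 * Real.pi) :
    Complex.arg (1 - Complex.exp (y * Complex.I)) = (y - Real.pi) / 2 := by
  have hs : 0 < Real.sin (y / 2) := Real.sin_pos_of_pos_of_lt_pi (by linarith) (by linarith)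
  have e : 1 - Complex.exp (y * Complex.I) = ((2 * Real.sin (y / 2) : ℝ) : ℂ) *
      (Complex.cos (((y - Real.pi) / 2 : ℝ) : ℂ) + Complex.sin (((y - Real.pi) / 2 : ℝ) : ℂ)
        * Complex.I) := by
    have hc : Real.cos ((y - Real.pi) / 2) = Real.sin (y / 2) := by
      rw [show (y - Real.pi) / 2 = y / 2 - Real.pi / 2 by ring, Real.cos_sub_pi_div_two]
    have hs' : Real.sin ((y - Real.pi) / 2) = -Real.cos (y / 2) := by
      rw [show (y - Real.pi) / 2 = y / 2 - Real.pi / 2 by ring, Real.sin_sub_pi_div_two]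
    have hcy : Real.cos y = 1 - 2 * Real.sin (y / 2) ^ 2 := by
      conv_lhs => rw [show y = 2 * (y / 2) by ring]
      rw [Real.cos_two_mul, Real.cos_sq']
      ring
    have hsy : Real.sin y = 2 * Real.sin (y / 2) * Real.cos (y / 2) := by
      conv_lhs => rw [show y = 2 * (y / 2) by ring]
      rw [Real.sin_two_mul]
    rw [← Complex.ofReal_cos, ← Complex.ofReal_sin, hc, hs', Complex.exp_mul_I, ← Complex.ofReal_cos,
      ← Complex.ofReal_sin, hcy, hsy]
    push_cast
    ring
  rw [e, Complex.arg_mul_cos_add_sin_mul_I (by positivity)]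
  constructor <;> linarith [Real.pi_pos]

/-- The imaginary part of -log(1 - e^{ix}). At x ∈ 2πℤ the logarithm is unavailable, but all terms
vanish, in agreement with the midpoint convention in `residue`. -/
theorem tendsto_sum_sin_div (x : ℝ) :
    Tendsto (fun N : ℕ => ∑ n ∈ Finset.Icc 1 N, Real.sin (n * x) / n) atTop
      (𝓝 (-(1 / 2) * residue (x - Real.pi))) := by
  rw [residue_sub_pi]
  set f := Int.fract (x / (2 * Real.pi)) with hf
  have hexp := exp_mul_I_eq_fract x
  rw [← hf] at hexp
  split_ifs with h0
  · rw [h0] at hexp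
    have : ∀ N : ℕ, ∑ n ∈ Finset.Icc 1 N, Real.sin (n * x) / n = 0 := by
      intro N
      refine Finset.sum_eq_zero fun n _ => ?_
      rw [← exp_pow_im, hexp]
      simp
    simp [this]
  have hf0 : 0 < f := lt_of_le_of_ne (Int.fract_nonneg _) (Ne.symm h0)
  have hf1 : f < 1 := Int.fract_lt_one _
  have hy0 : 0 < 2 * Real.pi * f := by positivity
  have hy1 : 2 * Real.pi * f < 2 * Real.pi := by nlinarith [Real.pi_pos]
  have harg := arg_one_sub_exp hy0 hy1
  rw [← hexp] at harg
  have hne : Complex.exp (x * Complex.I) ≠ 1 := by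
    intro h
    rw [h] at harg
    simp only [sub_self, Complex.arg_zero] at harg
    have hpi : 2 * Real.pi * f = Real.pi := by linarith
    rw [hexp, hpi, Complex.exp_pi_mul_I] at h
    norm_num at h
  have hlim := (Complex.continuous_im.tendsto _).comp
    (tendsto_sum_pow_div (Complex.norm_exp_ofReal_mul_I x) hne)
  rw [Complex.neg_im, Complex.log_im, harg] at hlim
  -- The shifted range contains the extra index n = 0, whose term is a division by zero and hence 0.
  have hlim2 := (tendsto_add_atTop_iff_nat 1).2 hlim
  convert hlim2 using 2 with N
  · rw [Icc_one_eq_Ico, sum_sin_div_eq, Function.comp_apply, Finset.range_eq_Ico,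
      Finset.sum_eq_sum_Ico_succ_bot (Nat.succ_pos N)]
    simp
  · ring
end BargmannFock
end

noncomputable section
namespace BargmannFock

/-! ### Spectral measures of unitary operators -/

section SpectralExistence

variable {H : Type*} [NormedAddCommGroup H] [InnerProductSpace ℂ H]

theorem coe_npow_apply (W : H ≃ₗᵢ[ℂ] H) (n : ℕ) (x : H) : (W ^ n) x = W^[n] x := by
  induction n generalizing x with
  | zero => rfl
  | succ n ih =>
    rw [pow_succ, Function.iterate_succ_apply, ← ih]
    rfl

theorem zpow_add_apply (W : H ≃ₗᵢ[ℂ] H) (m n : ℤ) (x : H) :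
    (W ^ (m + n)) x = (W ^ m) ((W ^ n) x) := by
  rw [zpow_add]
  rfl

theorem inner_zpow_left (W : H ≃ₗᵢ[ℂ] H) (n : ℤ) (x y : H) :
    (inner ℂ ((W ^ n) x) y : ℂ) = inner ℂ x ((W ^ (-n)) y) := by
  rw [← LinearIsometryEquiv.inner_map_map (W ^ (-n)) ((W ^ n) x) y, ← zpow_add_apply]
  simp

theorem inner_zpow_neg (W : H ≃ₗᵢ[ℂ] H) (n : ℤ) (x : H) :
    (inner ℂ x ((W ^ (-n)) x) : ℂ) = (starRingEnd ℂ) (inner ℂ x ((W ^ n) x)) := by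
  rw [← inner_zpow_left, inner_conj_symm]

theorem inner_zpow_zpow (W : H ≃ₗᵢ[ℂ] H) (m n : ℤ) (x y : H) :
    (inner ℂ ((W ^ m) x) ((W ^ n) y) : ℂ) = inner ℂ x ((W ^ (n - m)) y) := by
  rw [inner_zpow_left, ← zpow_add_apply, neg_add_eq_sub]

theorem fourier_two_pi (n : ℤ) (x : ℝ) :
    fourier n (x : AddCircle (2 * Real.pi)) = Complex.exp (n * x * Complex.I) := by
  rw [fourier_coe_apply]
  congr 1
  have := Real.pi_ne_zero
  push_cast
  field_simp

theorem integrable_continuousMap {X E : Type*} [TopologicalSpace X] [CompactSpace X]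
    [MeasurableSpace X] [BorelSpace X] [NormedAddCommGroup E] [SecondCountableTopologyEither X E]
    (μ : Measure X) [IsFiniteMeasure μ]
    (f : C(X, E)) : Integrable f μ :=
  f.continuous.integrable_of_hasCompactSupport (HasCompactSupport.of_compactSpace f)

variable [CompleteSpace H]

/-- The quadratic form of a continuous functional calculus is given by a finite measure on the
spectrum. -/
theorem exists_measure_cfcHom {a : H →L[ℂ] H} (ha : IsStarNormal a) (x : H) :
    ∃ ρ : Measure (spectrum ℂ a), IsFiniteMeasure ρ ∧
      ∀ g : C(spectrum ℂ a, ℂ), ∫ z, g z ∂ρ = inner ℂ x (cfcHom ha g x) := by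
  let φ : C(spectrum ℂ a, ℂ) →⋆ₐ[ℂ] (H →L[ℂ] H) := cfcHom ha
  let ι : C(spectrum ℂ a, ℝ) → C(spectrum ℂ a, ℂ) := fun f =>
    ⟨fun z => (f z : ℂ), by fun_prop⟩
  have hsq : ∀ g : C(spectrum ℂ a, ℂ), inner ℂ x (φ (star g * g) x) = (‖φ g x‖ ^ 2 : ℂ) := by
    intro g
    rw [map_mul, map_star, ContinuousLinearMap.star_eq_adjoint, mul_apply_eq_comp,
      ContinuousLinearMap.adjoint_inner_right, inner_self_eq_norm_sq_to_K]
    rfl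
  -- Riesz–Markov–Kakutani is applied to real functions on the compact spectrum. Positivity of L
  -- comes from writing f ≥ 0 as star g * g with g = √f and using `hsq`; complex functions follow by
  -- splitting into real and imaginary parts.
  let L : CompactlySupportedContinuousMap (spectrum ℂ a) ℝ →ₗ[ℝ] ℝ :=
    { toFun := fun f => (inner ℂ x (φ (ι f.toContinuousMap) x)).re
      map_add' := fun f g => by
        have : ι (f + g).toContinuousMap = ι f.toContinuousMap + ι g.toContinuousMap := by
          ext z
          simp [ι]
        rw [this, map_add, add_apply, inner_add_right, Complex.add_re]
      map_smul' := fun c f => by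
        have : ι (c • f).toContinuousMap = (c : ℂ) • ι f.toContinuousMap := by
          ext z
          simp [ι]
        rw [this, map_smul, smul_apply, inner_smul_right]
        simp }
  have hL : ∀ f, 0 ≤ f → 0 ≤ L f := by
    intro f hf
    let g : C(spectrum ℂ a, ℂ) := ⟨fun z => (Real.sqrt (f z) : ℂ), by fun_prop⟩
    have : ι f.toContinuousMap = star g * g := by
      ext z
      have h0 : 0 ≤ f z := hf z
      simp only [ι, g, ContinuousMap.coe_mk, ContinuousMap.mul_apply, ContinuousMap.star_apply,
        RCLike.star_def, Complex.conj_ofReal, CompactlySupportedContinuousMap.coe_toContinuousMap]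
      rw [← Complex.ofReal_mul, Real.mul_self_sqrt h0]
    change 0 ≤ (inner ℂ x (φ (ι f.toContinuousMap) x)).re
    rw [this, hsq]
    norm_cast
    positivity
  let Λ : CompactlySupportedContinuousMap (spectrum ℂ a) ℝ →ₚ[ℝ] ℝ := PositiveLinearMap.mk₀ L hL
  have hΛ : ∀ f : C(spectrum ℂ a, ℝ), ∫ z, f z ∂(RealRMK.rieszMeasure Λ) =
      (inner ℂ x (φ (ι f) x)).re := fun f =>
    RealRMK.integral_rieszMeasure Λ ⟨f, HasCompactSupport.of_compactSpace _⟩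
  have hreal : ∀ f : C(spectrum ℂ a, ℝ), ((inner ℂ x (φ (ι f) x)).re : ℂ) =
      inner ℂ x (φ (ι f) x) := by
    intro f
    have hs : star (ι f) = ι f := by
      ext z
      simp [ι]
    have : (starRingEnd ℂ) (inner ℂ x (φ (ι f) x)) = inner ℂ x (φ (ι f) x) := by
      rw [inner_conj_symm, ← ContinuousLinearMap.adjoint_inner_right,
        ← ContinuousLinearMap.star_eq_adjoint, ← map_star, hs]
    exact Complex.conj_eq_iff_re.1 this
  have hfin : IsFiniteMeasure (RealRMK.rieszMeasure Λ) :=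
    ⟨(isCompact_univ (X := spectrum ℂ a)).measure_lt_top⟩
  refine ⟨RealRMK.rieszMeasure Λ, hfin, fun g => ?_⟩
  let gr : C(spectrum ℂ a, ℝ) := ⟨fun z => (g z).re, by fun_prop⟩
  let gi : C(spectrum ℂ a, ℝ) := ⟨fun z => (g z).im, by fun_prop⟩
  have hg : g = ι gr + Complex.I • ι gi := by
    ext z
    simp only [ι, gr, gi, ContinuousMap.coe_mk, ContinuousMap.add_apply, ContinuousMap.smul_apply,
      smul_eq_mul]
    rw [mul_comm, Complex.re_add_im]
  have hint : ∫ z, g z ∂(RealRMK.rieszMeasure Λ) =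
      ((∫ z, gr z ∂(RealRMK.rieszMeasure Λ) : ℝ) : ℂ)
        + Complex.I * ((∫ z, gi z ∂(RealRMK.rieszMeasure Λ) : ℝ) : ℂ) := by
    rw [← integral_complex_ofReal, ← integral_complex_ofReal, ← integral_const_mul,
      ← integral_add (f := fun z => (gr z : ℂ)) (g := fun z => Complex.I * (gi z : ℂ))
        (integrable_continuousMap _ (ι gr)) ((integrable_continuousMap _ (ι gi)).const_mul _)]
    refine integral_congr_ae (Eventually.of_forall fun z => ?_)
    simp only [gr, gi, ContinuousMap.coe_mk]
    rw [mul_comm, Complex.re_add_im]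
  rw [hint, hΛ, hΛ, hreal, hreal]
  change _ = inner ℂ x (φ g x)
  conv_rhs => rw [hg]
  rw [map_add, map_smul, add_apply, smul_apply,
    inner_add_right, inner_smul_right]

/-- Existence of the spectral measure of a unitary operator with respect to a vector. -/
theorem exists_isSpectralMeasure (W : H ≃ₗᵢ[ℂ] H) (x : H) :
    ∃ μ, IsSpectralMeasure W x μ := by
  let U : unitary (H →L[ℂ] H) := Unitary.linearIsometryEquiv.symm W
  let a : H →L[ℂ] H := U
  have haW : ∀ y, a y = W y := fun y => rfl
  have ha : IsStarNormal a := Unitary.coe_isStarNormal U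
  obtain ⟨ρ, hρ, hint⟩ := exists_measure_cfcHom ha x
  have hcirc : ∀ z : spectrum ℂ a, ‖(z : ℂ)‖ = 1 := fun z => by
    simpa using spectrum.subset_circle_of_unitary U.2 z.2
  -- The argument is discontinuous on the negative axis, but measurability suffices for a
  -- push-forward, and e^{inζ(z)} = zⁿ because the spectrum lies on the unit circle.
  let ζ : spectrum ℂ a → AddCircle (2 * Real.pi) := fun z => ((Complex.arg z : ℝ) : AddCircle _)
  have hζ : Measurable ζ :=
    (AddCircle.measurable_mk').comp (Complex.measurable_arg.comp measurable_subtype_coe)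
  have hfz : ∀ (n : ℤ) z, fourier n (ζ z) = (z : ℂ) ^ n := by
    intro n z
    have : (z : ℂ) = Complex.exp (Complex.arg z * Complex.I) := by
      have := Complex.norm_mul_exp_arg_mul_I (z : ℂ)
      rw [hcirc, Complex.ofReal_one, one_mul] at this
      exact this.symm
    rw [fourier_two_pi]
    conv_rhs => rw [this]
    rw [← Complex.exp_int_mul]
    ring_nf
  refine ⟨ρ.map ζ, Measure.isFiniteMeasure_map ρ ζ, ?_⟩
  have hmap : ∀ n : ℤ, ∫ θ, fourier n θ ∂(ρ.map ζ) = ∫ z : spectrum ℂ a, (z : ℂ) ^ n ∂ρ := by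
    intro n
    rw [integral_map hζ.aemeasurable (by fun_prop)]
    simp_rw [hfz]
  have hnat : ∀ n : ℕ, ∫ θ, fourier (n : ℤ) θ ∂(ρ.map ζ) = (inner ℂ x ((W ^ (n : ℤ)) x) : ℂ) := by
    intro n
    rw [hmap]
    have h := hint ((ContinuousMap.restrict (spectrum ℂ a) (ContinuousMap.id ℂ)) ^ n)
    rw [map_pow, cfcHom_id] at h
    simp only [zpow_natCast]
    have hp : (a ^ n) x = (W ^ n) x := by
      rw [coe_npow_apply, FunLike.coe_pow_eq_iterate]
      rfl
    rw [hp] at h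
    rw [← h]
    rfl
  intro n
  obtain ⟨m, rfl | rfl⟩ := n.eq_nat_or_neg
  · exact hnat m
  · rw [inner_zpow_neg, ← hnat m, ← integral_conj]
    simp_rw [fourier_neg]

end SpectralExistence

/-! ### Trigonometric polynomials, uniqueness, and the spectral isometry -/

section SpectralMeasure

theorem exists_fourier_near (f : C(AddCircle (2 * Real.pi), ℂ)) {ε : ℝ} (hε : 0 < ε) :
    ∃ c : ℤ →₀ ℂ, ‖f - c.sum fun n a => a • fourier n‖ < ε := by
  have h : f ∈ (Submodule.span ℂ (Set.range (fourier (T := 2 * Real.pi)))).topologicalClosure := by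
    rw [span_fourier_closure_eq_top]
    trivial
  obtain ⟨g, hg, hfg⟩ := Metric.mem_closure_iff.1 h ε hε
  obtain ⟨c, rfl⟩ := Finsupp.mem_span_range_iff_exists_finsupp.1 hg
  exact ⟨c, by rwa [← dist_eq_norm]⟩

theorem exists_fourier_tendsto (f : C(AddCircle (2 * Real.pi), ℂ)) :
    ∃ c : ℕ → ℤ →₀ ℂ, Tendsto (fun k => (c k).sum fun n a => a • fourier n) atTop (𝓝 f) := by
  choose c hc using fun k : ℕ => exists_fourier_near f (Nat.one_div_pos_of_nat (α := ℝ) (n := k))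
  refine ⟨c, tendsto_iff_norm_sub_tendsto_zero.2 ?_⟩
  refine squeeze_zero (fun _ => norm_nonneg _) (fun k => ?_) tendsto_one_div_add_atTop_nhds_zero_nat
  rw [norm_sub_rev]
  exact (hc k).le

/-- Used with Φ the identity and with Φ the squared norm, to extend statements from trigonometric
polynomials to continuous functions. A convergent sequence is bounded in the sup norm, which gives
the dominating constant. -/
theorem tendsto_integral_of_tendsto {μ : Measure (AddCircle (2 * Real.pi))} [IsFiniteMeasure μ]
    {g : ℕ → C(AddCircle (2 * Real.pi), ℂ)} {f : C(AddCircle (2 * Real.pi), ℂ)}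
    (h : Tendsto g atTop (𝓝 f)) {E : Type*} [NormedAddCommGroup E] [NormedSpace ℝ E]
    (Φ : C(ℂ, E)) [SecondCountableTopology E] :
    Tendsto (fun k => ∫ θ, Φ (g k θ) ∂μ) atTop (𝓝 (∫ θ, Φ (f θ) ∂μ)) := by
  have h1 : Tendsto (fun k => Φ.comp (g k)) atTop (𝓝 (Φ.comp f)) :=
    ((ContinuousMap.continuous_postcomp Φ).tendsto f).comp h
  obtain ⟨C, hC⟩ := h1.norm.bddAbove_range
  refine tendsto_integral_of_dominated_convergence (fun _ => C)
    (fun k => (Φ.comp (g k)).continuous.aestronglyMeasurable) (integrable_const C) (fun k => ?_) ?_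
  · exact Eventually.of_forall fun θ => ((Φ.comp (g k)).norm_coe_le_norm θ).trans
      (hC ⟨k, rfl⟩)
  · exact Eventually.of_forall fun θ => ((continuous_eval_const θ).tendsto _).comp h1

/-- Trigonometric polynomials are uniformly dense in the continuous functions, and these determine a
finite Borel measure. -/
theorem measure_ext_of_fourier {μ ν : Measure (AddCircle (2 * Real.pi))} [IsFiniteMeasure μ]
    [IsFiniteMeasure ν] (h : ∀ n : ℤ, ∫ θ, fourier n θ ∂μ = ∫ θ, fourier n θ ∂ν) : μ = ν := by
  have hp : ∀ (c : ℤ →₀ ℂ) (κ : Measure (AddCircle (2 * Real.pi))) [IsFiniteMeasure κ],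
      ∫ θ, (c.sum fun n a => a • fourier n) θ ∂κ = c.sum fun n a => a * ∫ θ, fourier n θ ∂κ := by
    intro c κ _
    simp only [Finsupp.sum, ContinuousMap.coe_sum, Finset.sum_apply, ContinuousMap.coe_smul,
      Pi.smul_apply, smul_eq_mul]
    rw [integral_finsetSum _ fun n _ => (integrable_continuousMap _ (fourier n)).const_mul _]
    simp_rw [integral_const_mul]
  have hc : ∀ f : C(AddCircle (2 * Real.pi), ℂ), ∫ θ, f θ ∂μ = ∫ θ, f θ ∂ν := by
    intro f
    obtain ⟨c, hc⟩ := exists_fourier_tendsto f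
    refine tendsto_nhds_unique (tendsto_integral_of_tendsto hc (ContinuousMap.id ℂ)) ?_
    refine (tendsto_integral_of_tendsto hc (ContinuousMap.id ℂ)).congr fun k => ?_
    simp only [ContinuousMap.id_apply]
    rw [hp, hp]
    simp_rw [h]
  refine ext_of_forall_integral_eq_of_IsFiniteMeasure fun f => ?_
  have := hc ⟨fun θ => (f θ : ℂ), by fun_prop⟩
  simp only [ContinuousMap.coe_mk] at this
  rw [integral_complex_ofReal, integral_complex_ofReal] at this
  exact_mod_cast this

/-- Kept general in κ so that it serves both the spectral isometry and Parseval for Haar measure. -/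
theorem integral_norm_sq_sum (κ : Measure (AddCircle (2 * Real.pi))) [IsFiniteMeasure κ]
    (c : ℤ →₀ ℂ) :
    ((∫ θ, ‖(c.sum fun n a => a • fourier n) θ‖ ^ 2 ∂κ : ℝ) : ℂ) =
      ∑ m ∈ c.support, ∑ n ∈ c.support,
        (starRingEnd ℂ (c m) * c n) * ∫ θ, fourier (n - m) θ ∂κ := by
  have e1 : ∀ θ : AddCircle (2 * Real.pi),
      ((‖(c.sum fun n a => a • fourier n) θ‖ ^ 2 : ℝ) : ℂ) =
      ∑ m ∈ c.support, ∑ n ∈ c.support, (starRingEnd ℂ (c m) * c n) * fourier (n - m) θ := by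
    intro θ
    rw [← Complex.normSq_eq_norm_sq, Complex.normSq_eq_conj_mul_self]
    simp only [Finsupp.sum, ContinuousMap.coe_sum, Finset.sum_apply, ContinuousMap.coe_smul,
      Pi.smul_apply, smul_eq_mul]
    rw [map_sum, Finset.sum_mul_sum]
    refine Finset.sum_congr rfl fun m _ => Finset.sum_congr rfl fun n _ => ?_
    rw [map_mul, ← fourier_neg, sub_eq_add_neg, fourier_add]
    ring
  rw [← integral_complex_ofReal]
  simp_rw [e1]
  rw [integral_finsetSum _ fun m _ => integrable_finsetSum _ fun n _ =>
    (integrable_continuousMap _ (fourier (n - m))).const_mul _]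
  refine Finset.sum_congr rfl fun m _ => ?_
  rw [integral_finsetSum _ fun n _ => (integrable_continuousMap _ (fourier (n - m))).const_mul _]
  simp_rw [integral_const_mul]

variable {H : Type*} [NormedAddCommGroup H] [InnerProductSpace ℂ H] {W : H ≃ₗᵢ[ℂ] H} {x : H}
  {μ : Measure (AddCircle (2 * Real.pi))}

theorem IsSpectralMeasure.unique {ν : Measure (AddCircle (2 * Real.pi))}
    (hμ : IsSpectralMeasure W x μ) (hν : IsSpectralMeasure W x ν) : μ = ν := by
  have := hμ.1
  have := hν.1
  exact measure_ext_of_fourier fun n => (hμ.2 n).trans (hν.2 n).symm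

theorem IsSpectralMeasure.integral_sum (hμ : IsSpectralMeasure W x μ) (c : ℤ →₀ ℂ) :
    ∫ θ, (c.sum fun n a => a • fourier n) θ ∂μ = c.sum fun n a => a * inner ℂ x ((W ^ n) x) := by
  have := hμ.1
  simp only [Finsupp.sum, ContinuousMap.coe_sum, Finset.sum_apply, ContinuousMap.coe_smul,
    Pi.smul_apply, smul_eq_mul]
  rw [integral_finsetSum _ fun n _ => (integrable_continuousMap _ (fourier n)).const_mul _]
  simp_rw [integral_const_mul, hμ.2]

/-- The spectral isometry p ↦ p(W)x from L²(μ): both sides expand into the same double sum, because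
⟨Wᵐx, Wⁿx⟩ depends only on n - m. -/
theorem IsSpectralMeasure.integral_norm_sq (hμ : IsSpectralMeasure W x μ) (c : ℤ →₀ ℂ) :
    ∫ θ, ‖(c.sum fun n a => a • fourier n) θ‖ ^ 2 ∂μ = ‖c.sum fun n a => a • (W ^ n) x‖ ^ 2 := by
  have := hμ.1
  have e2 : ((‖c.sum fun n a => a • (W ^ n) x‖ ^ 2 : ℝ) : ℂ) =
      ∑ m ∈ c.support, ∑ n ∈ c.support,
        (starRingEnd ℂ (c m) * c n) * inner ℂ x ((W ^ (n - m)) x) := by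
    have h := inner_self_eq_norm_sq_to_K (𝕜 := ℂ) (c.sum fun n a => a • (W ^ n) x)
    push_cast
    refine Eq.trans (by exact h.symm) ?_
    simp only [Finsupp.sum]
    rw [sum_inner]
    refine Finset.sum_congr rfl fun m _ => ?_
    rw [inner_sum]
    refine Finset.sum_congr rfl fun n _ => ?_
    rw [inner_smul_left, inner_smul_right, inner_zpow_zpow]
    ring
  apply Complex.ofReal_injective
  rw [e2, integral_norm_sq_sum]
  simp_rw [hμ.2]

theorem IsSpectralMeasure.real_univ (hμ : IsSpectralMeasure W x μ) :
    μ.real Set.univ = ‖x‖ ^ 2 := by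
  have := hμ.1
  have h := hμ.2 0
  simp only [fourier_zero, zpow_zero, integral_const, LinearIsometryEquiv.coe_one, id] at h
  rw [inner_self_eq_norm_sq_to_K] at h
  have h2 : ((μ.real Set.univ : ℝ) : ℂ) = ((‖x‖ ^ 2 : ℝ) : ℂ) := by
    push_cast
    simpa using h
  exact_mod_cast h2

/-- The spectral measures of `y`, `z`, and `y + z`. -/
theorem IsSpectralMeasure.integral_le_of_add {y z : H}
    {ν κ : Measure (AddCircle (2 * Real.pi))} (hμ : IsSpectralMeasure W (y + z) μ)
    (hν : IsSpectralMeasure W y ν) (hκ : IsSpectralMeasure W z κ)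
    (f : C(AddCircle (2 * Real.pi), ℂ)) :
    ∫ θ, ‖f θ‖ ^ 2 ∂μ ≤ 2 * ∫ θ, ‖f θ‖ ^ 2 ∂ν + 2 * ∫ θ, ‖f θ‖ ^ 2 ∂κ := by
  have := hμ.1
  have := hν.1
  have := hκ.1
  obtain ⟨c, hc⟩ := exists_fourier_tendsto f
  let Φ : C(ℂ, ℝ) := ⟨fun z => ‖z‖ ^ 2, by fun_prop⟩
  have h1 := tendsto_integral_of_tendsto (μ := μ) hc Φ
  have h2 := tendsto_integral_of_tendsto (μ := ν) hc Φ
  have h3 := tendsto_integral_of_tendsto (μ := κ) hc Φ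
  refine le_of_tendsto_of_tendsto' h1 ((h2.const_mul 2).add (h3.const_mul 2)) fun k => ?_
  simp only [Φ, ContinuousMap.coe_mk]
  rw [hμ.integral_norm_sq, hν.integral_norm_sq, hκ.integral_norm_sq]
  -- The spectral isometry has reduced the claim to ‖p(W)(y + z)‖² ≤ 2‖p(W)y‖² + 2‖p(W)z‖² for a
  -- trigonometric polynomial p.
  have e : ((c k).sum fun n a => a • (W ^ n) (y + z)) =
      ((c k).sum fun n a => a • (W ^ n) y) + (c k).sum fun n a => a • (W ^ n) z := by
    simp only [Finsupp.sum, map_add, smul_add, Finset.sum_add_distrib]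
  rw [e]
  have := norm_add_le ((c k).sum fun n a => a • (W ^ n) y) ((c k).sum fun n a => a • (W ^ n) z)
  nlinarith [norm_nonneg (((c k).sum fun n a => a • (W ^ n) y) + (c k).sum fun n a => a • (W ^ n) z),
    sq_nonneg (‖(c k).sum fun n a => a • (W ^ n) y‖ - ‖(c k).sum fun n a => a • (W ^ n) z‖)]

end SpectralMeasure
end BargmannFock
end

noncomputable section
namespace BargmannFock

/-! ### Absolute continuity from square-summable correlations -/

section AbsolutelyContinuous

theorem integral_fourier_haar (n : ℤ) :
    ∫ θ, fourier n θ ∂(AddCircle.haarAddCircle (T := 2 * Real.pi)) = if n = 0 then 1 else 0 := by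
  have h := (orthonormal_iff_ite.1 (orthonormal_fourier (T := 2 * Real.pi))) 0 n
  rw [ContinuousMap.inner_toLp (𝕜 := ℂ) AddCircle.haarAddCircle (fourier 0) (fourier n)] at h
  simp only [fourier_zero, map_one, mul_one] at h
  rw [h]
  simp [eq_comm]

theorem integral_norm_sq_sum_haar (c : ℤ →₀ ℂ) :
    ∫ θ, ‖(c.sum fun n a => a • fourier n) θ‖ ^ 2 ∂(AddCircle.haarAddCircle (T := 2 * Real.pi)) =
      ∑ n ∈ c.support, ‖c n‖ ^ 2 := by
  apply Complex.ofReal_injective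
  rw [integral_norm_sq_sum]
  simp_rw [integral_fourier_haar]
  push_cast
  refine Finset.sum_congr rfl fun m hm => ?_
  rw [Finset.sum_eq_single m (fun n _ hn => by rw [if_neg (sub_ne_zero.2 hn), mul_zero])
    (fun h => absurd hm h)]
  rw [sub_self, if_pos rfl, mul_one, ← Complex.normSq_eq_conj_mul_self, Complex.normSq_eq_norm_sq]
  push_cast
  rfl

/-- Inner regularity reduces null sets to compact ones; `volume` is a positive multiple of
normalized Haar measure. -/
theorem absolutelyContinuous_of_isCompact {μ : Measure (AddCircle (2 * Real.pi))}
    [IsFiniteMeasure μ]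
    (h : ∀ K, IsCompact K → AddCircle.haarAddCircle K = 0 → μ.real K = 0) :
    μ ≪ (volume : Measure (AddCircle (2 * Real.pi))) := by
  refine Measure.AbsolutelyContinuous.mk fun s hs h0 => ?_
  rw [hs.measure_eq_iSup_isCompact]
  simp only [ENNReal.iSup_eq_zero]
  intro K hK hKc
  have h1 : AddCircle.haarAddCircle K = 0 := by
    have := measure_mono_null hK h0
    rw [AddCircle.volume_eq_smul_haarAddCircle, Measure.smul_apply, smul_eq_mul, mul_eq_zero] at this
    rcases this with h2 | h2
    · exact absurd h2 (by simp [Real.pi_pos])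
    · exact h2
  have := h K hKc h1
  rwa [measureReal_eq_zero_iff] at this

/-- A continuous function between the indicators of a compact set and of a neighbourhood. -/
theorem exists_continuous_between {K U : Set (AddCircle (2 * Real.pi))} (hK : IsCompact K)
    (hU : IsOpen U) (hKU : K ⊆ U) : ∃ f : C(AddCircle (2 * Real.pi), ℂ),
      (∀ θ, f θ = ((f θ).re : ℂ)) ∧ (∀ θ, K.indicator 1 θ ≤ (f θ).re) ∧
      (∀ θ, K.indicator 1 θ ≤ ‖f θ‖ ^ 2) ∧ (∀ θ, ‖f θ‖ ^ 2 ≤ U.indicator 1 θ) := by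
  obtain ⟨f, hf1, hf0, -, hf⟩ := exists_continuous_one_zero_of_isCompact hK hU.isClosed_compl
    (Set.disjoint_compl_right_iff_subset.2 hKU)
  refine ⟨⟨fun θ => (f θ : ℂ), by fun_prop⟩, fun θ => by simp, fun θ => ?_, fun θ => ?_,
    fun θ => ?_⟩
  · by_cases h : θ ∈ K
    · simp [h, hf1 h]
    · simp [h, (hf θ).1]
  · by_cases h : θ ∈ K
    · simp [h, hf1 h]
    · simp only [h, not_false_eq_true, Set.indicator_of_notMem]
      positivity
  · by_cases h : θ ∈ U
    · simp only [ContinuousMap.coe_mk, Complex.norm_real, Real.norm_eq_abs, sq_abs, h,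
        Set.indicator_of_mem, Pi.one_apply]
      have := hf θ
      exact pow_le_one₀ this.1 this.2
    · have : f θ = 0 := hf0 h
      simp [h, this]

variable {H : Type*} [NormedAddCommGroup H] [InnerProductSpace ℂ H] {W : H ≃ₗᵢ[ℂ] H} {x : H}
  {μ : Measure (AddCircle (2 * Real.pi))}

/-- For a trigonometric polynomial the integral is Σ cₙ⟨x, Wⁿx⟩, so Cauchy–Schwarz and Parseval
bound it by the L² norm for Haar measure; density does the rest. In effect, μ has a
square-integrable density. -/
theorem IsSpectralMeasure.norm_integral_sq_le (hμ : IsSpectralMeasure W x μ)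
    (hs : Summable fun n : ℤ => ‖(inner ℂ x ((W ^ n) x) : ℂ)‖ ^ 2)
    (f : C(AddCircle (2 * Real.pi), ℂ)) :
    ‖∫ θ, f θ ∂μ‖ ^ 2 ≤ (∑' n : ℤ, ‖(inner ℂ x ((W ^ n) x) : ℂ)‖ ^ 2) *
      ∫ θ, ‖f θ‖ ^ 2 ∂AddCircle.haarAddCircle := by
  have := hμ.1
  obtain ⟨c, hc⟩ := exists_fourier_tendsto f
  have h1 := tendsto_integral_of_tendsto (μ := μ) hc (ContinuousMap.id ℂ)
  have h2 := tendsto_integral_of_tendsto (μ := AddCircle.haarAddCircle) hc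
    (⟨fun z => ‖z‖ ^ 2, by fun_prop⟩ : C(ℂ, ℝ))
  refine le_of_tendsto_of_tendsto' (h1.norm.pow 2) (h2.const_mul _) fun k => ?_
  simp only [ContinuousMap.coe_mk, ContinuousMap.id_apply]
  rw [hμ.integral_sum, integral_norm_sq_sum_haar]
  have h3 : ‖(c k).sum fun n a => a * inner ℂ x ((W ^ n) x)‖ ≤
      ∑ n ∈ (c k).support, ‖c k n‖ * ‖(inner ℂ x ((W ^ n) x) : ℂ)‖ :=
    (norm_sum_le _ _).trans_eq (Finset.sum_congr rfl fun n _ => norm_mul _ _)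
  calc _ ≤ (∑ n ∈ (c k).support, ‖c k n‖ * ‖(inner ℂ x ((W ^ n) x) : ℂ)‖) ^ 2 := by gcongr
    _ ≤ (∑ n ∈ (c k).support, ‖c k n‖ ^ 2) *
        ∑ n ∈ (c k).support, ‖(inner ℂ x ((W ^ n) x) : ℂ)‖ ^ 2 :=
      Finset.sum_mul_sq_le_sq_mul_sq _ _ _
    _ ≤ (∑ n ∈ (c k).support, ‖c k n‖ ^ 2) * ∑' n : ℤ, ‖(inner ℂ x ((W ^ n) x) : ℂ)‖ ^ 2 := by
      gcongr
      exact hs.sum_le_tsum _ fun _ _ => by positivity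
    _ = _ := mul_comm _ _

theorem integral_norm_sq_le_real (κ : Measure (AddCircle (2 * Real.pi))) [IsFiniteMeasure κ]
    {f : C(AddCircle (2 * Real.pi), ℂ)} {U : Set (AddCircle (2 * Real.pi))} (hU : IsOpen U)
    (hf : ∀ θ, ‖f θ‖ ^ 2 ≤ U.indicator 1 θ) : ∫ θ, ‖f θ‖ ^ 2 ∂κ ≤ κ.real U := by
  rw [← integral_indicator_one hU.measurableSet]
  exact integral_mono (integrable_continuousMap κ (⟨fun θ => ‖f θ‖ ^ 2, by fun_prop⟩ : C(_, ℝ)))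
    ((integrable_const 1).indicator hU.measurableSet) hf

/-- A spectral measure with square-summable moments is absolutely continuous. -/
theorem IsSpectralMeasure.real_eq_zero (hμ : IsSpectralMeasure W x μ)
    (hs : Summable fun n : ℤ => ‖(inner ℂ x ((W ^ n) x) : ℂ)‖ ^ 2)
    {K : Set (AddCircle (2 * Real.pi))} (hK : IsCompact K)
    (h0 : AddCircle.haarAddCircle K = 0) : μ.real K = 0 := by
  have := hμ.1
  set M := ∑' n : ℤ, ‖(inner ℂ x ((W ^ n) x) : ℂ)‖ ^ 2
  have hM : 0 ≤ M := tsum_nonneg fun _ => by positivity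
  -- The L² bound is tested on a function squeezed between K and an open neighbourhood of Haar
  -- measure below ε.
  have key : ∀ ε > 0, μ.real K ^ 2 ≤ M * ε := by
    intro ε hε
    obtain ⟨U, hKU, hU, hUε⟩ := K.exists_isOpen_lt_of_lt (μ := AddCircle.haarAddCircle)
      (ENNReal.ofReal ε) (by rw [h0]; simpa using hε)
    obtain ⟨f, hf, hf1, -, hf2⟩ := exists_continuous_between hK hU hKU
    have h1 : μ.real K ≤ ‖∫ θ, f θ ∂μ‖ := by
      have e : ∫ θ, f θ ∂μ = ((∫ θ, (f θ).re ∂μ : ℝ) : ℂ) := by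
        rw [← integral_complex_ofReal]
        exact integral_congr_ae (Eventually.of_forall hf)
      rw [e, Complex.norm_real]
      refine le_trans ?_ (le_abs_self _)
      rw [← integral_indicator_one hK.measurableSet]
      exact integral_mono ((integrable_const 1).indicator hK.measurableSet)
        (integrable_continuousMap μ (⟨fun θ => (f θ).re, by fun_prop⟩ : C(_, ℝ))) hf1
    calc μ.real K ^ 2 ≤ ‖∫ θ, f θ ∂μ‖ ^ 2 := by gcongr
      _ ≤ M * ∫ θ, ‖f θ‖ ^ 2 ∂AddCircle.haarAddCircle := hμ.norm_integral_sq_le hs f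
      _ ≤ M * ε := by
        gcongr
        refine (integral_norm_sq_le_real _ hU hf2).trans ?_
        rw [measureReal_def]
        exact ENNReal.toReal_le_of_le_ofReal hε.le hUε.le
  have h2 : μ.real K ^ 2 ≤ 0 := by
    refine le_of_forall_pos_le_add fun ε hε => ?_
    have := key (ε / (M + 1)) (by positivity)
    refine this.trans ?_
    rw [zero_add, mul_div_assoc', div_le_iff₀ (by positivity)]
    nlinarith
  exact pow_eq_zero_iff (two_ne_zero) |>.1 (le_antisymm h2 (sq_nonneg _))

/-- Perturbation estimate: the error z enters only through the total mass ‖z‖² of its spectral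
measure, uniformly in K. -/
theorem IsSpectralMeasure.real_le_of_add {y z : H}
    {ν κ : Measure (AddCircle (2 * Real.pi))} (hμ : IsSpectralMeasure W (y + z) μ)
    (hν : IsSpectralMeasure W y ν) (hκ : IsSpectralMeasure W z κ)
    {K : Set (AddCircle (2 * Real.pi))} (hK : IsCompact K) :
    μ.real K ≤ 2 * ν.real K + 2 * ‖z‖ ^ 2 := by
  have := hμ.1
  have := hν.1
  have := hκ.1
  refine le_of_forall_pos_le_add fun ε hε => ?_
  obtain ⟨U, hKU, hU, hUε⟩ := K.exists_isOpen_lt_of_lt (μ := ν)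
    (ν K + ENNReal.ofReal (ε / 2))
    (ENNReal.lt_add_right (measure_ne_top _ _) (by simpa using hε))
  obtain ⟨f, -, -, hf1, hf2⟩ := exists_continuous_between hK hU hKU
  have hUr : ν.real U ≤ ν.real K + ε / 2 := by
    have := ENNReal.toReal_mono (by finiteness) hUε.le
    rwa [ENNReal.toReal_add (by finiteness) (by finiteness),
      ENNReal.toReal_ofReal (by positivity)] at this
  have h1 : μ.real K ≤ ∫ θ, ‖f θ‖ ^ 2 ∂μ := by
    rw [← integral_indicator_one hK.measurableSet]
    exact integral_mono ((integrable_const 1).indicator hK.measurableSet)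
      (integrable_continuousMap μ (⟨fun θ => ‖f θ‖ ^ 2, by fun_prop⟩ : C(_, ℝ))) hf1
  have h2 := integral_norm_sq_le_real ν hU hf2
  have h3 : ∫ θ, ‖f θ‖ ^ 2 ∂κ ≤ ‖z‖ ^ 2 := by
    rw [← hκ.real_univ]
    refine integral_norm_sq_le_real κ isOpen_univ fun θ => (hf2 θ).trans ?_
    exact Set.indicator_le_indicator_of_subset (Set.subset_univ _) (fun _ => zero_le_one) θ
  linarith [hμ.integral_le_of_add hν hκ f]

/-- Vectors with absolutely continuous spectral measure form a closed set, tested here on vectors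
with square-summable correlations. -/
theorem IsSpectralMeasure.absolutelyContinuous [CompleteSpace H] (hμ : IsSpectralMeasure W x μ)
    (h : ∀ ε > 0, ∃ y : H, ‖x - y‖ ^ 2 ≤ ε ∧
      Summable fun n : ℤ => ‖(inner ℂ y ((W ^ n) y) : ℂ)‖ ^ 2) :
    μ ≪ (volume : Measure (AddCircle (2 * Real.pi))) := by
  have := hμ.1
  refine absolutelyContinuous_of_isCompact fun K hK h0 => ?_
  refine le_antisymm (le_of_forall_pos_le_add fun ε hε => ?_) measureReal_nonneg
  obtain ⟨y, hy, hs⟩ := h (ε / 2) (by positivity)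
  obtain ⟨ν, hν⟩ := exists_isSpectralMeasure W y
  obtain ⟨κ, hκ⟩ := exists_isSpectralMeasure W (x - y)
  have h1 : IsSpectralMeasure W (y + (x - y)) μ := by rwa [add_sub_cancel]
  have := h1.real_le_of_add hν hκ hK
  rw [hν.real_eq_zero hs hK h0] at this
  linarith

end AbsolutelyContinuous

/-! ### Atoms and jumps -/

section Atoms

theorem tendsto_mean_pow {z : ℂ} (hz : ‖z‖ = 1) :
    Tendsto (fun N : ℕ => (N : ℂ)⁻¹ * ∑ n ∈ Finset.range N, z ^ n) atTop
      (𝓝 (if z = 1 then 1 else 0)) := by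
  split_ifs with h
  · refine tendsto_const_nhds.congr' ?_
    filter_upwards [eventually_gt_atTop 0] with N hN
    have : (N : ℂ) ≠ 0 := by exact_mod_cast hN.ne'
    simp [h, this]
  · have hpos : 0 < ‖z - 1‖ := norm_pos_iff.2 (sub_ne_zero.2 h)
    have hlim : Tendsto (fun N : ℕ => 2 / ‖z - 1‖ * (N : ℝ)⁻¹) atTop (𝓝 0) := by
      simpa using (tendsto_inv_atTop_nhds_zero_nat (𝕜 := ℝ)).const_mul (2 / ‖z - 1‖)
    refine squeeze_zero_norm (fun N => ?_) hlim
    rw [geom_sum_eq h, norm_mul, norm_inv, norm_div, mul_comm, Complex.norm_natCast]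
    gcongr
    refine (norm_sub_le _ _).trans ?_
    rw [norm_pow, hz, norm_one, one_pow]
    norm_num

theorem norm_mean_pow_le {z : ℂ} (hz : ‖z‖ = 1) (N : ℕ) :
    ‖(N : ℂ)⁻¹ * ∑ n ∈ Finset.range N, z ^ n‖ ≤ 1 := by
  rcases N.eq_zero_or_pos with rfl | hN
  · simp
  have h : ‖∑ n ∈ Finset.range N, z ^ n‖ ≤ N := by
    refine (norm_sum_le _ _).trans ?_
    simp [hz]
  rw [norm_mul, norm_inv, Complex.norm_natCast, inv_mul_le_iff₀ (by exact_mod_cast hN), mul_one]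
  exact h

theorem fourier_eq_pow (n : ℕ) (θ : AddCircle (2 * Real.pi)) :
    fourier (n : ℤ) θ = fourier 1 θ ^ n := by
  rw [fourier_apply, fourier_apply, one_zsmul, natCast_zsmul, AddCircle.toCircle_nsmul]
  rfl

theorem norm_fourier (n : ℤ) (θ : AddCircle (2 * Real.pi)) : ‖fourier n θ‖ = 1 := by
  rw [fourier_apply]
  exact Circle.norm_coe _

theorem fourier_one_injective {θ φ : AddCircle (2 * Real.pi)} :
    fourier 1 θ = fourier 1 φ ↔ θ = φ := by
  rw [fourier_one, fourier_one, Circle.coe_inj]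
  exact (AddCircle.injective_toCircle (Fact.out : 0 < 2 * Real.pi).ne').eq_iff

variable {H : Type*} [NormedAddCommGroup H] [InnerProductSpace ℂ H] {W : H ≃ₗᵢ[ℂ] H} {x : H}
  {μ : Measure (AddCircle (2 * Real.pi))}

/-- **Wiener's theorem**, for measures without atoms. -/
theorem IsSpectralMeasure.tendsto_mean_norm_sq (hμ : IsSpectralMeasure W x μ)
    (h : ∀ θ, μ {θ} = 0) :
    Tendsto (fun N : ℕ => (N : ℝ)⁻¹ * ∑ n ∈ Finset.range N, ‖(inner ℂ x ((W ^ n) x) : ℂ)‖ ^ 2)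
      atTop (𝓝 0) := by
  have := hμ.1
  -- Means of e^{in(θ-φ)}. Their integral against μ × μ is the mean of the squared moments, while
  -- pointwise they tend to the indicator of the diagonal, which is a null set by Fubini when μ has
  -- no atoms.
  let F : ℕ → AddCircle (2 * Real.pi) × AddCircle (2 * Real.pi) → ℂ := fun N p =>
    (N : ℂ)⁻¹ * ∑ n ∈ Finset.range N, (fourier 1 p.1 * (starRingEnd ℂ) (fourier 1 p.2)) ^ n
  have hz : ∀ p : AddCircle (2 * Real.pi) × AddCircle (2 * Real.pi),
      ‖(fourier 1 p.1 * (starRingEnd ℂ) (fourier 1 p.2) : ℂ)‖ = 1 := fun p => by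
    rw [norm_mul, RCLike.norm_conj, norm_fourier, norm_fourier, one_mul]
  have hone : ∀ p : AddCircle (2 * Real.pi) × AddCircle (2 * Real.pi),
      fourier 1 p.1 * (starRingEnd ℂ) (fourier 1 p.2) = (1 : ℂ) → p.1 = p.2 := by
    intro p hp
    rw [← fourier_one_injective]
    have h2 : (starRingEnd ℂ) (fourier 1 p.2) * fourier 1 p.2 = (1 : ℂ) := by
      rw [← Complex.normSq_eq_conj_mul_self, Complex.normSq_eq_norm_sq, norm_fourier]
      simp
    calc (fourier 1 p.1 : ℂ) = fourier 1 p.1 * ((starRingEnd ℂ) (fourier 1 p.2) * fourier 1 p.2) := by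
          rw [h2, mul_one]
      _ = _ := by rw [← mul_assoc, hp, one_mul]
  have hdiag : ∀ᵐ p ∂(μ.prod μ), p.1 ≠ p.2 := by
    have hm : MeasurableSet {p : AddCircle (2 * Real.pi) × AddCircle (2 * Real.pi) | p.1 ≠ p.2} :=
      (isClosed_eq continuous_fst continuous_snd).measurableSet.compl
    rw [ae_iff]
    rw [Measure.prod_apply (by simpa only [ne_eq, Set.compl_def, Set.mem_ofPred_eq, not_not] using hm.compl)]
    simp only [ne_eq, not_not, Set.preimage_ofPred_eq]
    have : ∀ a : AddCircle (2 * Real.pi), {b | a = b} = {a} := fun a => by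
      ext b
      simp [eq_comm]
    simp [this, h]
  have hlim : Tendsto (fun N => ∫ p, F N p ∂(μ.prod μ)) atTop
      (𝓝 (∫ _, (0 : ℂ) ∂(μ.prod μ))) := by
    refine tendsto_integral_of_dominated_convergence (fun _ => (1 : ℝ)) (fun N => ?_)
      (integrable_const _) (fun N => Eventually.of_forall fun p => norm_mean_pow_le (hz p) N) ?_
    · exact Continuous.aestronglyMeasurable (by fun_prop)
    · filter_upwards [hdiag] with p hp
      have := tendsto_mean_pow (hz p)
      rwa [if_neg fun h1 => hp (hone p h1)] at this
  have hF : ∀ N, ∫ p, F N p ∂(μ.prod μ) =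
      (((N : ℝ)⁻¹ * ∑ n ∈ Finset.range N, ‖(inner ℂ x ((W ^ n) x) : ℂ)‖ ^ 2 : ℝ) : ℂ) := by
    intro N
    simp only [F]
    rw [integral_const_mul, integral_finsetSum]
    · push_cast
      congr 1
      refine Finset.sum_congr rfl fun n _ => ?_
      simp_rw [mul_pow, ← map_pow, ← fourier_eq_pow]
      rw [integral_prod_mul (fun p => fourier (n : ℤ) p)
        (fun p => (starRingEnd ℂ) (fourier (n : ℤ) p)), integral_conj, hμ.2, zpow_natCast,
        Complex.mul_conj, Complex.normSq_eq_norm_sq]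
      push_cast
      rfl
    · intro n _
      refine (integrable_const (1 : ℝ)).mono' (Continuous.aestronglyMeasurable (by fun_prop)) ?_
      exact Eventually.of_forall fun p => by rw [norm_pow, hz p, one_pow]
  simp only [integral_zero] at hlim
  simp_rw [hF] at hlim
  have hre := (Complex.continuous_re.tendsto _).comp hlim
  simp only [Function.comp_def, Complex.ofReal_re, Complex.zero_re] at hre
  exact hre

/-- The eigenspace of a unitary operator for the eigenvalue `e^{iθ}`. -/
def eigenspaceAt (W : H ≃ₗᵢ[ℂ] H) (θ : AddCircle (2 * Real.pi)) : Submodule ℂ H where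
  carrier := {y | W y = (fourier 1 θ : ℂ) • y}
  zero_mem' := by simp
  add_mem' := by
    intro y z hy hz
    simp only [Set.mem_ofPred_eq] at *
    rw [map_add, hy, hz, smul_add]
  smul_mem' := by
    intro c y hy
    simp only [Set.mem_ofPred_eq] at *
    rw [map_smul, hy, smul_comm]

theorem isClosed_eigenspaceAt (W : H ≃ₗᵢ[ℂ] H) (θ : AddCircle (2 * Real.pi)) :
    IsClosed (eigenspaceAt W θ : Set H) :=
  isClosed_eq W.continuous (continuous_const_smul _)

variable [CompleteSpace H]

instance (W : H ≃ₗᵢ[ℂ] H) (θ : AddCircle (2 * Real.pi)) : CompleteSpace (eigenspaceAt W θ) :=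
  (isClosed_eigenspaceAt W θ).completeSpace_coe

/-- The mass of an atom is the square of the norm of the projection on the eigenspace. -/
theorem IsSpectralMeasure.real_singleton (hμ : IsSpectralMeasure W x μ)
    (θ : AddCircle (2 * Real.pi)) :
    μ.real {θ} = ‖(eigenspaceAt W θ).orthogonalProjectionOnto x‖ ^ 2 := by
  have := hμ.1
  let c : ℂ := (starRingEnd ℂ) (fourier 1 θ)
  have hc : ‖c‖ = 1 := by simp only [c, RCLike.norm_conj, norm_fourier]
  have hcc : c * fourier 1 θ = 1 := by
    simp only [c]
    rw [← Complex.normSq_eq_conj_mul_self, Complex.normSq_eq_norm_sq, norm_fourier]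
    simp
  have hcc' : fourier 1 θ * c = 1 := by rw [mul_comm, hcc]
  -- The fixed vectors of the contraction A = e^{-iθ}W form the eigenspace at θ. Paired with x, its
  -- ergodic averages converge to the squared norm of the projection by the mean ergodic theorem,
  -- and to the mass at θ by dominated convergence.
  let A : H →L[ℂ] H := c • (W.toContinuousLinearEquiv : H →L[ℂ] H)
  have hAx : ∀ y, A y = c • W y := fun y => rfl
  have hA : ‖A‖ ≤ 1 := ContinuousLinearMap.opNorm_le_bound _ zero_le_one fun y => by
    rw [hAx, norm_smul, hc, W.norm_map]
  have hker : (A : H →ₗ[ℂ] H).eqLocus ((1 : H →L[ℂ] H) : H →ₗ[ℂ] H) = eigenspaceAt W θ := by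
    ext y
    change c • W y = y ↔ W y = (fourier 1 θ : ℂ) • y
    constructor
    · intro h
      conv_rhs => rw [← h]
      rw [smul_smul, hcc', one_smul]
    · intro h
      rw [h, smul_smul, hcc, one_smul]
  have hiter : ∀ n : ℕ, A^[n] x = c ^ n • (W ^ n) x := by
    intro n
    induction n with
    | zero => simp
    | succ n ih =>
      rw [Function.iterate_succ_apply', ih, hAx, map_smul, smul_smul, ← pow_succ', pow_succ' W]
      rfl
  have herg := ContinuousLinearMap.tendsto_birkhoffAverage_orthogonalProjection A hA x
  have hproj : ∀ (K L : Submodule ℂ H) [K.HasOrthogonalProjection] [L.HasOrthogonalProjection],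
      K = L → ((K.orthogonalProjectionOnto x : K) : H) = (L.orthogonalProjectionOnto x : L) := by
    intro K L _ _ h
    subst h
    rfl
  have herg2 := ((innerSL ℂ x).continuous.tendsto _).comp herg
  simp only [innerSL_apply_apply] at herg2
  rw [hproj _ _ hker] at herg2
  have hval : (inner ℂ x ((eigenspaceAt W θ).orthogonalProjectionOnto x : H) : ℂ) =
      ((‖(eigenspaceAt W θ).orthogonalProjectionOnto x‖ ^ 2 : ℝ) : ℂ) := by
    rw [← Submodule.inner_orthogonalProjectionOnto_eq_of_mem_right, inner_self_eq_norm_sq_to_K]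
    push_cast
    rfl
  rw [hval] at herg2
  have hz : ∀ t : AddCircle (2 * Real.pi), ‖c * fourier 1 t‖ = 1 := fun t => by
    rw [norm_mul, hc, norm_fourier, one_mul]
  have hlim : Tendsto (fun N : ℕ => ∫ t, (N : ℂ)⁻¹ * ∑ n ∈ Finset.range N,
      (c * fourier 1 t) ^ n ∂μ) atTop (𝓝 (∫ t, ({θ} : Set _).indicator (fun _ => (1 : ℂ)) t ∂μ)) := by
    refine tendsto_integral_of_dominated_convergence (fun _ => (1 : ℝ)) (fun N => ?_)
      (integrable_const _) (fun N => Eventually.of_forall fun t => norm_mean_pow_le (hz t) N) ?_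
    · exact Continuous.aestronglyMeasurable (by fun_prop)
    · refine Eventually.of_forall fun t => ?_
      convert tendsto_mean_pow (hz t) using 2
      rw [Set.indicator_apply]
      refine if_congr ?_ rfl rfl
      rw [Set.mem_singleton_iff, ← fourier_one_injective]
      constructor
      · intro h
        rw [h, hcc]
      · intro h
        rw [← one_mul (fourier 1 t : ℂ), ← hcc', mul_assoc, h, mul_one]
  rw [integral_indicator_const _ (measurableSet_singleton θ)] at hlim
  have heq : ∀ N : ℕ, ∫ t, (N : ℂ)⁻¹ * ∑ n ∈ Finset.range N, (c * fourier 1 t) ^ n ∂μ =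
      inner ℂ x (birkhoffAverage ℂ A id N x) := by
    intro N
    rw [birkhoffAverage, birkhoffSum, inner_smul_right, inner_sum, integral_const_mul,
      integral_finsetSum]
    · congr 1
      refine Finset.sum_congr rfl fun n _ => ?_
      simp_rw [mul_pow, ← fourier_eq_pow]
      rw [integral_const_mul, hμ.2, id, hiter, inner_smul_right, zpow_natCast]
    · intro n _
      refine (integrable_const (1 : ℝ)).mono' (Continuous.aestronglyMeasurable (by fun_prop)) ?_
      exact Eventually.of_forall fun p => by rw [norm_pow, hz p, one_pow]
  simp_rw [heq] at hlim
  have := tendsto_nhds_unique hlim herg2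
  have h := congrArg Complex.re this
  rw [Complex.ofReal_re] at h
  rw [← h]
  simp

/-- Although `v` need not be complete in H, it is a Hilbert basis of the closure of its span, where
Parseval applies. -/
theorem hasSum_norm_inner_sq {ι : Type*} {v : ι → H} (hv : Orthonormal ℂ v) {y : H}
    (hy : y ∈ closure (Submodule.span ℂ (Set.range v) : Set H)) :
    HasSum (fun k => ‖(inner ℂ (v k) y : ℂ)‖ ^ 2) (‖y‖ ^ 2) := by
  let K := (Submodule.span ℂ (Set.range v)).topologicalClosure
  have hvK : ∀ k, v k ∈ K := fun k =>
    Submodule.le_topologicalClosure _ (Submodule.subset_span ⟨k, rfl⟩)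
  have : CompleteSpace K := (Submodule.isClosed_topologicalClosure _).completeSpace_coe
  let v' : ι → K := fun k => ⟨v k, hvK k⟩
  have hv' : Orthonormal ℂ v' := by
    refine ⟨fun k => hv.1 k, fun i j hij => hv.2 hij⟩
  have hbot : (Submodule.span ℂ (Set.range v'))ᗮ = ⊥ := by
    rw [Submodule.eq_bot_iff]
    intro z hz
    have h1 : ∀ k, (inner ℂ (v k) (z : H) : ℂ) = 0 := fun k =>
      Submodule.inner_right_of_mem_orthogonal (K := Submodule.span ℂ (Set.range v')) (u := v' k)
        (Submodule.subset_span (Set.mem_range_self k)) hz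
    have h2 : (z : H) ∈ (Submodule.span ℂ (Set.range v))ᗮ := by
      rw [Submodule.mem_orthogonal]
      intro u hu
      induction hu using Submodule.span_induction with
      | mem u hu =>
        obtain ⟨k, rfl⟩ := hu
        exact h1 k
      | zero => simp
      | add a b _ _ ha hb => rw [inner_add_left, ha, hb, add_zero]
      | smul c a _ ha => rw [inner_smul_left, ha, mul_zero]
    rw [← Submodule.orthogonal_closure] at h2
    have h3 : (inner ℂ (z : H) (z : H) : ℂ) = 0 := Submodule.inner_right_of_mem_orthogonal z.2 h2
    exact Subtype.ext (inner_self_eq_zero.1 h3)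
  let b := HilbertBasis.mkOfOrthogonalEqBot hv' hbot
  have hb : ∀ k, b k = v' k := fun k => by
    simp only [b, HilbertBasis.coe_mkOfOrthogonalEqBot]
  have h := b.hasSum_inner_mul_inner (⟨y, hy⟩ : K) ⟨y, hy⟩
  rw [inner_self_eq_norm_sq_to_K] at h
  have h2 := Complex.hasSum_re h
  convert h2 using 1
  · ext k
    rw [hb]
    change _ = ((inner ℂ y (v k) : ℂ) * inner ℂ (v k) y).re
    rw [← inner_conj_symm, Complex.mul_conj, Complex.normSq_eq_norm_sq, Complex.ofReal_re,
      RCLike.norm_conj]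
  · change _ = ((‖y‖ : ℂ) ^ 2).re
    norm_cast

theorem exp_I_mul_eq_fourier (s : ℝ) :
    Complex.exp (Complex.I * s) = fourier 1 (s : AddCircle (2 * Real.pi)) := by
  rw [fourier_two_pi]
  push_cast
  ring_nf

/-- The projection y of x on the eigenspace satisfies the eigenvalue equation, so it lies in the
closed span of `v` and Parseval applies to it. Its coefficients along other eigenvalues vanish by
orthogonality of eigenspaces; along e^{iθ} they agree with those of x. -/
theorem IsEigenSystem.hasSum {ι : Type*} {s : ι → ℝ} {v : ι → H} (h : IsEigenSystem W s v)
    (x : H) (θ : AddCircle (2 * Real.pi)) :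
    HasSum (fun k : {k : ι // Complex.exp (Complex.I * s k) = fourier 1 θ} =>
      ‖(inner ℂ (v k) x : ℂ)‖ ^ 2) (‖(eigenspaceAt W θ).orthogonalProjectionOnto x‖ ^ 2) := by
  set y := (eigenspaceAt W θ).orthogonalProjectionOnto x with hy
  have hyW : W y = (fourier 1 θ : ℂ) • (y : H) := y.2
  have h1 := hasSum_norm_inner_sq h.1 (h.2.2 _ _ hyW)
  have h2 : ∀ k, Complex.exp (Complex.I * s k) ≠ fourier 1 θ → (inner ℂ (v k) (y : H) : ℂ) = 0 := by
    intro k hk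
    have e := LinearIsometryEquiv.inner_map_map W (v k) y
    rw [hyW, h.2.1, inner_smul_left, inner_smul_right, ← mul_assoc] at e
    by_contra hne
    have e2 := mul_right_cancel₀ hne (e.trans (one_mul _).symm)
    apply hk
    have e3 : Complex.exp (Complex.I * s k) * (starRingEnd ℂ) (Complex.exp (Complex.I * s k)) = 1 := by
      rw [mul_comm, ← Complex.normSq_eq_conj_mul_self, Complex.normSq_eq_norm_sq, mul_comm,
        Complex.norm_exp_ofReal_mul_I]
      simp
    rw [← one_mul (fourier 1 θ : ℂ), ← e3, mul_assoc, e2, mul_one]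
  have h3 : ∀ k, Complex.exp (Complex.I * s k) = fourier 1 θ →
      (inner ℂ (v k) (y : H) : ℂ) = inner ℂ (v k) x := by
    intro k hk
    have hmem : v k ∈ eigenspaceAt W θ := by
      change W (v k) = _
      rw [h.2.1, hk]
    exact Submodule.inner_orthogonalProjectionOnto_eq_of_mem_left ⟨v k, hmem⟩ x
  have h4 := (hasSum_subtype_iff_of_support_subset
    (s := {k | Complex.exp (Complex.I * s k) = fourier 1 θ}) (fun k hk => by
      by_contra hne
      exact hk (by simp [h2 k hne]))).2 h1
  refine h4.congr_fun fun k => ?_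
  rw [← h3 k k.2]
  rfl
end Atoms
end BargmannFock
end

noncomputable section
namespace BargmannFock

/-! ### One-sided limits of the sawtooth -/

section Sawtooth

theorem abs_residue_le (y : ℝ) : |residue y| ≤ Real.pi := by
  rw [residue]
  split_ifs with h
  · simpa using Real.pi_pos.le
  · have h0 := Int.fract_nonneg (y / (2 * Real.pi) + 1 / 2)
    have h1 := (Int.fract_lt_one (y / (2 * Real.pi) + 1 / 2)).le
    rw [abs_le]
    constructor <;> nlinarith [Real.pi_pos]

theorem tendsto_residue_of_fract {x : ℝ} {l : Filter ℝ} {a : ℝ}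
    (h : Tendsto (fun y : ℝ => Int.fract (y / (2 * Real.pi))) l (𝓝 a))
    (h0 : ∀ᶠ y : ℝ in l, Int.fract (y / (2 * Real.pi)) ≠ 0) (hx : 2 * Real.pi * a - Real.pi = x) :
    Tendsto (fun y : ℝ => residue (y - Real.pi)) l (𝓝 x) := by
  subst hx
  refine ((h.const_mul (2 * Real.pi)).sub_const Real.pi).congr' ?_
  filter_upwards [h0] with y hy
  rw [residue_sub_pi, if_neg hy]

theorem continuousAt_residue {x : ℝ} (hx : Int.fract (x / (2 * Real.pi)) ≠ 0) :
    ContinuousAt (fun y : ℝ => residue (y - Real.pi)) x := by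
  have hc : ContinuousAt (fun y : ℝ => Int.fract (y / (2 * Real.pi))) x := by
    refine ContinuousAt.comp (g := Int.fract) (continuousAt_fract fun h => hx ?_) (by fun_prop)
    rw [h, Int.fract_intCast]
  exact tendsto_residue_of_fract hc.tendsto (hc.eventually_ne hx)
    (by simp only [residue_sub_pi, if_neg hx])

theorem tendsto_div_right (x : ℝ) :
    Tendsto (fun y : ℝ => y / (2 * Real.pi)) (𝓝[>] x) (𝓝[>] (x / (2 * Real.pi))) := by
  refine tendsto_nhdsWithin_iff.2 ⟨?_, ?_⟩
  · exact (Continuous.tendsto (by fun_prop) x).mono_left nhdsWithin_le_nhds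
  · filter_upwards [self_mem_nhdsWithin] with y hy
    exact div_lt_div_of_pos_right hy Real.two_pi_pos

theorem tendsto_div_left (x : ℝ) :
    Tendsto (fun y : ℝ => y / (2 * Real.pi)) (𝓝[<] x) (𝓝[<] (x / (2 * Real.pi))) := by
  refine tendsto_nhdsWithin_iff.2 ⟨?_, ?_⟩
  · exact (Continuous.tendsto (by fun_prop) x).mono_left nhdsWithin_le_nhds
  · filter_upwards [self_mem_nhdsWithin] with y hy
    exact div_lt_div_of_pos_right hy Real.two_pi_pos

/-- The sawtooth drops from π to -π here; the factor -1/(2T) in front of the integral makes the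
jumps of Q positive. -/
theorem tendsto_residue_right {x : ℝ} (hx : Int.fract (x / (2 * Real.pi)) = 0) :
    Tendsto (fun y : ℝ => residue (y - Real.pi)) (𝓝[>] x) (𝓝 (-Real.pi)) := by
  obtain ⟨n, hn⟩ := Int.fract_eq_zero_iff.1 hx
  have hd := tendsto_div_right x
  rw [← hn] at hd
  refine tendsto_residue_of_fract (a := 0) (((tendsto_fract_right' n).mono_left
    (nhdsWithin_mono _ Set.Ioi_subset_Ici_self)).comp hd) ?_ (by ring)
  have : ∀ᶠ u in 𝓝[>] (n : ℝ), Int.fract u ≠ 0 := by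
    filter_upwards [Ioo_mem_nhdsGT (show (n : ℝ) < n + 1 by linarith)] with u hu h
    obtain ⟨m, rfl⟩ := Int.fract_eq_zero_iff.1 h
    have h1 : n < m := by exact_mod_cast hu.1
    have h2 : m < n + 1 := by exact_mod_cast hu.2
    omega
  exact hd.eventually this

theorem tendsto_residue_left {x : ℝ} (hx : Int.fract (x / (2 * Real.pi)) = 0) :
    Tendsto (fun y : ℝ => residue (y - Real.pi)) (𝓝[<] x) (𝓝 Real.pi) := by
  obtain ⟨n, hn⟩ := Int.fract_eq_zero_iff.1 hx
  have hd := tendsto_div_left x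
  rw [← hn] at hd
  refine tendsto_residue_of_fract (a := 1) ((tendsto_fract_left' n).comp hd) ?_ (by ring)
  have : ∀ᶠ u in 𝓝[<] (n : ℝ), Int.fract u ≠ 0 := by
    filter_upwards [Ioo_mem_nhdsLT (show (n : ℝ) - 1 < n by linarith)] with u hu h
    obtain ⟨m, rfl⟩ := Int.fract_eq_zero_iff.1 h
    have h1 : n - 1 < m := by exact_mod_cast hu.1
    have h2 : m < n := by exact_mod_cast hu.2
    omega
  exact hd.eventually this

theorem fract_eq_zero_iff_coe {x : ℝ} :
    Int.fract (x / (2 * Real.pi)) = 0 ↔ (x : AddCircle (2 * Real.pi)) = 0 := by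
  rw [Int.fract_eq_zero_iff, AddCircle.coe_eq_zero_iff]
  have := Real.two_pi_pos.ne'
  constructor
  · rintro ⟨n, hn⟩
    refine ⟨n, ?_⟩
    rw [zsmul_eq_mul, hn]
    field_simp
  · rintro ⟨n, hn⟩
    refine ⟨n, ?_⟩
    rw [← hn, zsmul_eq_mul]
    field_simp

end Sawtooth

/-! ### Q as an integral, its jumps and its continuity -/

section Q

variable {H : Type*} [NormedAddCommGroup H] [InnerProductSpace ℂ H] {W : H ≃ₗᵢ[ℂ] H} {x : H}
  {μ : Measure (AddCircle (2 * Real.pi))} {T : ℝ}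

/-- The representative in `[0, 2π)` of a point of the circle. -/
def rep (θ : AddCircle (2 * Real.pi)) : ℝ := (AddCircle.equivIco (2 * Real.pi) 0 θ : ℝ)

theorem coe_rep (θ : AddCircle (2 * Real.pi)) : (rep θ : AddCircle (2 * Real.pi)) = θ :=
  AddCircle.coe_equivIco

/-- The partial sums of the sawtooth series as continuous functions on the circle. -/
def sawPartial (lam T : ℝ) (N : ℕ) : C(AddCircle (2 * Real.pi), ℝ) :=
  ⟨fun θ => ∑ n ∈ Finset.Icc 1 N,
    (Complex.exp (Complex.I * (lam * n * T)) * fourier (n : ℤ) θ).im / (n * T), by fun_prop⟩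

theorem sawPartial_apply (lam T : ℝ) (N : ℕ) (θ : AddCircle (2 * Real.pi)) :
    sawPartial lam T N θ = 1 / T *
      ∑ n ∈ Finset.Icc 1 N, Real.sin (n * (rep θ + lam * T)) / n := by
  simp only [sawPartial, ContinuousMap.coe_mk]
  rw [Finset.mul_sum]
  refine Finset.sum_congr rfl fun n _ => ?_
  have : Complex.exp (Complex.I * (lam * n * T)) * fourier (n : ℤ) θ =
      Complex.exp ((n * (rep θ + lam * T) : ℝ) * Complex.I) := by
    conv_lhs => rw [← coe_rep θ]
    rw [fourier_two_pi, ← Complex.exp_add]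
    congr 1
    push_cast
    ring
  rw [this, Complex.exp_ofReal_mul_I_im]
  rw [div_mul_div_comm, one_mul, mul_comm T]

theorem tendsto_sawPartial (lam T : ℝ) (θ : AddCircle (2 * Real.pi)) :
    Tendsto (fun N => sawPartial lam T N θ) atTop
      (𝓝 (-(1 / (2 * T)) * residue (rep θ + lam * T - Real.pi))) := by
  simp_rw [sawPartial_apply]
  convert (tendsto_sum_sin_div (rep θ + lam * T)).const_mul (1 / T) using 2
  ring

/-- Measurability comes from being a pointwise limit of the continuous partial sums. -/
theorem measurable_residue (hT : 0 < T) (lam : ℝ) :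
    Measurable fun θ => residue (rep θ + lam * T - Real.pi) := by
  have h : Measurable fun θ => -(1 / (2 * T)) * residue (rep θ + lam * T - Real.pi) :=
    measurable_of_tendsto_metrizable (fun N => (sawPartial lam T N).continuous.measurable)
      (tendsto_pi_nhds.2 (tendsto_sawPartial lam T))
  have h2 := h.const_mul (-(2 * T))
  convert h2 using 2
  field_simp

theorem IsSpectralMeasure.integral_sawPartial (hμ : IsSpectralMeasure W x μ) (lam T : ℝ) (N : ℕ) :
    ∫ θ, sawPartial lam T N θ ∂μ = QPartial W x T lam N := by
  have := hμ.1
  simp only [sawPartial, ContinuousMap.coe_mk, QPartial]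
  have hi : ∀ n : ℕ, Integrable (fun θ : AddCircle (2 * Real.pi) =>
      Complex.exp (Complex.I * (lam * n * T)) * fourier (n : ℤ) θ) μ := fun n =>
    (integrable_continuousMap μ (fourier (n : ℤ))).const_mul _
  rw [integral_finsetSum _ fun n _ => by exact (hi n).im.div_const _]
  refine Finset.sum_congr rfl fun n _ => ?_
  rw [integral_div]
  congr 1
  have h1 : ∫ θ, (Complex.exp (Complex.I * (lam * n * T)) * fourier (n : ℤ) θ).im ∂μ =
      (∫ θ, Complex.exp (Complex.I * (lam * n * T)) * fourier (n : ℤ) θ ∂μ).im :=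
    integral_im (hi n)
  rw [h1, integral_const_mul, hμ.2, zpow_natCast]

theorem IsSpectralMeasure.tendsto_QPartial (hμ : IsSpectralMeasure W x μ) (hT : 0 < T) (lam : ℝ) :
    Tendsto (QPartial W x T lam) atTop
      (𝓝 (-(1 / (2 * T)) * ∫ θ, residue (rep θ + lam * T - Real.pi) ∂μ)) := by
  have := hμ.1
  rw [← integral_const_mul]
  have h : Tendsto (fun N => ∫ θ, sawPartial lam T N θ ∂μ) atTop
      (𝓝 (∫ θ, -(1 / (2 * T)) * residue (rep θ + lam * T - Real.pi) ∂μ)) := by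
    refine tendsto_integral_of_dominated_convergence (fun _ => 1 / T * 3)
      (fun N => (sawPartial lam T N).continuous.aestronglyMeasurable) (integrable_const _)
      (fun N => Eventually.of_forall fun θ => ?_)
      (Eventually.of_forall (tendsto_sawPartial lam T))
    rw [sawPartial_apply, norm_mul, Real.norm_of_nonneg (by positivity)]
    gcongr
    exact abs_sum_sin_div_le _ _
  simp_rw [hμ.integral_sawPartial] at h
  exact h

theorem IsSpectralMeasure.Qfun_eq (hμ : IsSpectralMeasure W x μ) (hT : 0 < T) (lam : ℝ) :
    Qfun W x T lam = -(1 / (2 * T)) * ∫ θ, residue (rep θ + lam * T - Real.pi) ∂μ :=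
  (hμ.tendsto_QPartial hT lam).limUnder_eq

/-- Dominated convergence in λ with the constant π. The filter is left free so that one-sided limits
and continuity are both covered. -/
theorem IsSpectralMeasure.tendsto_Qfun (hμ : IsSpectralMeasure W x μ) (hT : 0 < T) {l : Filter ℝ}
    [l.IsCountablyGenerated] {g : AddCircle (2 * Real.pi) → ℝ}
    (h : ∀ᵐ θ ∂μ, Tendsto (fun lam => residue (rep θ + lam * T - Real.pi)) l (𝓝 (g θ))) :
    Tendsto (Qfun W x T) l (𝓝 (-(1 / (2 * T)) * ∫ θ, g θ ∂μ)) := by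
  have := hμ.1
  have e : Qfun W x T = fun lam => -(1 / (2 * T)) * ∫ θ, residue (rep θ + lam * T - Real.pi) ∂μ :=
    funext (hμ.Qfun_eq hT)
  rw [e]
  refine Tendsto.const_mul _ ?_
  refine tendsto_integral_filter_of_dominated_convergence (fun _ => Real.pi)
    (Eventually.of_forall fun lam => (measurable_residue hT lam).aestronglyMeasurable)
    (Eventually.of_forall fun lam => Eventually.of_forall fun θ => abs_residue_le _)
    (integrable_const _) h

theorem fract_rep_eq_zero_iff (θ : AddCircle (2 * Real.pi)) (y : ℝ) :
    Int.fract ((rep θ + y) / (2 * Real.pi)) = 0 ↔ θ = ((-y : ℝ) : AddCircle (2 * Real.pi)) := by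
  rw [fract_eq_zero_iff_coe, AddCircle.coe_add, coe_rep, AddCircle.coe_neg, add_eq_zero_iff_eq_neg]

theorem tendsto_affine_right (hT : 0 < T) (c lam : ℝ) :
    Tendsto (fun t : ℝ => c + t * T) (𝓝[>] lam) (𝓝[>] (c + lam * T)) := by
  refine tendsto_nhdsWithin_iff.2 ⟨?_, ?_⟩
  · exact (Continuous.tendsto (by fun_prop) lam).mono_left nhdsWithin_le_nhds
  · filter_upwards [self_mem_nhdsWithin] with y hy
    have : lam < y := hy
    simp only [Set.mem_Ioi]
    gcongr

theorem tendsto_affine_left (hT : 0 < T) (c lam : ℝ) :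
    Tendsto (fun t : ℝ => c + t * T) (𝓝[<] lam) (𝓝[<] (c + lam * T)) := by
  refine tendsto_nhdsWithin_iff.2 ⟨?_, ?_⟩
  · exact (Continuous.tendsto (by fun_prop) lam).mono_left nhdsWithin_le_nhds
  · filter_upwards [self_mem_nhdsWithin] with y hy
    have : y < lam := hy
    simp only [Set.mem_Iio]
    gcongr

/-- The one-sided limits of `Q` exist, and the jump is a multiple of the mass of an atom. -/
theorem IsSpectralMeasure.exists_jump (hμ : IsSpectralMeasure W x μ) (hT : 0 < T) (lam : ℝ) :
    ∃ a b : ℝ, Tendsto (Qfun W x T) (𝓝[>] lam) (𝓝 a) ∧ Tendsto (Qfun W x T) (𝓝[<] lam) (𝓝 b) ∧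
      a - b = Real.pi / T * μ.real {((-(lam * T) : ℝ) : AddCircle (2 * Real.pi))} := by
  classical
  have := hμ.1
  set θ₀ := ((-(lam * T) : ℝ) : AddCircle (2 * Real.pi)) with hθ₀
  have hiff : ∀ θ, Int.fract ((rep θ + lam * T) / (2 * Real.pi)) = 0 ↔ θ = θ₀ := fun θ =>
    fract_rep_eq_zero_iff θ _
  let r : AddCircle (2 * Real.pi) → ℝ := fun θ => residue (rep θ + lam * T - Real.pi)
  have hr0 : r θ₀ = 0 := by
    simp only [r]
    rw [residue_sub_pi, if_pos ((hiff θ₀).2 rfl)]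
  -- The one-sided limits of the integrand differ from its value only at θ₀, where the value is 0
  -- and the limits are -π and π. The difference integrates to -2π times the mass at θ₀.
  let gp : AddCircle (2 * Real.pi) → ℝ := fun θ => r θ + ({θ₀} : Set _).indicator (fun _ => -Real.pi) θ
  let gm : AddCircle (2 * Real.pi) → ℝ := fun θ => r θ + ({θ₀} : Set _).indicator (fun _ => Real.pi) θ
  have hri : Integrable r μ := (integrable_const Real.pi).mono'
    (measurable_residue hT lam).aestronglyMeasurable (Eventually.of_forall fun θ => abs_residue_le _)
  have hp : ∀ θ, Tendsto (fun t => residue (rep θ + t * T - Real.pi)) (𝓝[>] lam) (𝓝 (gp θ)) := by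
    intro θ
    by_cases h : θ = θ₀
    · have h2 := (tendsto_residue_right ((hiff θ).2 h)).comp (tendsto_affine_right hT (rep θ) lam)
      have e : gp θ = -Real.pi := by simp [gp, h, hr0]
      rwa [e]
    · have h2 := (continuousAt_residue ((hiff θ).not.2 h)).tendsto.comp
        ((tendsto_affine_right hT (rep θ) lam).mono_right nhdsWithin_le_nhds)
      have e : gp θ = r θ := by simp [gp, h]
      rwa [e]
  have hm : ∀ θ, Tendsto (fun t => residue (rep θ + t * T - Real.pi)) (𝓝[<] lam) (𝓝 (gm θ)) := by
    intro θ
    by_cases h : θ = θ₀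
    · have h2 := (tendsto_residue_left ((hiff θ).2 h)).comp (tendsto_affine_left hT (rep θ) lam)
      have e : gm θ = Real.pi := by simp [gm, h, hr0]
      rwa [e]
    · have h2 := (continuousAt_residue ((hiff θ).not.2 h)).tendsto.comp
        ((tendsto_affine_left hT (rep θ) lam).mono_right nhdsWithin_le_nhds)
      have e : gm θ = r θ := by simp [gm, h]
      rwa [e]
  refine ⟨_, _, hμ.tendsto_Qfun hT (Eventually.of_forall hp),
    hμ.tendsto_Qfun hT (Eventually.of_forall hm), ?_⟩
  have hind : ∀ c : ℝ, Integrable (({θ₀} : Set (AddCircle (2 * Real.pi))).indicator fun _ => c) μ :=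
    fun c => (integrable_const c).indicator (measurableSet_singleton _)
  simp only [gp, gm]
  rw [integral_add hri (hind _), integral_add hri (hind _),
    integral_indicator_const _ (measurableSet_singleton _),
    integral_indicator_const _ (measurableSet_singleton _)]
  simp only [smul_eq_mul]
  field_simp
  ring

theorem IsSpectralMeasure.mem_jumpSet (hμ : IsSpectralMeasure W x μ) (hT : 0 < T) (lam : ℝ) :
    lam ∈ jumpSet (Qfun W x T) ↔
      μ {((-(lam * T) : ℝ) : AddCircle (2 * Real.pi))} ≠ 0 := by
  have := hμ.1
  obtain ⟨a, b, ha, hb, hab⟩ := hμ.exists_jump hT lam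
  have hpos : 0 < Real.pi / T := by positivity
  have h1 : 0 < a - b ↔ μ {((-(lam * T) : ℝ) : AddCircle (2 * Real.pi))} ≠ 0 := by
    rw [hab, mul_pos_iff_of_pos_left hpos, lt_iff_le_and_ne, Ne, eq_comm, measureReal_eq_zero_iff]
    simp [measureReal_nonneg]
  rw [← h1]
  constructor
  · rintro ⟨a', b', ha', hb', h⟩
    rwa [tendsto_nhds_unique ha ha', tendsto_nhds_unique hb hb']
  · exact fun h => ⟨a, b, ha, hb, h⟩

theorem IsSpectralMeasure.continuousAt_Qfun (hμ : IsSpectralMeasure W x μ) (hT : 0 < T) {lam : ℝ}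
    (h : μ {((-(lam * T) : ℝ) : AddCircle (2 * Real.pi))} = 0) :
    ContinuousAt (Qfun W x T) lam := by
  rw [ContinuousAt, hμ.Qfun_eq hT]
  refine hμ.tendsto_Qfun hT ?_
  have : ∀ᵐ θ ∂μ, θ ≠ ((-(lam * T) : ℝ) : AddCircle (2 * Real.pi)) := by
    rw [ae_iff]
    simpa using h
  filter_upwards [this] with θ hθ
  have hc := continuousAt_residue ((fract_rep_eq_zero_iff θ _).not.2 hθ)
  exact ContinuousAt.comp (f := fun t : ℝ => rep θ + t * T) (x := lam) hc (by fun_prop)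

theorem residue_add_two_pi (y : ℝ) : residue (y + 2 * Real.pi) = residue y := by
  have : (y + 2 * Real.pi) / (2 * Real.pi) + 1 / 2 = (y / (2 * Real.pi) + 1 / 2) + 1 := by
    have := Real.pi_ne_zero
    field_simp
    ring
  rw [residue, residue, this, Int.fract_add_one]

theorem IsSpectralMeasure.periodic_Qfun (hμ : IsSpectralMeasure W x μ) (hT : 0 < T) :
    Function.Periodic (Qfun W x T) (2 * Real.pi / T) := by
  intro lam
  rw [hμ.Qfun_eq hT, hμ.Qfun_eq hT]
  congr 2
  ext θ
  rw [← residue_add_two_pi (rep θ + lam * T - Real.pi)]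
  congr 1
  field_simp
  ring

theorem uniformContinuous_of_periodic {f : ℝ → ℝ} {p : ℝ} (hp : 0 < p) (hf : Function.Periodic f p)
    (hc : Continuous f) : UniformContinuous f := by
  have : Fact (0 < p) := ⟨hp⟩
  have h1 : Continuous (hf.lift : AddCircle p → ℝ) := continuous_coinduced_dom.2 hc
  have h2 : UniformContinuous (hf.lift : AddCircle p → ℝ) :=
    CompactSpace.uniformContinuous_of_continuous h1
  have h3 : UniformContinuous ((↑) : ℝ → AddCircle p) :=
    uniformContinuous_addMonoidHom_of_continuous (f := QuotientAddGroup.mk' _)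
      (AddCircle.continuous_mk' p)
  exact h2.comp h3

/-- An atom at θ would force a jump at -θ/T; without atoms Q is continuous, and periodicity makes
the continuity uniform. -/
theorem IsSpectralMeasure.uniformContinuous_Qfun_iff (hμ : IsSpectralMeasure W x μ) (hT : 0 < T) :
    UniformContinuous (Qfun W x T) ↔ ∀ θ, μ {θ} = 0 := by
  constructor
  · intro h θ
    by_contra hne
    have hl : (-(-(rep θ / T) * T) : ℝ) = rep θ := by field_simp
    have hmem : -(rep θ / T) ∈ jumpSet (Qfun W x T) := by
      rw [hμ.mem_jumpSet hT, hl, coe_rep]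
      exact hne
    obtain ⟨a, b, ha, hb, hab⟩ := hmem
    have hc := h.continuous.tendsto (-(rep θ / T))
    have h1 := tendsto_nhds_unique ha (hc.mono_left nhdsWithin_le_nhds)
    have h2 := tendsto_nhds_unique hb (hc.mono_left nhdsWithin_le_nhds)
    linarith
  · intro h
    exact uniformContinuous_of_periodic (by positivity) (hμ.periodic_Qfun hT)
      (continuous_iff_continuousAt.2 fun lam => hμ.continuousAt_Qfun hT (h _))

theorem singleton_eq_zero_of_absolutelyContinuous
    (h : μ ≪ (volume : Measure (AddCircle (2 * Real.pi)))) (θ : AddCircle (2 * Real.pi)) :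
    μ {θ} = 0 := by
  apply h
  rw [← Metric.closedBall_zero, AddCircle.volume_closedBall]
  simp [Real.two_pi_pos.le]

end Q
end BargmannFock
end

noncomputable section
namespace BargmannFock

/-! ### The ground state function and the mean value property -/

section GroundState

variable {V : Type*} [NormedAddCommGroup V] [InnerProductSpace ℂ V]

theorem groundFun_eq (v : V) : groundFun v = Complex.exp (-(1 / 2) * (‖v‖ : ℂ) ^ 2) := by
  rw [groundFun, sigma_cxJ_self]
  push_cast
  rfl

theorem norm_groundFun (v : V) : ‖groundFun v‖ = Real.exp (-(1 / 2) * ‖v‖ ^ 2) := by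
  rw [groundFun, sigma_cxJ_self, Complex.norm_real, Real.norm_of_nonneg (Real.exp_pos _).le]

theorem conj_groundFun (v : V) : (starRingEnd ℂ) (groundFun v) = groundFun v := by
  rw [groundFun, Complex.conj_ofReal]

theorem groundFun_ne_zero (v : V) : groundFun v ≠ 0 := by
  rw [groundFun_eq]
  exact Complex.exp_ne_zero _

theorem groundFun_mul_self (v : V) : groundFun v * groundFun v = Complex.exp (-(‖v‖ : ℂ) ^ 2) := by
  rw [groundFun_eq, ← Complex.exp_add]
  congr 1
  ring

theorem integral_circle_of_entire {h : V → ℂ} (hh : Differentiable ℂ h) (w : V) :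
    ∫ φ in Set.Ioc 0 (2 * Real.pi), h (Complex.exp (φ * Complex.I) • w) = 2 * Real.pi * h 0 := by
  have h1 : DiffContOnCl ℂ (fun z : ℂ => h (z • w)) (Metric.ball 0 |1|) :=
    (hh.comp (differentiable_id.smul_const w)).diffContOnCl
  have h2 := h1.circleAverage
  rw [Real.circleAverage_def, intervalIntegral.integral_of_le Real.two_pi_pos.le] at h2
  simp only [circleMap, Complex.ofReal_one, one_mul, zero_add, zero_smul] at h2
  rw [← h2, Complex.real_smul]
  push_cast
  rw [← mul_assoc, mul_inv_cancel₀ (by exact_mod_cast Real.two_pi_pos.ne'), one_mul]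

theorem norm_sq_sub_expand (w v : V) :
    (-(‖w - v‖ : ℂ) ^ 2) = -(‖w‖ : ℂ) ^ 2 + inner ℂ v w + inner ℂ w v - (‖v‖ : ℂ) ^ 2 := by
  have h : ∀ x : V, ((‖x‖ : ℂ) ^ 2) = inner ℂ x x := fun x =>
    (inner_self_eq_norm_sq_to_K (𝕜 := ℂ) x).symm
  rw [h, h, h, inner_sub_left, inner_sub_right, inner_sub_right]
  ring

end GroundState

/-! ### Gaussian integrals and invariance of the measure -/

section Measure

variable (V : Type*) [NormedAddCommGroup V] [InnerProductSpace ℂ V] [FiniteDimensional ℂ V]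
  [MeasurableSpace V] [BorelSpace V]

instance isAddHaarMeasure_dL : Measure.IsAddHaarMeasure (dL V) := by
  let _ := InnerProductSpace.rclikeToReal ℂ V
  have h : Measure.IsAddHaarMeasure (lebesgue V) :=
    inferInstanceAs (Measure.IsAddHaarMeasure (volume : Measure V))
  refine Measure.IsAddHaarMeasure.smul _ ?_ ENNReal.ofReal_ne_top
  simp [Real.pi_pos]

variable {V}

theorem integrable_exp_neg_mul_sq {b : ℝ} (hb : 0 < b) :
    Integrable (fun v : V => Real.exp (-b * ‖v‖ ^ 2)) (dL V) := by
  refine Integrable.smul_measure ?_ ENNReal.ofReal_ne_top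
  let _ := InnerProductSpace.rclikeToReal ℂ V
  have h := (GaussianFourier.integrable_cexp_neg_mul_sq_norm_add (V := V) (b := b)
    (by simpa using hb) 0 0).norm
  refine h.congr (Eventually.of_forall fun v => ?_)
  simp only [zero_mul, add_zero, Complex.norm_exp]
  norm_cast

theorem integrable_exp_neg_mul_sq_add {b : ℝ} (hb : 0 < b) (c : ℝ) :
    Integrable (fun v : V => Real.exp (-b * ‖v‖ ^ 2 + c * ‖v‖)) (dL V) := by
  refine ((integrable_exp_neg_mul_sq (V := V) (half_pos hb)).const_mul
    (Real.exp (c ^ 2 / (2 * b)))).mono' (Continuous.aestronglyMeasurable (by fun_prop))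
    (Eventually.of_forall fun v => ?_)
  rw [Real.norm_of_nonneg (Real.exp_pos _).le, ← Real.exp_add, Real.exp_le_exp]
  have h : c * ‖v‖ ≤ c ^ 2 / (2 * b) + b / 2 * ‖v‖ ^ 2 := by
    have : c ^ 2 / (2 * b) + b / 2 * ‖v‖ ^ 2 - c * ‖v‖ = (c - b * ‖v‖) ^ 2 / (2 * b) := by
      field_simp
      ring
    have h2 : 0 ≤ (c - b * ‖v‖) ^ 2 / (2 * b) := by positivity
    linarith
  linarith

theorem integral_exp_neg_sq : ∫ v : V, Real.exp (-‖v‖ ^ 2) ∂(dL V) = 1 := by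
  let _ := InnerProductSpace.rclikeToReal ℂ V
  have h := GaussianFourier.integral_rexp_neg_mul_sq_norm (V := V) (zero_lt_one)
  have h2 : ∫ v : V, Real.exp (-‖v‖ ^ 2) ∂(lebesgue V) = Real.pi ^ Module.finrank ℂ V := by
    refine Eq.trans ?_ (h.trans ?_)
    · refine integral_congr_ae (Eventually.of_forall fun v => ?_)
      simp
    · have : Module.finrank ℝ V = 2 * Module.finrank ℂ V := finrank_real_of_complex V
      rw [this, div_one]
      push_cast
      rw [mul_div_cancel_left₀ _ (two_ne_zero), Real.rpow_natCast]
  rw [dL, integral_smul_measure, h2, ENNReal.toReal_ofReal (by positivity), smul_eq_mul]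
  exact inv_mul_cancel₀ (by positivity)

theorem measurePreserving_smul {c : ℂ} (hc : ‖c‖ = 1) :
    MeasurePreserving (fun v : V => c • v) (dL V) (dL V) := by
  let _ := InnerProductSpace.rclikeToReal ℂ V
  have hc0 : c ≠ 0 := by
    rintro rfl
    simp at hc
  let e : V ≃ₗᵢ[ℝ] V :=
    { (LinearEquiv.smulOfNeZero ℂ V c hc0).restrictScalars ℝ with
      norm_map' := fun v => by
        change ‖c • v‖ = ‖v‖
        rw [norm_smul, hc, one_mul] }
  have h : MeasurePreserving (fun v : V => c • v) (lebesgue V) (lebesgue V) := e.measurePreserving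
  exact h.smul_measure _

theorem integral_cexp_neg_sq : ∫ v : V, Complex.exp (-(‖v‖ : ℂ) ^ 2) ∂(dL V) = 1 := by
  rw [← Complex.ofReal_one, ← integral_exp_neg_sq (V := V), ← integral_complex_ofReal]
  push_cast
  rfl

/-! ### The reproducing formula -/

/-- Multiplication by e^{iφ} preserves the Gaussian measure. Averaging over φ and exchanging
integrals replaces h by its circle means, which equal h(0), and the Gaussian has total mass 1. -/
theorem integral_entire_mul_gauss {h : V → ℂ} (hh : Differentiable ℂ h)
    (hi : Integrable (fun w => h w * Complex.exp (-(‖w‖ : ℂ) ^ 2)) (dL V)) :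
    ∫ w, h w * Complex.exp (-(‖w‖ : ℂ) ^ 2) ∂(dL V) = h 0 := by
  let G : V → ℂ := fun w => h w * Complex.exp (-(‖w‖ : ℂ) ^ 2)
  have hGc : Continuous G := hh.continuous.mul (by fun_prop)
  have hG : ∀ φ : ℝ, ∀ w, G (Complex.exp (φ * Complex.I) • w) =
      h (Complex.exp (φ * Complex.I) • w) * Complex.exp (-(‖w‖ : ℂ) ^ 2) := by
    intro φ w
    simp only [G]
    rw [norm_smul, Complex.norm_exp_ofReal_mul_I, one_mul]
  have hemb : ∀ φ : ℝ, MeasurableEmbedding fun v : V => Complex.exp (φ * Complex.I) • v :=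
    fun φ => (Homeomorph.smulOfNeZero _ (Complex.exp_ne_zero _)).measurableEmbedding
  have hmp : ∀ φ : ℝ, MeasurePreserving (fun v : V => Complex.exp (φ * Complex.I) • v) (dL V) (dL V) :=
    fun φ => measurePreserving_smul (Complex.norm_exp_ofReal_mul_I φ)
  have hrot : ∀ φ : ℝ, ∫ w, G (Complex.exp (φ * Complex.I) • w) ∂(dL V) = ∫ w, G w ∂(dL V) :=
    fun φ => (hmp φ).integral_comp (hemb φ) G
  have hint : Integrable (Function.uncurry fun (φ : ℝ) (w : V) => G (Complex.exp (φ * Complex.I) • w))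
      ((volume.restrict (Set.Ioc 0 (2 * Real.pi))).prod (dL V)) := by
    rw [integrable_prod_iff]
    · refine ⟨Eventually.of_forall fun φ => ((hmp φ).integrable_comp_emb (hemb φ)).2 hi, ?_⟩
      have : ∀ φ : ℝ, ∫ w, ‖G (Complex.exp (φ * Complex.I) • w)‖ ∂(dL V) = ∫ w, ‖G w‖ ∂(dL V) :=
        fun φ => (hmp φ).integral_comp (hemb φ) fun w => ‖G w‖
      simp only [Function.uncurry_apply_pair, this]
      exact integrable_const _
    · exact Continuous.aestronglyMeasurable (by
        refine hGc.comp ?_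
        fun_prop)
  have hswap := integral_integral_swap hint
  simp only [hrot] at hswap
  rw [integral_const] at hswap
  have h3 : ∀ w, ∫ φ in Set.Ioc 0 (2 * Real.pi), G (Complex.exp (φ * Complex.I) • w) =
      2 * Real.pi * h 0 * Complex.exp (-(‖w‖ : ℂ) ^ 2) := by
    intro w
    simp_rw [hG]
    rw [integral_mul_const, integral_circle_of_entire hh]
  simp_rw [h3] at hswap
  rw [integral_const_mul, integral_cexp_neg_sq, mul_one] at hswap
  have h4 : (volume.restrict (Set.Ioc 0 (2 * Real.pi))).real Set.univ = 2 * Real.pi := by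
    simp [Real.two_pi_pos.le]
  rw [h4, Complex.real_smul] at hswap
  push_cast at hswap
  exact mul_left_cancel₀ (by simp [Real.pi_ne_zero]) hswap

/-- The reproducing formula for entire functions in Gaussian-weighted space. -/
theorem integral_reproducing {f : V → ℂ} (hf : Differentiable ℂ f) (v : V)
    (hi : Integrable (fun w => f w * Complex.exp (inner ℂ w v - (‖w‖ : ℂ) ^ 2)) (dL V)) :
    ∫ w, f w * Complex.exp (inner ℂ w v - (‖w‖ : ℂ) ^ 2) ∂(dL V) = f v := by
  -- Translating by v moves the evaluation point to 0; the factor e^{-⟨v,w⟩}, holomorphic in w,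
  -- compensates the shift of the Gaussian.
  let h : V → ℂ := fun w => f (w + v) * Complex.exp (-inner ℂ v w)
  have hh : Differentiable ℂ h := by
    refine (hf.comp (differentiable_id.add_const v)).mul ?_
    exact ((innerSL ℂ v).differentiable.neg).cexp
  have e : ∀ w, h (w - v) * Complex.exp (-(‖w - v‖ : ℂ) ^ 2) =
      f w * Complex.exp (inner ℂ w v - (‖w‖ : ℂ) ^ 2) := by
    intro w
    simp only [h, sub_add_cancel]
    rw [mul_assoc, ← Complex.exp_add, norm_sq_sub_expand, inner_sub_right]
    congr 2
    rw [inner_self_eq_norm_sq_to_K (𝕜 := ℂ) v]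
    simp only [Complex.coe_algebraMap]
    ring
  have hi2 : Integrable (fun w => h w * Complex.exp (-(‖w‖ : ℂ) ^ 2)) (dL V) := by
    simp_rw [← e] at hi
    have := hi.comp_add_right v
    simpa using this
  have h2 := integral_entire_mul_gauss hh hi2
  rw [← integral_sub_right_eq_self _ v] at h2
  simp_rw [e] at h2
  rw [h2]
  simp [h]

end Measure
end BargmannFock
end

noncomputable section
namespace BargmannFock

/-! ### Coherent states and the reproducing kernel -/

section CoherentFunctions

variable {V : Type*} [NormedAddCommGroup V] [InnerProductSpace ℂ V]

/-- The coherent state `w ↦ e^{⟨v, w⟩} Ω(w)`, as a function. -/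
def cohFun (v w : V) : ℂ := Complex.exp (inner ℂ v w) * groundFun w

theorem continuous_cohFun (v : V) : Continuous (cohFun v) :=
  (Complex.continuous_exp.comp (continuous_const.inner continuous_id)).mul groundFun_continuous

theorem norm_cohFun_le (v w : V) :
    ‖cohFun v w‖ ≤ Real.exp (‖v‖ * ‖w‖) * Real.exp (-(1 / 2) * ‖w‖ ^ 2) := by
  rw [cohFun, norm_mul, norm_groundFun, Complex.norm_exp]
  gcongr
  exact (Complex.re_le_norm _).trans (norm_inner_le_norm v w)

theorem conj_cohFun (v w : V) :
    (starRingEnd ℂ) (cohFun v w) = Complex.exp (inner ℂ w v) * groundFun w := by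
  rw [cohFun, map_mul, conj_groundFun, ← Complex.exp_conj, inner_conj_symm]

end CoherentFunctions

section Coherent

variable {V : Type*} [NormedAddCommGroup V] [InnerProductSpace ℂ V] [FiniteDimensional ℂ V]
  [MeasurableSpace V] [BorelSpace V]

theorem memLp_exp_weight (c : ℝ) :
    MemLp (fun w : V => Real.exp (c * ‖w‖) * Real.exp (-(1 / 2) * ‖w‖ ^ 2)) 2 (dL V) := by
  rw [memLp_two_iff_integrable_sq_norm (Continuous.aestronglyMeasurable (by fun_prop))]
  refine (integrable_exp_neg_mul_sq_add (V := V) one_pos (2 * c)).congr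
    (Eventually.of_forall fun w => ?_)
  simp only [Real.norm_eq_abs, sq_abs]
  rw [← Real.exp_add, ← Real.exp_nat_mul]
  congr 1
  push_cast
  ring

theorem memLp_cohFun (v : V) : MemLp (cohFun v) 2 (dL V) :=
  (memLp_exp_weight ‖v‖).mono (continuous_cohFun v).aestronglyMeasurable
    (Eventually.of_forall fun w => (norm_cohFun_le v w).trans (le_abs_self _))

/-- The coherent state as an element of Bargmann-Fock space. -/
def coh (v : V) : fock V :=
  ⟨(memLp_cohFun v).toLp (cohFun v), fun w => Complex.exp (inner ℂ v w),
    (innerSL ℂ v).differentiable.cexp, (memLp_cohFun v).coeFn_toLp⟩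

theorem coeFn_coh (v : V) : ((coh v : fock V) : Lp ℂ 2 (dL V)) =ᵐ[dL V] cohFun v :=
  (memLp_cohFun v).coeFn_toLp

theorem ground_eq_coh : ground V = coh (0 : V) := by
  apply Subtype.ext
  refine (Lp.ext_iff).2 ((groundFun_memLp.coeFn_toLp).trans ?_)
  filter_upwards [coeFn_coh (0 : V)] with w hw
  rw [hw, cohFun, inner_zero_left, Complex.exp_zero, one_mul]

theorem inner_coh_eq (v : V) (F : Lp ℂ 2 (dL V)) :
    (inner ℂ (coh v : Lp ℂ 2 (dL V)) F : ℂ) =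
      ∫ w, Complex.exp (inner ℂ w v) * (groundFun w * F w) ∂(dL V) := by
  rw [L2.inner_def]
  refine integral_congr_ae ?_
  filter_upwards [coeFn_coh v] with w hw
  rw [hw, RCLike.inner_apply, conj_cohFun]
  ring

theorem integrable_weight_mul (F : Lp ℂ 2 (dL V)) (c : ℝ) :
    Integrable (fun w => Real.exp (c * ‖w‖) * ‖groundFun w * F w‖) (dL V) := by
  have h := (memLp_exp_weight (V := V) c).integrable_mul (Lp.memLp F).norm
  refine h.congr (Eventually.of_forall fun w => ?_)
  simp only [Pi.mul_apply, norm_mul, norm_groundFun]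
  ring

theorem integrable_cexp_inner_mul (v : V) (F : Lp ℂ 2 (dL V)) :
    Integrable (fun w => Complex.exp (inner ℂ w v) * (groundFun w * F w)) (dL V) := by
  refine (integrable_weight_mul F ‖v‖).mono' ?_ (Eventually.of_forall fun w => ?_)
  · exact (Complex.continuous_exp.comp (continuous_id.inner continuous_const)).aestronglyMeasurable.mul
      (groundFun_continuous.aestronglyMeasurable.mul (Lp.aestronglyMeasurable F))
  · rw [norm_mul, Complex.norm_exp]
    gcongr
    refine (Complex.re_le_norm _).trans ((norm_inner_le_norm w v).trans_eq (mul_comm _ _))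

/-- Pairing with coherent states gives entire functions. -/
theorem differentiable_inner_coh (F : Lp ℂ 2 (dL V)) :
    Differentiable ℂ fun v : V => (inner ℂ (coh v : Lp ℂ 2 (dL V)) F : ℂ) := by
  simp_rw [inner_coh_eq]
  intro v₀
  let F' : V → V → V →L[ℂ] ℂ := fun v w =>
    (Complex.exp (inner ℂ w v) * (groundFun w * F w)) • innerSL ℂ w
  have hmeas : ∀ v : V, AEStronglyMeasurable
      (fun w => Complex.exp (inner ℂ w v) * (groundFun w * F w)) (dL V) := fun v =>
    (integrable_cexp_inner_mul v F).aestronglyMeasurable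
  -- The 2 in the bound is 1 for the radius of the ball around v₀ and 1 for ‖w‖ ≤ e^{‖w‖}, which
  -- absorbs the factor created by differentiation.
  refine (hasFDerivAt_integral_of_dominated_of_fderiv_le (F' := F')
    (bound := fun w => Real.exp ((‖v₀‖ + 2) * ‖w‖) * ‖groundFun w * F w‖)
    (Metric.ball_mem_nhds v₀ one_pos) (Eventually.of_forall hmeas)
    (integrable_cexp_inner_mul v₀ F) ?_ ?_ (integrable_weight_mul F _) ?_).differentiableAt
  · exact (hmeas v₀).smul (innerSL ℂ).continuous.aestronglyMeasurable
  · refine Eventually.of_forall fun w v hv => ?_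
    simp only [F']
    rw [norm_smul, norm_mul, Complex.norm_exp, innerSL_apply_norm]
    have h1 : ‖v‖ ≤ ‖v₀‖ + 1 := by
      have := norm_sub_norm_le v v₀
      rw [Metric.mem_ball, dist_eq_norm] at hv
      linarith
    have h2 : Real.exp ((inner ℂ w v : ℂ).re) ≤ Real.exp ((‖v₀‖ + 1) * ‖w‖) := by
      gcongr
      refine (Complex.re_le_norm _).trans ((norm_inner_le_norm w v).trans ?_)
      rw [mul_comm]
      gcongr
    have h3 : ‖w‖ ≤ Real.exp ‖w‖ := by linarith [Real.add_one_le_exp ‖w‖]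
    calc Real.exp ((inner ℂ w v : ℂ).re) * ‖groundFun w * F w‖ * ‖w‖
        ≤ Real.exp ((‖v₀‖ + 1) * ‖w‖) * ‖groundFun w * F w‖ * Real.exp ‖w‖ := by gcongr
      _ = Real.exp ((‖v₀‖ + 1) * ‖w‖) * Real.exp ‖w‖ * ‖groundFun w * F w‖ := by ring
      _ = _ := by
        rw [← Real.exp_add]
        congr 2
        ring
  · refine Eventually.of_forall fun w v _ => ?_
    have h1 : HasFDerivAt (fun v : V => (inner ℂ w v : ℂ)) (innerSL ℂ w) v :=
      (innerSL ℂ w).hasFDerivAt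
    refine (h1.cexp.mul_const (groundFun w * F w)).congr_fderiv ?_
    ext u
    simp only [F', smul_apply, innerSL_apply_apply, smul_eq_mul]
    ring

/-- The value of the holomorphic part of an element of Bargmann-Fock space is the pairing with a
coherent state. -/
theorem inner_coh_of_ae_eq {F : Lp ℂ 2 (dL V)} {f : V → ℂ} (hf : Differentiable ℂ f)
    (hF : F =ᵐ[dL V] fun v => f v * groundFun v) (v : V) :
    (inner ℂ (coh v : Lp ℂ 2 (dL V)) F : ℂ) = f v := by
  have e : (fun w => Complex.exp (inner ℂ w v) * (groundFun w * F w)) =ᵐ[dL V]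
      fun w => f w * Complex.exp (inner ℂ w v - (‖w‖ : ℂ) ^ 2) := by
    filter_upwards [hF] with w hw
    rw [hw, sub_eq_add_neg, Complex.exp_add, ← groundFun_mul_self]
    ring
  rw [inner_coh_eq, integral_congr_ae e]
  exact integral_reproducing hf v ((integrable_cexp_inner_mul v F).congr e)

/-- Replaces the existential entire function by an explicit one: the reproducing formula recovers it
from F, and conversely the pairing is entire for every F in L². Unlike the definition, this
condition visibly passes to limits. -/
theorem mem_fock_iff {F : Lp ℂ 2 (dL V)} :
    F ∈ fock V ↔ F =ᵐ[dL V] fun v => (inner ℂ (coh v : Lp ℂ 2 (dL V)) F : ℂ) * groundFun v := by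
  constructor
  · rintro ⟨f, hf, hF⟩
    simp_rw [inner_coh_of_ae_eq hf hF]
    exact hF
  · exact fun h => ⟨_, differentiable_inner_coh F, h⟩

/-- Along an almost everywhere convergent subsequence both sides of `mem_fock_iff` converge, the
pairings by continuity of the inner product. -/
theorem isClosed_fock : IsClosed (fock V : Set (Lp ℂ 2 (dL V))) := by
  refine isSeqClosed_iff_isClosed.1 fun F G hF hG => ?_
  have h1 : TendstoInMeasure (dL V) (fun n => (F n : V → ℂ)) atTop G :=
    tendstoInMeasure_of_tendsto_Lp hG
  obtain ⟨ns, hns, hae⟩ := h1.exists_seq_tendsto_ae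
  have h2 : ∀ᵐ v ∂(dL V), ∀ n, F n v = (inner ℂ (coh v : Lp ℂ 2 (dL V)) (F n) : ℂ) * groundFun v :=
    ae_all_iff.2 fun n => mem_fock_iff.1 (hF n)
  refine mem_fock_iff.2 ?_
  filter_upwards [hae, h2] with v hv1 hv2
  refine tendsto_nhds_unique hv1 ?_
  simp_rw [hv2]
  refine Tendsto.mul_const _ ?_
  exact ((innerSL ℂ (coh v : Lp ℂ 2 (dL V))).continuous.tendsto G).comp (hG.comp hns.tendsto_atTop)

instance completeSpace_fock : CompleteSpace (fock V) :=
  isClosed_fock.completeSpace_coe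

/-- Elements of Bargmann-Fock space are determined by their pairings with coherent states. -/
theorem fock_ext {F G : fock V} (h : ∀ v : V, (inner ℂ (coh v) F : ℂ) = inner ℂ (coh v) G) :
    F = G := by
  apply Subtype.ext
  refine Lp.ext_iff.2 ?_
  have h2 : ∀ v : V, (inner ℂ (coh v : Lp ℂ 2 (dL V)) (F : Lp ℂ 2 (dL V)) : ℂ) =
      inner ℂ (coh v : Lp ℂ 2 (dL V)) (G : Lp ℂ 2 (dL V)) := h
  filter_upwards [mem_fock_iff.1 F.2, mem_fock_iff.1 G.2] with v h3 h4
  rw [h3, h4, h2]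

theorem inner_coh_coh (u v : V) : (inner ℂ (coh u) (coh v) : ℂ) = Complex.exp (inner ℂ v u) :=
  inner_coh_of_ae_eq (innerSL ℂ v).differentiable.cexp (coeFn_coh v) u

theorem inner_ground_ground : (inner ℂ (ground V) (ground V) : ℂ) = 1 := by
  rw [ground_eq_coh, inner_coh_coh, inner_zero_left, Complex.exp_zero]

theorem norm_ground : ‖ground V‖ = 1 := by
  have h := inner_ground_ground (V := V)
  have h1 := (inner_self_eq_norm_sq_to_K (𝕜 := ℂ) (ground V)).symm.trans h
  have h2 : ‖ground V‖ ^ 2 = 1 := Complex.ofReal_injective (by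
    push_cast
    exact h1)
  exact (pow_eq_one_iff_of_nonneg (norm_nonneg _) two_ne_zero).1 h2

theorem norm_groundProj (F : fock V) : ‖groundProj F‖ = ‖(inner ℂ (ground V) F : ℂ)‖ := by
  rw [groundProj, norm_smul, norm_ground, mul_one]

end Coherent
end BargmannFock
end

noncomputable section
namespace BargmannFock

/-! ### Determinants attached to a symplectic map -/

section RealLinear

/-- A positive operator on a real Euclidean space has a square root. -/
theorem exists_sqrt_of_positive {E : Type*} [NormedAddCommGroup E] [InnerProductSpace ℝ E]
    [FiniteDimensional ℝ E] {P : E →ₗ[ℝ] E} (hP : P.IsPositive) :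
    ∃ R : E →ₗ[ℝ] E, R ∘ₗ R = P ∧ ∀ v, ‖R v‖ ^ 2 = inner ℝ v (P v) := by
  let b := hP.isSymmetric.eigenvectorBasis rfl
  let ev := hP.isSymmetric.eigenvalues rfl
  have hev : ∀ i, 0 ≤ ev i := fun i => hP.nonneg_eigenvalues rfl i
  have hPb : ∀ i, P (b i) = ev i • b i := fun i =>
    hP.isSymmetric.apply_eigenvectorBasis rfl i
  let R : E →ₗ[ℝ] E := ∑ i, Real.sqrt (ev i) • (innerₛₗ ℝ (b i)).smulRight (b i)
  have hRv : ∀ v, R v = ∑ i, Real.sqrt (ev i) • (inner ℝ (b i) v : ℝ) • b i := fun v => by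
    simp [R, LinearMap.sum_apply]
  have hRb : ∀ i, R (b i) = Real.sqrt (ev i) • b i := fun i => by
    rw [hRv, Finset.sum_eq_single i]
    · rw [real_inner_self_eq_norm_sq, b.norm_eq_one]
      simp
    · intro j _ hj
      rw [b.inner_eq_zero hj, zero_smul, smul_zero]
    · simp
  have hsymm : R.IsSymmetric := by
    intro v w
    rw [hRv, hRv, sum_inner, inner_sum]
    refine Finset.sum_congr rfl fun i _ => ?_
    rw [inner_smul_left, inner_smul_left, inner_smul_right, inner_smul_right, real_inner_comm v]
    simp only [conj_trivial]
    ring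
  have hRR : R ∘ₗ R = P := by
    refine b.toBasis.ext fun i => ?_
    simp only [OrthonormalBasis.coe_toBasis, LinearMap.comp_apply]
    rw [hRb, map_smul, hRb, smul_smul, Real.mul_self_sqrt (hev i), hPb]
  refine ⟨R, hRR, fun v => ?_⟩
  rw [← hRR, LinearMap.comp_apply, ← hsymm, real_inner_self_eq_norm_sq]

variable {V : Type*} [NormedAddCommGroup V] [InnerProductSpace ℂ V]

theorem IsSymplectic.symm {S : V ≃ₗ[ℝ] V} (hS : IsSymplectic S) : IsSymplectic S.symm := by
  intro v w
  rw [← hS, S.apply_symm_apply, S.apply_symm_apply]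

variable [FiniteDimensional ℂ V]

/-- The positive operator `(1 + SᵀS) / 2` of a symplectic map `S`, whose determinant is determined by
that of the holomorphic block of `S`. -/
theorem exists_adjoint (S : V ≃ₗ[ℝ] V) (hS : IsSymplectic S) :
    ∃ P : V →ₗ[ℝ] V, (∀ v, (inner ℂ v (P v) : ℂ).re = (‖v‖ ^ 2 + ‖S v‖ ^ 2) / 2) ∧
      (let _ := InnerProductSpace.rclikeToReal ℂ V; P.IsPositive) ∧
      LinearMap.det S.toLinearMap ^ 2 = 1 ∧
      LinearMap.det P ^ 2 = Complex.normSq (LinearMap.det (holoBlock S.toLinearMap)) ^ 2 := by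
  let _ := InnerProductSpace.rclikeToReal ℂ V
  have hfd : FiniteDimensional ℝ V := FiniteDimensional.complexToReal V
  let J : V →ₗ[ℝ] V := (LinearMap.lsmul ℂ V Complex.I).restrictScalars ℝ
  have hJ : ∀ v, J v = Complex.I • v := fun v => rfl
  have hre : ∀ v w : V, inner ℝ v w = (inner ℂ v w : ℂ).re := fun v w => rfl
  have hsig : ∀ v w : V, inner ℝ (J v) w = sigma v w := by
    intro v w
    rw [hre, hJ, inner_smul_left, sigma]
    simp
  let S₀ : V →ₗ[ℝ] V := S.toLinearMap
  let T : V →ₗ[ℝ] V := LinearMap.adjoint S₀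
  -- Symplecticity SᵀJS = J, with the transpose taken for the real inner product Re⟨·,·⟩.
  have hJT : T ∘ₗ J ∘ₗ S₀ = J := by
    ext v
    refine ext_inner_right ℝ fun w => ?_
    rw [LinearMap.comp_apply, LinearMap.adjoint_inner_left, LinearMap.comp_apply, hsig, hsig]
    exact hS v w
  have hdetT : LinearMap.det T = LinearMap.det S₀ := by
    let b := stdOrthonormalBasis ℝ V
    rw [← LinearMap.det_toMatrix b.toBasis, ← LinearMap.det_toMatrix b.toBasis S₀,
      LinearMap.toMatrix_adjoint, Matrix.det_conjTranspose]
    simp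
  have hJJ : ∀ v, J (J v) = -v := fun v => by
    rw [hJ, hJ, smul_smul, Complex.I_mul_I, neg_one_smul]
  have hdetJ : LinearMap.det J ≠ 0 := by
    have h1 : J ∘ₗ (-J) = LinearMap.id := by
      ext v
      simp [hJJ]
    have h2 := congrArg LinearMap.det h1
    rw [LinearMap.det_comp, LinearMap.det_id] at h2
    exact left_ne_zero_of_mul_eq_one h2
  have hdet : LinearMap.det S₀ ^ 2 = 1 := by
    have h := congrArg LinearMap.det hJT
    rw [LinearMap.det_comp, LinearMap.det_comp, hdetT] at h
    have h2 : LinearMap.det J * LinearMap.det S₀ ^ 2 = LinearMap.det J * 1 := by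
      rw [mul_one]
      conv_rhs => rw [← h]
      ring
    exact mul_left_cancel₀ hdetJ h2
  let A : V →ₗ[ℝ] V := (holoBlock S₀).restrictScalars ℝ
  have hA : ∀ v, A v = (2⁻¹ : ℝ) • (S₀ v - J (S₀ (J v))) := fun v => by
    rw [← Complex.coe_smul]
    push_cast
    rfl
  -- Since SᵀJS = J and J² = -1, the product Sᵀ·(S - JSJ)/2 equals (1 + SᵀS)/2. The real determinant
  -- of the complex-linear factor A is the squared modulus of its complex determinant.
  let P : V →ₗ[ℝ] V := T ∘ₗ A
  have hP : ∀ v, P v = (2⁻¹ : ℝ) • (v + T (S₀ v)) := by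
    intro v
    have h := LinearMap.congr_fun hJT (J v)
    simp only [LinearMap.comp_apply] at h
    simp only [P, LinearMap.comp_apply]
    rw [hA, map_smul, map_sub, h, hJJ]
    congr 1
    abel
  have hinner : ∀ v w, inner ℝ v (P w) = (inner ℝ v w + inner ℝ (S v) (S w)) / 2 := by
    intro v w
    rw [hP, inner_smul_right, inner_add_right, LinearMap.adjoint_inner_right]
    change 2⁻¹ * (inner ℝ v w + inner ℝ (S v) (S w)) = _
    ring
  have hself : ∀ v, inner ℝ v (P v) = (‖v‖ ^ 2 + ‖S v‖ ^ 2) / 2 := fun v => by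
    rw [hinner, real_inner_self_eq_norm_sq, real_inner_self_eq_norm_sq]
  refine ⟨P, hself, ⟨fun v w => ?_, fun v => ?_⟩, hdet, ?_⟩
  · rw [hinner, real_inner_comm, hinner, real_inner_comm w v, real_inner_comm (S w) (S v)]
  · rw [real_inner_comm]
    simp only [RCLike.re_to_real]
    rw [hself]
    positivity
  · rw [LinearMap.det_comp, hdetT, mul_pow, hdet, one_mul, LinearMap.det_restrictScalars,
      Algebra.norm_complex_apply]

theorem continuous_realEquiv (S : V ≃ₗ[ℝ] V) : Continuous S :=
  haveI : FiniteDimensional ℝ V := FiniteDimensional.complexToReal V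
  S.toLinearMap.continuous_of_finiteDimensional

end RealLinear

/-! ### The overlap integral and the modulus of η -/

section Overlap

variable {V : Type*} [NormedAddCommGroup V] [InnerProductSpace ℂ V] [FiniteDimensional ℂ V]
  [MeasurableSpace V] [BorelSpace V]

theorem measurePreserving_of_det {S : V ≃ₗ[ℝ] V} (h : LinearMap.det S.toLinearMap ^ 2 = 1) :
    MeasurePreserving S (dL V) (dL V) := by
  have hfd : FiniteDimensional ℝ V := FiniteDimensional.complexToReal V
  have h1 : |LinearMap.det S.toLinearMap| = 1 := by
    rw [← sq_abs] at h
    exact (pow_eq_one_iff_of_nonneg (abs_nonneg _) two_ne_zero).1 h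
  have h0 : LinearMap.det S.toLinearMap ≠ 0 := by
    intro h0
    simp [h0] at h1
  refine ⟨(S.toLinearMap.continuous_of_finiteDimensional).measurable, ?_⟩
  have := Measure.map_linearMap_addHaar_eq_smul_addHaar (dL V) h0
  rw [abs_inv, h1] at this
  simpa using this

theorem IsSymplectic.measurePreserving {S : V ≃ₗ[ℝ] V} (hS : IsSymplectic S) :
    MeasurePreserving S (dL V) (dL V) := by
  obtain ⟨P, -, -, h, -⟩ := exists_adjoint S hS
  exact measurePreserving_of_det h

/-- The overlap integral `∫ exp(-(‖d‖² + ‖S d‖²) / 2) dL(d)`. -/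
def overlap (S : V ≃ₗ[ℝ] V) : ℝ :=
  ∫ d, Real.exp (-(1 / 2) * ‖S d‖ ^ 2) * Real.exp (-(1 / 2) * ‖d‖ ^ 2) ∂(dL V)

theorem integrable_overlap (S : V ≃ₗ[ℝ] V) :
    Integrable (fun d => Real.exp (-(1 / 2) * ‖S d‖ ^ 2) * Real.exp (-(1 / 2) * ‖d‖ ^ 2)) (dL V) := by
  have hc := continuous_realEquiv S
  refine (integrable_exp_neg_mul_sq (V := V) (half_pos one_pos)).mono'
    (Continuous.aestronglyMeasurable (by fun_prop)) (Eventually.of_forall fun d => ?_)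
  rw [norm_mul, Real.norm_of_nonneg (Real.exp_pos _).le, Real.norm_of_nonneg (Real.exp_pos _).le]
  refine mul_le_of_le_one_left (Real.exp_pos _).le ?_
  rw [Real.exp_le_one_iff]
  have := sq_nonneg ‖S d‖
  linarith

theorem overlap_symm {S : V ≃ₗ[ℝ] V} (hS : IsSymplectic S) : overlap S.symm = overlap S := by
  rw [overlap, overlap]
  have hemb : MeasurableEmbedding S :=
    (Homeomorph.mk S.toEquiv (continuous_realEquiv S) (continuous_realEquiv S.symm)).measurableEmbedding
  rw [← hS.measurePreserving.integral_comp hemb]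
  refine integral_congr_ae (Eventually.of_forall fun d => ?_)
  simp only [S.symm_apply_apply]
  ring

theorem integral_exp_neg_sq_comp {R : V →ₗ[ℝ] V} (hR : LinearMap.det R ≠ 0) :
    ∫ v, Real.exp (-‖R v‖ ^ 2) ∂(dL V) = |(LinearMap.det R)⁻¹| := by
  have hfd : FiniteDimensional ℝ V := FiniteDimensional.complexToReal V
  have hc : Continuous R := R.continuous_of_finiteDimensional
  have h1 := integral_map (μ := dL V) hc.measurable.aemeasurable
    (f := fun v => Real.exp (-‖v‖ ^ 2)) (Continuous.aestronglyMeasurable (by fun_prop))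
  rw [← h1, Measure.map_linearMap_addHaar_eq_smul_addHaar (dL V) hR, integral_smul_measure,
    integral_exp_neg_sq, smul_eq_mul, mul_one, ENNReal.toReal_ofReal (abs_nonneg _)]

/-- With R the square root of P = (1 + SᵀS)/2, the integrand is e^{-‖Rd‖²} and the overlap is 1/|det
R|. The fourth power appears because det R² = det P and only (det P)² has been computed. -/
theorem overlap_pow_four_mul {S : V ≃ₗ[ℝ] V} (hS : IsSymplectic S) :
    overlap S ^ 4 * Complex.normSq (LinearMap.det (holoBlock S.toLinearMap)) ^ 2 = 1 := by
  have hfd : FiniteDimensional ℝ V := FiniteDimensional.complexToReal V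
  obtain ⟨P, hP, hpos, -, hdet⟩ := exists_adjoint S hS
  obtain ⟨R, hRR, hR⟩ := @exists_sqrt_of_positive V _ (InnerProductSpace.rclikeToReal ℂ V) _ P hpos
  have hR' : ∀ v, ‖R v‖ ^ 2 = (‖v‖ ^ 2 + ‖S v‖ ^ 2) / 2 := fun v => (hR v).trans (hP v)
  have hker : LinearMap.ker R = ⊥ := by
    rw [LinearMap.ker_eq_bot']
    intro v hv
    have h := hR' v
    rw [hv, norm_zero] at h
    have : ‖v‖ ^ 2 = 0 := by nlinarith [sq_nonneg ‖v‖, sq_nonneg ‖S v‖]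
    simpa using this
  have hR0 : LinearMap.det R ≠ 0 := by
    have := (LinearEquiv.ofInjectiveEndo R (LinearMap.ker_eq_bot.1 hker)).isUnit_det'
    exact this.ne_zero
  have hov : overlap S = |(LinearMap.det R)⁻¹| := by
    rw [← integral_exp_neg_sq_comp hR0, overlap]
    refine integral_congr_ae (Eventually.of_forall fun v => ?_)
    simp only
    rw [← Real.exp_add, hR']
    congr 1
    ring
  have hdR : LinearMap.det R ^ 2 = LinearMap.det P := by
    rw [← hRR, LinearMap.det_comp, sq]
  rw [hov, ← hdet, ← hdR, show 4 = 2 * 2 by norm_num, pow_mul, sq_abs]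
  field_simp

/-- The normalization that makes η times the compression isometric. Nonnegativity of the overlap
allows the fourth root to be taken. -/
theorem norm_factor_sq_mul_overlap {S : V ≃ₗ[ℝ] V} (hS : IsSymplectic S) {η : ℂ}
    (hη : IsMetaplecticFactor S η) : ‖η‖ ^ 2 * overlap S = 1 := by
  have h0 : 0 ≤ overlap S := integral_nonneg fun d => by positivity
  have h := overlap_pow_four_mul hS
  have h1 : Complex.normSq (LinearMap.det (holoBlock S.toLinearMap)) = ‖η‖ ^ 4 := by
    rw [Complex.normSq_eq_norm_sq, ← RCLike.norm_conj, ← hη, norm_pow]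
    ring
  rw [h1] at h
  have h2 : (‖η‖ ^ 2 * overlap S) ^ 4 = 1 := by
    rw [← h]
    ring
  exact (pow_eq_one_iff_of_nonneg (by positivity) (by norm_num)).1 h2

end Overlap
end BargmannFock
end

noncomputable section
namespace BargmannFock

/-! ### Heisenberg translations -/

section Sigma

variable {V : Type*} [NormedAddCommGroup V] [InnerProductSpace ℂ V]

theorem continuous_sigma (z : V) : Continuous (sigma z) := by
  unfold sigma
  fun_prop

theorem sigma_self (z : V) : sigma z z = 0 := by
  rw [sigma, inner_self_eq_norm_sq_to_K]
  norm_cast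

theorem sigma_swap (z w : V) : sigma w z = -sigma z w := by
  rw [sigma, sigma, ← inner_conj_symm, Complex.conj_im]

theorem sigma_neg_left (z w : V) : sigma (-z) w = -sigma z w := by
  rw [sigma, sigma, inner_neg_left, Complex.neg_im]

theorem sigma_add_left (z z' w : V) : sigma (z + z') w = sigma z w + sigma z' w := by
  rw [sigma, sigma, sigma, inner_add_left, Complex.add_im]

theorem sigma_sub_right (z w w' : V) : sigma z (w - w') = sigma z w - sigma z w' := by
  rw [sigma, sigma, sigma, inner_sub_right, Complex.sub_im]

theorem abs_sigma_le (z w : V) : |sigma z w| ≤ ‖z‖ * ‖w‖ :=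
  (Complex.abs_im_le_norm _).trans (norm_inner_le_norm z w)

theorem I_mul_sigma (z w : V) :
    Complex.I * (sigma z w : ℂ) = (inner ℂ z w - inner ℂ w z) / 2 := by
  rw [← inner_conj_symm w z, Complex.sub_conj, sigma]
  push_cast
  ring

theorem norm_sq_eq_inner (v : V) : ((‖v‖ : ℂ) ^ 2) = inner ℂ v v :=
  (inner_self_eq_norm_sq_to_K (𝕜 := ℂ) v).symm

/-- The phase factor of the Heisenberg translations. -/
def phase (t : ℝ) : ℂ := Complex.exp (t * Complex.I)

theorem norm_phase (t : ℝ) : ‖phase t‖ = 1 := Complex.norm_exp_ofReal_mul_I t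

theorem phase_add (s t : ℝ) : phase (s + t) = phase s * phase t := by
  rw [phase, phase, phase, ← Complex.exp_add]
  push_cast
  ring_nf

theorem phase_zero : phase 0 = 1 := by
  simp [phase]

theorem conj_phase_mul (t : ℝ) : (starRingEnd ℂ) (phase t) * phase t = 1 := by
  rw [← Complex.normSq_eq_conj_mul_self, Complex.normSq_eq_norm_sq, norm_phase]
  simp

theorem continuous_phase : Continuous phase := by
  unfold phase
  fun_prop

/-- The kernel identity behind the conjugated projection. -/
theorem kernel_identity (p q : V) :
    Complex.exp (inner ℂ (p - q) p) * (groundFun (p - q) * groundFun p) =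
      (Real.exp (-(1 / 2) * ‖q‖ ^ 2) : ℂ) * phase (-sigma q p) := by
  rw [groundFun_eq, groundFun_eq, phase, ← Complex.exp_add, ← Complex.exp_add, Complex.ofReal_exp,
    ← Complex.exp_add]
  congr 1
  push_cast
  have h := I_mul_sigma q p
  rw [norm_sq_eq_inner, norm_sq_eq_inner, norm_sq_eq_inner, inner_sub_left, inner_sub_left,
    inner_sub_right, inner_sub_right]
  linear_combination h

/-- The phase iσ(z,x) combines with the cross term Re⟨z,x⟩ of the Gaussian to give the holomorphic
⟨z,x⟩. Hence the translations with κ = 1 preserve Bargmann–Fock space. -/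
theorem weyl_identity (x z : V) :
    phase (sigma z x) * groundFun (x - z) =
      Complex.exp (inner ℂ z x) * (Real.exp (-(1 / 2) * ‖z‖ ^ 2) : ℂ) * groundFun x := by
  rw [groundFun_eq, groundFun_eq, phase, Complex.ofReal_exp, ← Complex.exp_add, ← Complex.exp_add,
    ← Complex.exp_add]
  congr 1
  push_cast
  have h := I_mul_sigma z x
  rw [norm_sq_eq_inner, norm_sq_eq_inner, norm_sq_eq_inner, inner_sub_left,
    inner_sub_right, inner_sub_right]
  linear_combination h

/-- With the opposite phase the cross term becomes the antiholomorphic ⟨x,z⟩, which merely shifts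
the reproducing kernel from u to u + z. -/
theorem weyl_neg_identity (u x z : V) :
    Complex.exp (inner ℂ x u) * (groundFun x * (phase (-sigma z x) * groundFun (x - z))) =
      (Real.exp (-(1 / 2) * ‖z‖ ^ 2) : ℂ) * Complex.exp (inner ℂ x (u + z) - (‖x‖ : ℂ) ^ 2) := by
  rw [groundFun_eq, groundFun_eq, phase, Complex.ofReal_exp, ← Complex.exp_add, ← Complex.exp_add,
    ← Complex.exp_add, ← Complex.exp_add]
  congr 1
  push_cast
  have h := I_mul_sigma z x
  rw [norm_sq_eq_inner, norm_sq_eq_inner, norm_sq_eq_inner, inner_sub_left,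
    inner_sub_right, inner_sub_right, inner_add_right]
  linear_combination -h

/-- Puts the Gaussian average of translations in the shape of the reproducing formula with
integration variable d and evaluation point x. -/
theorem weyl_moyal_identity (x d : V) :
    (Real.exp (-(1 / 2) * ‖d‖ ^ 2) : ℂ) * (phase (sigma d x) * groundFun (x - d)) =
      groundFun x * Complex.exp (inner ℂ d x - (‖d‖ : ℂ) ^ 2) := by
  rw [weyl_identity, sub_eq_add_neg, Complex.exp_add]
  have : Complex.exp (-(‖d‖ : ℂ) ^ 2) =
      (Real.exp (-(1 / 2) * ‖d‖ ^ 2) : ℂ) * (Real.exp (-(1 / 2) * ‖d‖ ^ 2) : ℂ) := by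
    rw [Complex.ofReal_exp, ← Complex.exp_add]
    congr 1
    push_cast
    ring
  rw [this]
  ring

end Sigma

section Weyl

variable {V : Type*} [NormedAddCommGroup V] [InnerProductSpace ℂ V] [FiniteDimensional ℂ V]
  [MeasurableSpace V] [BorelSpace V]

theorem inner_Lp_eq (F G : Lp ℂ 2 (dL V)) :
    (inner ℂ F G : ℂ) = ∫ x, (starRingEnd ℂ) (F x) * G x ∂(dL V) := by
  rw [L2.inner_def]
  refine integral_congr_ae (Eventually.of_forall fun x => ?_)
  simp only [RCLike.inner_apply]
  ring

theorem ae_sub_right {p : V → Prop} (h : ∀ᵐ x ∂(dL V), p x) (z : V) : ∀ᵐ x ∂(dL V), p (x - z) :=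
  (measurePreserving_sub_right (dL V) z).quasiMeasurePreserving.ae h

theorem memLp_weyl (κ : ℝ) (z : V) (F : Lp ℂ 2 (dL V)) :
    MemLp (fun x => phase (κ * sigma z x) * F (x - z)) 2 (dL V) := by
  have h := (Lp.memLp F).comp_measurePreserving (measurePreserving_sub_right (dL V) z)
  refine h.mono ?_ (Eventually.of_forall fun x => ?_)
  · exact (continuous_phase.comp (continuous_const.mul (continuous_sigma z))).aestronglyMeasurable.mul
      h.aestronglyMeasurable
  · rw [norm_mul, norm_phase, one_mul]
    rfl

/-- The translations `F ↦ e^{i κ σ(z, x)} F(x - z)` of `L²(V, dL)`. For `κ = 1` they preserve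
Bargmann-Fock space, and for `κ = -1` they commute with those for `κ = 1`. -/
def weyl (κ : ℝ) (z : V) : Lp ℂ 2 (dL V) →ₗᵢ[ℂ] Lp ℂ 2 (dL V) :=
  LinearMap.isometryOfInner
    { toFun := fun F => (memLp_weyl κ z F).toLp _
      map_add' := fun F G => by
        refine Lp.ext_iff.2 ?_
        filter_upwards [(memLp_weyl κ z (F + G)).coeFn_toLp, (memLp_weyl κ z F).coeFn_toLp,
          (memLp_weyl κ z G).coeFn_toLp, Lp.coeFn_add ((memLp_weyl κ z F).toLp _)
          ((memLp_weyl κ z G).toLp _), ae_sub_right (Lp.coeFn_add F G) z] with x h1 h2 h3 h4 h5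
        rw [h1, h4, Pi.add_apply, h2, h3, h5, Pi.add_apply, mul_add]
      map_smul' := fun c F => by
        refine Lp.ext_iff.2 ?_
        filter_upwards [(memLp_weyl κ z (c • F)).coeFn_toLp, (memLp_weyl κ z F).coeFn_toLp,
          Lp.coeFn_smul c ((memLp_weyl κ z F).toLp _), ae_sub_right (Lp.coeFn_smul c F) z]
          with x h1 h2 h3 h4
        rw [h1, RingHom.id_apply, h3, Pi.smul_apply, h2, h4, Pi.smul_apply, smul_eq_mul, smul_eq_mul]
        ring }
    (fun F G => by
      rw [inner_Lp_eq, inner_Lp_eq,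
        ← integral_sub_right_eq_self (fun x => (starRingEnd ℂ) (F x) * G x) z]
      refine integral_congr_ae ?_
      filter_upwards [(memLp_weyl κ z F).coeFn_toLp, (memLp_weyl κ z G).coeFn_toLp] with x h1 h2
      simp only [LinearMap.coe_mk, AddHom.coe_mk]
      rw [h1, h2, map_mul]
      linear_combination ((starRingEnd ℂ) (F (x - z)) * G (x - z)) * conj_phase_mul (κ * sigma z x))

theorem coeFn_weyl (κ : ℝ) (z : V) (F : Lp ℂ 2 (dL V)) :
    weyl κ z F =ᵐ[dL V] fun x => phase (κ * sigma z x) * F (x - z) :=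
  (memLp_weyl κ z F).coeFn_toLp

theorem weyl_weyl (κ : ℝ) (z w : V) (F : Lp ℂ 2 (dL V)) :
    weyl κ z (weyl κ w F) = phase (κ * sigma z w) • weyl κ (z + w) F := by
  refine Lp.ext_iff.2 ?_
  filter_upwards [coeFn_weyl κ z (weyl κ w F), ae_sub_right (coeFn_weyl κ w F) z,
    coeFn_weyl κ (z + w) F, Lp.coeFn_smul (phase (κ * sigma z w)) (weyl κ (z + w) F)]
    with x h1 h2 h3 h4
  rw [h1, h2, h4, Pi.smul_apply, h3, smul_eq_mul, ← mul_assoc, ← mul_assoc, ← phase_add,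
    ← phase_add, sub_sub]
  congr 2
  rw [sigma_sub_right, sigma_add_left, sigma_swap z w]
  ring

theorem weyl_zero (κ : ℝ) (F : Lp ℂ 2 (dL V)) : weyl κ 0 F = F := by
  refine Lp.ext_iff.2 ?_
  filter_upwards [coeFn_weyl κ (0 : V) F] with x h
  rw [h, sub_zero, sigma, inner_zero_left, Complex.zero_im, mul_zero, phase_zero, one_mul]

theorem weyl_neg_weyl (κ : ℝ) (z : V) (F : Lp ℂ 2 (dL V)) : weyl κ (-z) (weyl κ z F) = F := by
  rw [weyl_weyl, neg_add_cancel, weyl_zero, sigma_neg_left, sigma_self, neg_zero, mul_zero,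
    phase_zero, one_smul]

theorem inner_weyl_right (κ : ℝ) (z : V) (F G : Lp ℂ 2 (dL V)) :
    (inner ℂ F (weyl κ z G) : ℂ) = inner ℂ (weyl κ (-z) F) G := by
  rw [← LinearIsometry.inner_map_map (weyl κ (-z)) F, weyl_neg_weyl]

theorem weyl_mem_fock (z : V) {F : Lp ℂ 2 (dL V)} (hF : F ∈ fock V) : weyl 1 z F ∈ fock V := by
  obtain ⟨f, hf, hFf⟩ := hF
  refine ⟨fun x => f (x - z) * (Complex.exp (inner ℂ z x) * (Real.exp (-(1 / 2) * ‖z‖ ^ 2) : ℂ)),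
    ?_, ?_⟩
  · exact (hf.comp (differentiable_id.sub_const z)).mul
      ((innerSL ℂ z).differentiable.cexp.mul_const _)
  · filter_upwards [coeFn_weyl 1 z F, ae_sub_right hFf z] with x h1 h2
    rw [h1, h2, one_mul]
    linear_combination f (x - z) * weyl_identity x z

/-- The Heisenberg translations of Bargmann-Fock space. -/
def tau (z : V) : fock V →ₗᵢ[ℂ] fock V where
  toLinearMap := (weyl 1 z).toLinearMap.restrict fun _ hF => weyl_mem_fock z hF
  norm_map' F := (weyl 1 z).norm_map F

theorem coe_tau (z : V) (F : fock V) : ((tau z F : fock V) : Lp ℂ 2 (dL V)) = weyl 1 z F := rfl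

theorem inner_tau_right (z : V) (F G : fock V) :
    (inner ℂ F (tau z G) : ℂ) = inner ℂ (tau (-z) F) G :=
  inner_weyl_right 1 z F G

theorem tau_tau (z w : V) (F : fock V) :
    tau z (tau w F) = phase (sigma z w) • tau (z + w) F := by
  apply Subtype.ext
  have := weyl_weyl 1 z w (F : Lp ℂ 2 (dL V))
  rwa [one_mul] at this

theorem inner_coh_tau (v z : V) (F : fock V) :
    (inner ℂ (coh v) (tau z F) : ℂ) = inner ℂ (coh (v - z)) F *
      (Complex.exp (inner ℂ z v) * (Real.exp (-(1 / 2) * ‖z‖ ^ 2) : ℂ)) := by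
  have hF := mem_fock_iff.1 F.2
  refine inner_coh_of_ae_eq (F := weyl 1 z F) (f := fun v => inner ℂ (coh (v - z)) F *
      (Complex.exp (inner ℂ z v) * (Real.exp (-(1 / 2) * ‖z‖ ^ 2) : ℂ))) ?_ ?_ v
  · exact ((differentiable_inner_coh (F : Lp ℂ 2 (dL V))).comp (differentiable_id.sub_const z)).mul
      ((innerSL ℂ z).differentiable.cexp.mul_const _)
  · filter_upwards [coeFn_weyl 1 z (F : Lp ℂ 2 (dL V)), ae_sub_right hF z] with x h1 h2
    rw [h1, h2, one_mul]
    change phase (sigma z x) * ((inner ℂ (coh (x - z)) F : ℂ) * groundFun (x - z)) = _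
    linear_combination (inner ℂ (coh (x - z)) F : ℂ) * weyl_identity x z

theorem inner_ground_tau_ground (z : V) :
    (inner ℂ (ground V) (tau z (ground V)) : ℂ) = (Real.exp (-(1 / 2) * ‖z‖ ^ 2) : ℂ) := by
  rw [ground_eq_coh, inner_coh_tau, inner_coh_coh, inner_zero_left, inner_zero_right,
    Complex.exp_zero, one_mul, one_mul]

theorem inner_proj (F : fock V) (X : Lp ℂ 2 (dL V)) :
    (inner ℂ F ((fock V).orthogonalProjectionOnto X) : ℂ) = inner ℂ (F : Lp ℂ 2 (dL V)) X :=
  Submodule.inner_orthogonalProjectionOnto_eq_of_mem_left F X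

/-- The kernel shift to u + z cancels the translation of f by z, leaving f(u). So the translations
with κ = -1 compress to scalars on Bargmann–Fock space. -/
theorem inner_coh_weyl_neg (u z : V) (F : fock V) :
    (inner ℂ (coh u : Lp ℂ 2 (dL V)) (weyl (-1) z F) : ℂ) =
      (Real.exp (-(1 / 2) * ‖z‖ ^ 2) : ℂ) * inner ℂ (coh u) F := by
  obtain ⟨f, hf, hF⟩ := F.2
  have e : (fun w => Complex.exp (inner ℂ w u) * (groundFun w * weyl (-1) z (F : Lp ℂ 2 (dL V)) w))
      =ᵐ[dL V] fun w => (Real.exp (-(1 / 2) * ‖z‖ ^ 2) : ℂ) *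
        (f (w - z) * Complex.exp (inner ℂ w (u + z) - (‖w‖ : ℂ) ^ 2)) := by
    filter_upwards [coeFn_weyl (-1) z (F : Lp ℂ 2 (dL V)), ae_sub_right hF z] with w h1 h2
    rw [h1, h2, neg_one_mul]
    linear_combination f (w - z) * weyl_neg_identity u w z
  have hi := (integrable_cexp_inner_mul u (weyl (-1) z (F : Lp ℂ 2 (dL V)))).congr e
  have hne : (Real.exp (-(1 / 2) * ‖z‖ ^ 2) : ℂ) ≠ 0 := by
    exact_mod_cast (Real.exp_pos _).ne'
  have hi2 : Integrable (fun w => f (w - z) * Complex.exp (inner ℂ w (u + z) - (‖w‖ : ℂ) ^ 2))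
      (dL V) := by
    refine (hi.const_mul (Real.exp (-(1 / 2) * ‖z‖ ^ 2) : ℂ)⁻¹).congr
      (Eventually.of_forall fun w => ?_)
    simp only
    rw [← mul_assoc, inv_mul_cancel₀ hne, one_mul]
  rw [inner_coh_eq, integral_congr_ae e, integral_const_mul,
    integral_reproducing (f := fun w => f (w - z)) (hf.comp (differentiable_id.sub_const z)) (u + z) hi2,
    add_sub_cancel_right]
  congr 1
  exact (inner_coh_of_ae_eq hf hF u).symm

theorem inner_weyl_neg (G F : fock V) (z : V) :
    (inner ℂ (G : Lp ℂ 2 (dL V)) (weyl (-1) z F) : ℂ) =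
      (Real.exp (-(1 / 2) * ‖z‖ ^ 2) : ℂ) * inner ℂ G F := by
  have h : (fock V).orthogonalProjectionOnto (weyl (-1) z (F : Lp ℂ 2 (dL V))) =
      (Real.exp (-(1 / 2) * ‖z‖ ^ 2) : ℂ) • F :=
    fock_ext fun u => (inner_proj _ _).trans
      ((inner_coh_weyl_neg u z F).trans (inner_smul_right (coh u) F _).symm)
  exact (inner_proj _ _).symm.trans ((congrArg (inner ℂ G) h).trans (inner_smul_right G F _))

/-- Fubini for twisted convolutions. -/
theorem integral_mul_inner_weyl (κ : ℝ) {ρ : V → ℝ} (hρ : Integrable ρ (dL V))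
    (hρc : Continuous ρ) (G F : Lp ℂ 2 (dL V)) :
    ∫ d, (ρ d : ℂ) * inner ℂ G (weyl κ d F) ∂(dL V) =
      ∫ x, (starRingEnd ℂ) (G x) * ∫ d, (ρ d : ℂ) * (phase (κ * sigma d x) * F (x - d)) ∂(dL V)
        ∂(dL V) := by
  let K : V → V → ℂ := fun d x =>
    (ρ d : ℂ) * ((starRingEnd ℂ) (G x) * (phase (κ * sigma d x) * F (x - d)))
  have hFm : StronglyMeasurable F := Lp.stronglyMeasurable F
  have hGm : StronglyMeasurable G := Lp.stronglyMeasurable G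
  have hsig : Continuous fun p : V × V => phase (κ * sigma p.1 p.2) := by
    unfold phase sigma
    fun_prop
  have hKm : StronglyMeasurable (Function.uncurry K) := by
    have h1 : StronglyMeasurable fun p : V × V => (ρ p.1 : ℂ) :=
      (Complex.continuous_ofReal.comp (hρc.comp continuous_fst)).stronglyMeasurable
    have h2 : StronglyMeasurable fun p : V × V => (starRingEnd ℂ) (G p.2) :=
      Complex.continuous_conj.comp_stronglyMeasurable (hGm.comp_measurable measurable_snd)
    have h3 : StronglyMeasurable fun p : V × V => F (p.2 - p.1) :=
      hFm.comp_measurable (measurable_snd.sub measurable_fst)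
    exact h1.mul (h2.mul (hsig.stronglyMeasurable.mul h3))
  have hsq : ∀ X : Lp ℂ 2 (dL V), Integrable (fun x => ‖X x‖ ^ 2) (dL V) := fun X =>
    (memLp_two_iff_integrable_sq_norm (Lp.aestronglyMeasurable X)).1 (Lp.memLp X)
  -- The inequality ab ≤ (a² + b²)/2 suffices: the integral in x of the right side is |ρ(d)| times a
  -- constant independent of d.
  have hbound : ∀ d x, ‖K d x‖ ≤ |ρ d| * ((‖G x‖ ^ 2 + ‖F (x - d)‖ ^ 2) / 2) := by
    intro d x
    simp only [K, norm_mul, norm_phase, one_mul, RCLike.norm_conj, Complex.norm_real,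
      Real.norm_eq_abs]
    gcongr
    nlinarith [sq_nonneg (‖G x‖ - ‖F (x - d)‖)]
  have hbi : ∀ d, Integrable (fun x => |ρ d| * ((‖G x‖ ^ 2 + ‖F (x - d)‖ ^ 2) / 2)) (dL V) :=
    fun d => (((hsq G).add ((hsq F).comp_sub_right d)).div_const 2).const_mul _
  have hKi : Integrable (Function.uncurry K) ((dL V).prod (dL V)) := by
    rw [integrable_prod_iff hKm.aestronglyMeasurable]
    refine ⟨Eventually.of_forall fun d => (hbi d).mono'
      (hKm.comp_measurable measurable_prodMk_left).aestronglyMeasurable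
      (Eventually.of_forall (hbound d)), ?_⟩
    refine (hρ.norm.mul_const ((∫ x, ‖G x‖ ^ 2 ∂(dL V) + ∫ x, ‖F x‖ ^ 2 ∂(dL V)) / 2)).mono'
      hKm.norm.integral_prod_right'.aestronglyMeasurable (Eventually.of_forall fun d => ?_)
    rw [Real.norm_of_nonneg (integral_nonneg fun _ => norm_nonneg _)]
    have h1 := integral_mono_of_nonneg (Eventually.of_forall fun x => norm_nonneg (K d x)) (hbi d)
      (Eventually.of_forall (hbound d))
    refine h1.trans_eq ?_
    rw [integral_const_mul, integral_div, integral_add (hsq G) ((hsq F).comp_sub_right d),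
      integral_sub_right_eq_self (fun x => ‖F x‖ ^ 2) d]
    rfl
  have hL : ∀ d, (ρ d : ℂ) * inner ℂ G (weyl κ d F) = ∫ x, K d x ∂(dL V) := by
    intro d
    simp only [K]
    rw [integral_const_mul, inner_Lp_eq]
    congr 1
    refine integral_congr_ae ?_
    filter_upwards [coeFn_weyl κ d F] with x hx
    rw [hx]
  have hR : ∀ x, (starRingEnd ℂ) (G x) * ∫ d, (ρ d : ℂ) * (phase (κ * sigma d x) * F (x - d)) ∂(dL V) =
      ∫ d, K d x ∂(dL V) := by
    intro x
    rw [← integral_const_mul]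
    refine integral_congr_ae (Eventually.of_forall fun d => ?_)
    simp only [K]
    ring
  simp_rw [hL, hR]
  exact integral_integral_swap hKi

/-- The ground state projection as an average of translations. -/
theorem norm_inner_ground_sq (F : fock V) :
    ((‖(inner ℂ (ground V) F : ℂ)‖ ^ 2 : ℝ) : ℂ) =
      ∫ d, (Real.exp (-(1 / 2) * ‖d‖ ^ 2) : ℂ) * inner ℂ F (tau d F) ∂(dL V) := by
  obtain ⟨f, hf, hF⟩ := F.2
  have hf0 : (inner ℂ (ground V) F : ℂ) = f 0 := by
    rw [ground_eq_coh]
    exact inner_coh_of_ae_eq hf hF 0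
  have h := integral_mul_inner_weyl 1 (integrable_exp_neg_mul_sq (V := V) (half_pos one_pos))
    (by fun_prop) (F : Lp ℂ 2 (dL V)) F
  refine Eq.trans ?_ h.symm
  -- The reproducing formula for d ↦ f(x - d), evaluated at d = x, returns f(0) = ⟨Ω, F⟩.
  have hin : ∀ x : V, ∫ d, (Real.exp (-(1 / 2) * ‖d‖ ^ 2) : ℂ) *
      (phase (1 * sigma d x) * (F : Lp ℂ 2 (dL V)) (x - d)) ∂(dL V) = groundFun x * f 0 := by
    intro x
    have hae : ∀ᵐ d ∂(dL V), (F : Lp ℂ 2 (dL V)) (x - d) = f (x - d) * groundFun (x - d) :=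
      (Measure.measurePreserving_sub_left (dL V) x).quasiMeasurePreserving.ae hF
    have e : (fun d => (Real.exp (-(1 / 2) * ‖d‖ ^ 2) : ℂ) *
        (phase (1 * sigma d x) * (F : Lp ℂ 2 (dL V)) (x - d))) =ᵐ[dL V]
        fun d => groundFun x * (f (x - d) * Complex.exp (inner ℂ d x - (‖d‖ : ℂ) ^ 2)) := by
      filter_upwards [hae] with d hd
      rw [hd, one_mul]
      linear_combination f (x - d) * weyl_moyal_identity x d
    have hi : Integrable (fun d => (Real.exp (-(1 / 2) * ‖d‖ ^ 2) : ℂ) *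
        (phase (1 * sigma d x) * (F : Lp ℂ 2 (dL V)) (x - d))) (dL V) := by
      have h1 := ((Lp.memLp (F : Lp ℂ 2 (dL V))).comp_measurePreserving
        (Measure.measurePreserving_sub_left (dL V) x))
      have h2 := (groundFun_memLp (V := V)).integrable_mul h1
      have hc : Continuous fun d : V => phase (1 * sigma d x) := by
        unfold phase sigma
        fun_prop
      refine h2.mono ?_ (Eventually.of_forall fun d => ?_)
      · have hρ : Continuous fun d : V => (Real.exp (-(1 / 2) * ‖d‖ ^ 2) : ℂ) := by fun_prop
        exact hρ.aestronglyMeasurable.mul (hc.aestronglyMeasurable.mul h1.aestronglyMeasurable)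
      · simp only [norm_mul, norm_phase, one_mul, Pi.mul_apply, norm_groundFun, Function.comp_apply,
          Complex.norm_real, Real.norm_of_nonneg (Real.exp_pos _).le]
        exact le_refl _
    have hi2 : Integrable (fun d => f (x - d) * Complex.exp (inner ℂ d x - (‖d‖ : ℂ) ^ 2)) (dL V) := by
      refine ((hi.congr e).const_mul (groundFun x)⁻¹).congr (Eventually.of_forall fun d => ?_)
      simp only
      rw [← mul_assoc, inv_mul_cancel₀ (groundFun_ne_zero x), one_mul]
    rw [integral_congr_ae e, integral_const_mul,
      integral_reproducing (f := fun d => f (x - d)) (hf.comp (differentiable_id.const_sub x)) x hi2,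
      sub_self]
  simp_rw [hin]
  have h2 : ∫ x, (starRingEnd ℂ) ((F : Lp ℂ 2 (dL V)) x) * (groundFun x * f 0) ∂(dL V) =
      (inner ℂ F (ground V) : ℂ) * f 0 := by
    have h3 : (inner ℂ F (ground V) : ℂ) =
        ∫ x, (starRingEnd ℂ) ((F : Lp ℂ 2 (dL V)) x) * groundFun x ∂(dL V) := by
      refine (inner_Lp_eq (F : Lp ℂ 2 (dL V)) (ground V)).trans (integral_congr_ae ?_)
      filter_upwards [(groundFun_memLp (V := V)).coeFn_toLp] with x hx
      change _ * (groundFun_memLp (V := V)).toLp _ x = _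
      rw [hx]
    rw [h3, ← integral_mul_const]
    refine integral_congr_ae (Eventually.of_forall fun x => ?_)
    simp only
    ring
  rw [h2, ← hf0, ← inner_conj_symm F, ← Complex.normSq_eq_conj_mul_self, Complex.normSq_eq_norm_sq]

end Weyl
end BargmannFock
end

noncomputable section
namespace BargmannFock

/-! ### Metaplectic operators -/

section Metaplectic

variable {V : Type*} [NormedAddCommGroup V] [InnerProductSpace ℂ V] [FiniteDimensional ℂ V]
  [MeasurableSpace V] [BorelSpace V] {S : V ≃ₗ[ℝ] V}

theorem measurableEmbedding_realEquiv (S : V ≃ₗ[ℝ] V) : MeasurableEmbedding S :=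
  (Homeomorph.mk S.toEquiv (continuous_realEquiv S) (continuous_realEquiv S.symm)).measurableEmbedding

/-- The unitary operator `U_S F = F ∘ S⁻¹` of `L²(V, dL)`. -/
def pull (hS : IsSymplectic S) : Lp ℂ 2 (dL V) →ₗᵢ[ℂ] Lp ℂ 2 (dL V) :=
  Lp.compMeasurePreservingₗᵢ ℂ S.symm hS.symm.measurePreserving

theorem coeFn_pull (hS : IsSymplectic S) (F : Lp ℂ 2 (dL V)) :
    pull hS F =ᵐ[dL V] fun x => F (S.symm x) :=
  Lp.coeFn_compMeasurePreserving F hS.symm.measurePreserving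

theorem pull_symm_pull (hS : IsSymplectic S) (F : Lp ℂ 2 (dL V)) :
    pull hS.symm (pull hS F) = F := by
  refine Lp.ext_iff.2 ?_
  filter_upwards [coeFn_pull hS.symm (pull hS F),
    hS.measurePreserving.quasiMeasurePreserving.ae (coeFn_pull hS F)] with x h1 h2
  rw [h1, LinearEquiv.symm_symm, h2, S.symm_apply_apply]

theorem inner_pull_left (hS : IsSymplectic S) (F G : Lp ℂ 2 (dL V)) :
    (inner ℂ (pull hS F) G : ℂ) = inner ℂ F (pull hS.symm G) := by
  rw [← LinearIsometry.inner_map_map (pull hS.symm), pull_symm_pull]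

theorem pull_weyl (hS : IsSymplectic S) (κ : ℝ) (z : V) (F : Lp ℂ 2 (dL V)) :
    pull hS (weyl κ z F) = weyl κ (S z) (pull hS F) := by
  refine Lp.ext_iff.2 ?_
  filter_upwards [coeFn_pull hS (weyl κ z F), ae_sub_right (coeFn_pull hS F) (S z),
    coeFn_weyl κ (S z) (pull hS F),
    hS.symm.measurePreserving.quasiMeasurePreserving.ae (coeFn_weyl κ z F)] with x h1 h2 h3 h4
  rw [h1, h3, h4, h2, map_sub, S.symm_apply_apply, ← hS z (S.symm x), S.apply_symm_apply]

/-- The operator `Π_J U_S Π_J` on Bargmann-Fock space. -/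
def compression (hS : IsSymplectic S) : fock V →L[ℂ] fock V :=
  (fock V).orthogonalProjectionOnto ∘L (pull hS).toContinuousLinearMap ∘L (fock V).subtypeL

theorem inner_compression (hS : IsSymplectic S) (G F : fock V) :
    (inner ℂ G (compression hS F) : ℂ) = inner ℂ (G : Lp ℂ 2 (dL V)) (pull hS F) :=
  inner_proj G _

theorem inner_compression_left (hS : IsSymplectic S) (G F : fock V) :
    (inner ℂ (compression hS G) F : ℂ) = inner ℂ (pull hS G) (F : Lp ℂ 2 (dL V)) :=
  Submodule.inner_orthogonalProjectionOnto_eq_of_mem_right F _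

theorem inner_compression_symm (hS : IsSymplectic S) (G F : fock V) :
    (inner ℂ (compression hS G) F : ℂ) = inner ℂ G (compression hS.symm F) :=
  (inner_compression_left hS G F).trans
    ((inner_pull_left hS G F).trans (inner_compression hS.symm G F).symm)

/-- Substituting x → Sx and then w = S(x - d) turns the left side into an average, with weight
e^{-‖Sd‖²/2}, of the translations with κ = -1. Each of these acts as the scalar e^{-‖d‖²/2}, and the
average of the scalars is the overlap. -/
theorem inner_compression_compression (hS : IsSymplectic S) (G F : fock V) :
    (inner ℂ (compression hS G) (compression hS F) : ℂ) = overlap S * inner ℂ G F := by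
  have hemb := measurableEmbedding_realEquiv S
  have hc := continuous_realEquiv S
  rw [inner_compression_left, inner_Lp_eq]
  have h1 : ∀ᵐ x ∂(dL V), (starRingEnd ℂ) (pull hS G x) *
      (compression hS F : Lp ℂ 2 (dL V)) x = (starRingEnd ℂ) ((G : Lp ℂ 2 (dL V)) (S.symm x)) *
        ((∫ w, Complex.exp (inner ℂ w x) * (groundFun w * (F : Lp ℂ 2 (dL V)) (S.symm w)) ∂(dL V)) *
          groundFun x) := by
    filter_upwards [coeFn_pull hS G, mem_fock_iff.1 (compression hS F).2] with x h1 h2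
    have h3 : (inner ℂ (coh x : Lp ℂ 2 (dL V)) (compression hS F : Lp ℂ 2 (dL V)) : ℂ) =
        ∫ w, Complex.exp (inner ℂ w x) * (groundFun w * (F : Lp ℂ 2 (dL V)) (S.symm w)) ∂(dL V) := by
      refine (inner_compression hS (coh x) F).trans ((inner_coh_eq x _).trans ?_)
      refine integral_congr_ae ?_
      filter_upwards [coeFn_pull hS F] with w hw
      rw [hw]
    rw [h1, h2, h3]
  rw [integral_congr_ae h1, ← hS.measurePreserving.integral_comp hemb]
  have h2 : ∀ x : V, (starRingEnd ℂ) ((G : Lp ℂ 2 (dL V)) (S.symm (S x))) *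
        ((∫ w, Complex.exp (inner ℂ w (S x)) * (groundFun w * (F : Lp ℂ 2 (dL V)) (S.symm w)) ∂(dL V)) *
          groundFun (S x)) = (starRingEnd ℂ) ((G : Lp ℂ 2 (dL V)) x) *
        ∫ d, (Real.exp (-(1 / 2) * ‖S d‖ ^ 2) : ℂ) *
          (phase (-1 * sigma d x) * (F : Lp ℂ 2 (dL V)) (x - d)) ∂(dL V) := by
    intro x
    rw [S.symm_apply_apply, ← hS.measurePreserving.integral_comp hemb,
      ← integral_sub_left_eq_self _ (dL V) x, ← integral_mul_const]
    congr 1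
    refine integral_congr_ae (Eventually.of_forall fun d => ?_)
    simp only [S.symm_apply_apply]
    rw [map_sub, neg_one_mul, ← hS d x]
    linear_combination (F : Lp ℂ 2 (dL V)) (x - d) * kernel_identity (S x) (S d)
  simp_rw [h2]
  have hρ : Integrable (fun d => Real.exp (-(1 / 2) * ‖S d‖ ^ 2)) (dL V) :=
    hS.measurePreserving.integrable_comp_of_integrable
      (integrable_exp_neg_mul_sq (V := V) (half_pos one_pos))
  rw [← integral_mul_inner_weyl (-1) hρ (by fun_prop) (G : Lp ℂ 2 (dL V)) F]
  simp_rw [inner_weyl_neg, ← mul_assoc]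
  rw [integral_mul_const, overlap, ← integral_complex_ofReal]
  push_cast
  rfl

theorem compression_compression_symm (hS : IsSymplectic S) (F : fock V) :
    compression hS (compression hS.symm F) = (overlap S : ℂ) • F := by
  refine ext_inner_left ℂ fun G => ?_
  refine (inner_compression_symm hS.symm G _).symm.trans ?_
  rw [inner_compression_compression, overlap_symm hS]
  exact (inner_smul_right G F _).symm

/-- U_S carries the translation by z to the one by Sz since S preserves σ, and translations pass
through the projection because they and their adjoints preserve Bargmann–Fock space. -/
theorem compression_tau (hS : IsSymplectic S) (z : V) (F : fock V) :
    compression hS (tau z F) = tau (S z) (compression hS F) := by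
  refine ext_inner_left ℂ fun G => ?_
  refine (inner_compression hS G _).trans (Eq.trans ?_ (inner_tau_right (S z) G _).symm)
  refine Eq.trans ?_ (inner_compression hS _ F).symm
  rw [coe_tau, coe_tau, pull_weyl, inner_weyl_right]

theorem isMetaplectic_iff (hS : IsSymplectic S) {η : ℂ} {W : fock V ≃ₗᵢ[ℂ] fock V} :
    IsMetaplectic S η W ↔ ∀ F, W F = η • compression hS F := by
  have h : ∀ F G : fock V, ∫ v, (starRingEnd ℂ) ((G : Lp ℂ 2 (dL V)) v) *
      (F : Lp ℂ 2 (dL V)) (S.symm v) ∂(dL V) = inner ℂ G (compression hS F) := by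
    intro F G
    refine Eq.trans ?_ (inner_compression hS G F).symm
    rw [inner_Lp_eq]
    refine integral_congr_ae ?_
    filter_upwards [coeFn_pull hS F] with x hx
    rw [hx]
  constructor
  · intro hW F
    refine ext_inner_left ℂ fun G => ?_
    exact (hW F G).trans ((congrArg (η * ·) (h F G)).trans (inner_smul_right G _ η).symm)
  · intro hW F G
    rw [h, hW]
    exact inner_smul_right G _ η

/-- The metaplectic operators exist. -/
theorem existsUnique_isMetaplectic (hS : IsSymplectic S) {η : ℂ} (hη : IsMetaplecticFactor S η) :
    ∃! W : fock V ≃ₗᵢ[ℂ] fock V, IsMetaplectic S η W := by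
  have h1 := norm_factor_sq_mul_overlap hS hη
  have h1' : (starRingEnd ℂ) η * η * (overlap S : ℂ) = 1 := by
    rw [← Complex.normSq_eq_conj_mul_self, Complex.normSq_eq_norm_sq]
    exact_mod_cast h1
  have hη0 : η ≠ 0 := by
    rintro rfl
    simp at h1'
  have ho : (overlap S : ℂ) ≠ 0 := by
    intro h
    simp [h] at h1'
  let U : fock V →ₗᵢ[ℂ] fock V := LinearMap.isometryOfInner (η • (compression hS).toLinearMap)
    fun F G => by
      refine (inner_smul_left (compression hS F) (η • compression hS G) η).trans ?_
      refine (congrArg ((starRingEnd ℂ) η * ·) (inner_smul_right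
        (compression hS F) (compression hS G) η)).trans ?_
      refine (congrArg (fun t => (starRingEnd ℂ) η * (η * t))
        (inner_compression_compression hS F G)).trans ?_
      linear_combination (inner ℂ F G : ℂ) * h1'
  have hU : ∀ F, U F = η • compression hS F := fun F => rfl
  have hsurj : Function.Surjective U := fun F =>
    ⟨(η⁻¹ * (overlap S : ℂ)⁻¹) • compression hS.symm F, by
      rw [hU, map_smul, compression_compression_symm, smul_smul, smul_smul]
      rw [show η * (η⁻¹ * (overlap S : ℂ)⁻¹) * (overlap S : ℂ) = 1 by field_simp, one_smul]⟩
  refine ⟨LinearIsometryEquiv.ofSurjective U hsurj, (isMetaplectic_iff hS).2 hU, fun W hW => ?_⟩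
  ext1 F
  exact ((isMetaplectic_iff hS).1 hW F).trans (hU F).symm

theorem IsMetaplectic.map_tau (hS : IsSymplectic S) {η : ℂ} {W : fock V ≃ₗᵢ[ℂ] fock V}
    (hW : IsMetaplectic S η W) (z : V) (F : fock V) : W (tau z F) = tau (S z) (W F) := by
  rw [(isMetaplectic_iff hS).1 hW, (isMetaplectic_iff hS).1 hW, compression_tau, map_smul]

/-- `W` implements the symplectic map `S` on the Heisenberg translations. -/
def Implements (W : fock V ≃ₗᵢ[ℂ] fock V) (S : V ≃ₗ[ℝ] V) : Prop :=
  IsSymplectic S ∧ ∀ z F, W (tau z F) = tau (S z) (W F)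

theorem Implements.pow {W : fock V ≃ₗᵢ[ℂ] fock V} (h : Implements W S) (n : ℕ) :
    Implements (W ^ n) (S ^ n) := by
  induction n with
  | zero => exact ⟨fun _ _ => rfl, fun _ _ => rfl⟩
  | succ n ih =>
    refine ⟨fun v w => ?_, fun z F => ?_⟩
    · rw [pow_succ']
      exact (h.1 _ _).trans (ih.1 v w)
    · rw [pow_succ', pow_succ']
      exact (congrArg W (ih.2 z F)).trans (h.2 _ _)

theorem Implements.symm {W : fock V ≃ₗᵢ[ℂ] fock V} (h : Implements W S) :
    Implements W.symm S.symm := by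
  refine ⟨h.1.symm, fun z F => ?_⟩
  rw [W.symm_apply_eq, h.2, S.apply_symm_apply, W.apply_symm_apply]

/-- The ground state projection is a Gaussian average of τ_d, and conjugation by W turns τ_d into
τ_{S⁻¹d}, whose ground state expectation is Gaussian. Only the intertwining relation is used, so the
result applies to every power Wⁿ without tracking metaplectic factors. -/
theorem Implements.norm_inner_ground_sq {W : fock V ≃ₗᵢ[ℂ] fock V} (h : Implements W S) :
    ‖(inner ℂ (ground V) (W (ground V)) : ℂ)‖ ^ 2 = overlap S := by
  rw [← overlap_symm h.1]
  apply Complex.ofReal_injective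
  rw [BargmannFock.norm_inner_ground_sq, overlap, ← integral_complex_ofReal]
  refine integral_congr_ae (Eventually.of_forall fun d => ?_)
  have h1 : tau d (W (ground V)) = W (tau (S.symm d) (ground V)) := by
    rw [h.2, S.apply_symm_apply]
  simp only
  rw [h1, LinearIsometryEquiv.inner_map_map, inner_ground_tau_ground]
  push_cast
  ring

end Metaplectic
end BargmannFock
end

noncomputable section
namespace BargmannFock

/-! ### Powers of a linear automorphism -/

section Dichotomy

variable {V : Type*} [NormedAddCommGroup V] [NormedSpace ℝ V]

/-- The vector `u` is a sum of vectors that are square-summably small before, respectively after,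
the application of `S ^ n`. -/
def IsSquareSmall (S : V ≃ₗ[ℝ] V) (u : V) : Prop :=
  ∃ δ : ℕ → ℝ, Summable (fun n => δ n ^ 2) ∧
    ∀ n, ∃ a b, u = (S ^ (n + 1)) a + b ∧ ‖a‖ ≤ δ n ∧ ‖b‖ ≤ δ n

theorem symm_pow_apply_pow (S : V ≃ₗ[ℝ] V) (n : ℕ) (v : V) : (S.symm ^ n) ((S ^ n) v) = v := by
  have h : S.symm ^ n * S ^ n = 1 := by
    rw [← (show Commute S.symm S from LinearEquiv.ext fun x => by
      simp [LinearEquiv.mul_apply]).mul_pow]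
    rw [show S.symm * S = 1 from LinearEquiv.ext fun x => S.symm_apply_apply x, one_pow]
  exact LinearEquiv.congr_fun h v

variable {E : Type*} [AddCommGroup E] [Module ℂ E]

theorem exists_norm_map_smul_le (ρ : E →ₗ[ℝ] V) (x : E) : ∃ C, ∀ c : ℂ, ‖ρ (c • x)‖ ≤ C * ‖c‖ := by
  refine ⟨‖ρ x‖ + ‖ρ (Complex.I • x)‖, fun c => ?_⟩
  have h : c • x = c.re • x + c.im • Complex.I • x := by
    rw [← Complex.coe_smul c.re, ← Complex.coe_smul c.im, smul_smul, ← add_smul, Complex.re_add_im]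
  rw [h, map_add, map_smul, map_smul]
  refine (norm_add_le _ _).trans ?_
  rw [norm_smul, norm_smul, add_mul, mul_comm ‖ρ x‖, mul_comm ‖ρ (Complex.I • x)‖]
  gcongr
  · exact Complex.abs_re_le_norm c
  · exact Complex.abs_im_le_norm c

variable {S : V ≃ₗ[ℝ] V} {T : Module.End ℂ E} {ρ : E →ₗ[ℝ] V}

theorem map_pow_apply (hT : ∀ x, ρ (T x) = S (ρ x)) (n : ℕ) (x : E) :
    ρ ((T ^ n) x) = (S ^ n) (ρ x) := by
  induction n with
  | zero => rfl
  | succ n ih =>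
    rw [pow_succ', pow_succ']
    exact (hT _).trans (congrArg S ih)

theorem pow_apply_of_eigenvector {l : ℂ} {x : E} (hx : T x = l • x) (n : ℕ) :
    (T ^ n) x = l ^ n • x := by
  induction n with
  | zero => rw [pow_zero, pow_zero, one_smul]; rfl
  | succ n ih =>
    rw [pow_succ', pow_succ, mul_smul]
    exact (congrArg T ih).trans (by rw [map_smul, hx])

theorem pow_apply_of_chain {l : ℂ} {w z : E} (hw : T w = l • w + l • z) (hz : T z = l • z) (n : ℕ) :
    (T ^ n) w = l ^ n • (w + (n : ℂ) • z) := by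
  induction n with
  | zero => simp
  | succ n ih =>
    rw [pow_succ', pow_succ, mul_smul]
    refine (congrArg T ih).trans ?_
    rw [map_smul, map_add, map_smul, hw, hz]
    push_cast
    module

theorem summable_sq_geometric {r : ℝ} (h0 : 0 ≤ r) (h1 : r < 1) (C : ℝ) :
    Summable fun n : ℕ => (C * r ^ (n + 1)) ^ 2 := by
  have := (summable_geometric_of_lt_one (sq_nonneg r) (by nlinarith)).mul_left (C ^ 2 * r ^ 2)
  refine this.congr fun n => ?_
  ring

/-- Going back n + 1 steps shrinks an expanded eigenvector geometrically, so b = 0 suffices. -/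
theorem isSquareSmall_of_norm_gt (hT : ∀ x, ρ (T x) = S (ρ x)) {l : ℂ} (hl : 1 < ‖l‖) {x : E}
    (hx : T x = l • x) : IsSquareSmall S (ρ x) := by
  obtain ⟨C, hC⟩ := exists_norm_map_smul_le ρ x
  have hl0 : l ≠ 0 := by
    rintro rfl
    simp at hl
    linarith
  refine ⟨fun n => C * (‖l‖⁻¹) ^ (n + 1),
    summable_sq_geometric (by positivity) (inv_lt_one_of_one_lt₀ hl) C, fun n => ?_⟩
  have h := hC ((l⁻¹) ^ (n + 1))
  rw [norm_pow, norm_inv] at h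
  refine ⟨ρ ((l⁻¹) ^ (n + 1) • x), 0, ?_, h, by rw [norm_zero]; exact (norm_nonneg _).trans h⟩
  rw [add_zero, ← map_pow_apply hT, map_smul, pow_apply_of_eigenvector hx, smul_smul, ← mul_pow,
    inv_mul_cancel₀ hl0, one_pow, one_smul]

theorem isSquareSmall_symm_of_norm_lt (hT : ∀ x, ρ (T x) = S (ρ x)) {l : ℂ} (hl : ‖l‖ < 1) {x : E}
    (hx : T x = l • x) : IsSquareSmall S.symm (ρ x) := by
  obtain ⟨C, hC⟩ := exists_norm_map_smul_le ρ x
  refine ⟨fun n => C * ‖l‖ ^ (n + 1), summable_sq_geometric (norm_nonneg _) hl C, fun n => ?_⟩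
  have h := hC (l ^ (n + 1))
  rw [norm_pow] at h
  refine ⟨ρ (l ^ (n + 1) • x), 0, ?_, h, by rw [norm_zero]; exact (norm_nonneg _).trans h⟩
  rw [add_zero, ← pow_apply_of_eigenvector hx, map_pow_apply hT, symm_pow_apply_pow]

/-- The linear growth Tᵐw = lᵐ(w + mz) exhibits z as Tᵐ(l⁻ᵐw/m) - w/m. Both pieces are O(1/m), with
m = n + 1: square-summable, though not summable. This case is why the definition allows a second
summand b. -/
theorem isSquareSmall_of_chain (hT : ∀ x, ρ (T x) = S (ρ x)) {l : ℂ} (hl : ‖l‖ = 1) {w z : E}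
    (hw : T w = l • w + l • z) (hz : T z = l • z) : IsSquareSmall S (ρ z) := by
  obtain ⟨C, hC⟩ := exists_norm_map_smul_le ρ w
  have hl0 : l ≠ 0 := by
    rintro rfl
    simp at hl
  refine ⟨fun n => C * ((n + 1 : ℕ) : ℝ)⁻¹, ?_, fun n => ?_⟩
  · have := (summable_nat_add_iff 1).2 (Real.summable_nat_pow_inv.2 one_lt_two)
    refine (this.mul_left (C ^ 2)).congr fun n => ?_
    rw [mul_pow, inv_pow]
  · have hn : ((n + 1 : ℕ) : ℂ) ≠ 0 := Nat.cast_ne_zero.2 n.succ_ne_zero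
    refine ⟨ρ (((l⁻¹) ^ (n + 1) * ((n + 1 : ℕ) : ℂ)⁻¹) • w), ρ ((-((n + 1 : ℕ) : ℂ)⁻¹) • w), ?_, ?_, ?_⟩
    · rw [← map_pow_apply hT, map_smul, pow_apply_of_chain hw hz, ← map_add]
      congr 1
      rw [smul_smul, inv_pow, show (l ^ (n + 1))⁻¹ * ((n + 1 : ℕ) : ℂ)⁻¹ * l ^ (n + 1) =
        ((n + 1 : ℕ) : ℂ)⁻¹ by field_simp, smul_add, smul_smul, inv_mul_cancel₀ hn]
      module
    · refine (hC _).trans_eq ?_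
      rw [norm_mul, norm_pow, norm_inv, norm_inv, hl, inv_one, one_pow, one_mul, Complex.norm_natCast]
    · refine (hC _).trans_eq ?_
      rw [norm_neg, norm_inv, Complex.norm_natCast]

/-- The hypothesis excludes Jordan chains of length two at l, hence longer ones. -/
theorem mem_eigenspace_of_mem_maxGenEigenspace {l : ℂ}
    (h : ∀ w, (T - algebraMap ℂ _ l) ((T - algebraMap ℂ _ l) w) = 0 → (T - algebraMap ℂ _ l) w = 0)
    {x : E} (hx : x ∈ T.maxGenEigenspace l) : T x = l • x := by
  obtain ⟨k, hk⟩ := Module.End.mem_maxGenEigenspace T l x |>.1 hx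
  have hk' : ((T - algebraMap ℂ (Module.End ℂ E) l) ^ k) x = 0 := hk
  have key : ∀ k x, ((T - algebraMap ℂ (Module.End ℂ E) l) ^ k) x = 0 →
      (T - algebraMap ℂ (Module.End ℂ E) l) x = 0 := by
    intro k
    induction k with
    | zero =>
      intro x hx
      have : x = 0 := hx
      rw [this, map_zero]
    | succ k ih =>
      intro x hx
      rw [pow_succ] at hx
      exact h x (ih _ hx)
  have := key k x hk'
  rwa [LinearMap.sub_apply, Module.algebraMap_end_apply, sub_eq_zero] at this

/-- Generalized eigenvectors span, and here they are eigenvectors with unimodular eigenvalues, so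
each has a bounded orbit. -/
theorem exists_bound_of_semisimple [FiniteDimensional ℂ E] (hT : ∀ x, ρ (T x) = S (ρ x))
    (hρ : Function.Surjective ρ) (h1 : ∀ (l : ℂ) (x : E), T x = l • x → x ≠ 0 → ‖l‖ = 1)
    (h2 : ∀ (l : ℂ) (w : E), (T - algebraMap ℂ _ l) ((T - algebraMap ℂ _ l) w) = 0 →
      (T - algebraMap ℂ _ l) w = 0) (v : V) : ∃ C, ∀ n : ℕ, ‖(S ^ n) v‖ ≤ C := by
  obtain ⟨x, rfl⟩ := hρ v
  have hx : x ∈ ⨆ l, T.maxGenEigenspace l := by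
    rw [Module.End.iSup_maxGenEigenspace_eq_top]
    trivial
  simp_rw [← map_pow_apply hT]
  induction hx using Submodule.iSup_induction' with
  | mem l x hx =>
    have hx' := mem_eigenspace_of_mem_maxGenEigenspace (h2 l) hx
    obtain ⟨C, hC⟩ := exists_norm_map_smul_le ρ x
    refine ⟨C, fun n => ?_⟩
    rw [pow_apply_of_eigenvector hx']
    rcases eq_or_ne x 0 with rfl | h0
    · simpa using hC 1
    · refine (hC _).trans_eq ?_
      rw [norm_pow, h1 l x hx' h0, one_pow, mul_one]
  | zero => exact ⟨0, fun n => by simp⟩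
  | add x y hx hy ihx ihy =>
    obtain ⟨C, hC⟩ := ihx
    obtain ⟨D, hD⟩ := ihy
    refine ⟨C + D, fun n => ?_⟩
    rw [map_add, map_add]
    exact (norm_add_le _ _).trans (add_le_add (hC n) (hD n))

/-- Existence of a complexification. -/
theorem exists_complexification [FiniteDimensional ℝ V] (S : V ≃ₗ[ℝ] V) :
    ∃ (m : ℕ) (T : Module.End ℂ (Fin m → ℂ)) (ρ : (Fin m → ℂ) →ₗ[ℝ] V),
      (∀ x, ρ (T x) = S (ρ x)) ∧ Function.Surjective ρ ∧ ∀ x, (∀ c : ℂ, ρ (c • x) = 0) → x = 0 := by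
  let b := Module.finBasis ℝ V
  let M := LinearMap.toMatrix b b S.toLinearMap
  -- The matrix of S acts on complex coordinates and ρ takes real parts; x is recovered from ρ(x)
  -- and ρ(ix).
  let ρ : (Fin (Module.finrank ℝ V) → ℂ) →ₗ[ℝ] V :=
    b.equivFun.symm.toLinearMap ∘ₗ Complex.reLm.compLeft _
  have hρ : ∀ x, ρ x = b.equivFun.symm fun i => (x i).re := fun x => rfl
  refine ⟨_, Matrix.toLin' (M.map Complex.ofReal), ρ, fun x => ?_, fun v => ?_, fun x hx => ?_⟩
  · apply b.equivFun.injective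
    rw [hρ, LinearEquiv.apply_symm_apply]
    have h : b.equivFun (S (ρ x)) = M.mulVec (b.equivFun (ρ x)) := by
      have := LinearMap.toMatrix_mulVec_repr b b S.toLinearMap (ρ x)
      exact this.symm
    rw [h, hρ, LinearEquiv.apply_symm_apply]
    funext i
    simp [Matrix.toLin'_apply, Matrix.mulVec, dotProduct]
  · refine ⟨fun i => (b.equivFun v i : ℂ), ?_⟩
    rw [hρ]
    simp
  · have h0 : ∀ c : ℂ, ∀ i, (c * x i).re = 0 := fun c i => by
      have h1 := hx c
      rw [hρ, LinearEquiv.map_eq_zero_iff] at h1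
      exact congrFun h1 i
    funext i
    have h1 := h0 1 i
    have h2 := h0 Complex.I i
    apply Complex.ext
    · simpa using h1
    · simpa using h2

/-- A linear automorphism has bounded powers, or it or its inverse moves a direction. -/
theorem bounded_or_isSquareSmall [FiniteDimensional ℝ V] (S : V ≃ₗ[ℝ] V) :
    (∃ C, ∀ (n : ℕ) (v : V), ‖(S ^ n) v‖ ≤ C * ‖v‖) ∨
      ∃ u : V, u ≠ 0 ∧ (IsSquareSmall S u ∨ IsSquareSmall S.symm u) := by
  obtain ⟨m, T, ρ, hT, hρ, hinj⟩ := exists_complexification S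
  by_contra! hcon
  obtain ⟨hb, hs⟩ := hcon
  have hne : ∀ x, x ≠ 0 → ∃ c : ℂ, ρ (c • x) ≠ 0 := fun x hx => by
    by_contra! h
    exact hx (hinj x h)
  have h1 : ∀ (l : ℂ) (x : Fin m → ℂ), T x = l • x → x ≠ 0 → ‖l‖ = 1 := by
    intro l x hx h0
    obtain ⟨c, hc⟩ := hne x h0
    have hcx : T (c • x) = l • c • x := by rw [map_smul, hx, smul_comm]
    by_contra hl
    rcases lt_or_gt_of_ne hl with hl | hl
    · exact (hs _ hc).2 (isSquareSmall_symm_of_norm_lt hT hl hcx)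
    · exact (hs _ hc).1 (isSquareSmall_of_norm_gt hT hl hcx)
  have h2 : ∀ (l : ℂ) (w : Fin m → ℂ), (T - algebraMap ℂ _ l) ((T - algebraMap ℂ _ l) w) = 0 →
      (T - algebraMap ℂ _ l) w = 0 := by
    intro l w hw
    by_contra h0
    set z := (T - algebraMap ℂ (Module.End ℂ (Fin m → ℂ)) l) w with hzdef
    have hz : T z = l • z := by
      rwa [LinearMap.sub_apply, Module.algebraMap_end_apply, sub_eq_zero] at hw
    have hl := h1 l z hz h0
    have hl0 : l ≠ 0 := by
      rintro rfl
      simp at hl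
    have hTw : T w = l • w + z := by
      rw [hzdef, LinearMap.sub_apply, Module.algebraMap_end_apply, add_sub_cancel]
    obtain ⟨c, hc⟩ := hne z h0
    -- From Tw = lw + z, rescaling w by c·l gives the chain l·w' + l·(cz) in the normalized form,
    -- where c is chosen so that ρ(cz) ≠ 0.
    refine (hs _ hc).1 (isSquareSmall_of_chain hT hl (w := (c * l) • w) ?_ ?_)
    · rw [map_smul, hTw]
      module
    · rw [map_smul, hz, smul_comm]
  have h3 := exists_bound_of_semisimple hT hρ h1 h2
  -- Orbits are bounded one vector at a time; uniform boundedness makes the constant independent of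
  -- the vector.
  obtain ⟨C, hC⟩ := banach_steinhaus
    (g := fun n : ℕ => LinearMap.toContinuousLinearMap (S ^ n).toLinearMap) h3
  obtain ⟨n, v, hv⟩ := hb C
  refine absurd ?_ hv.not_ge
  refine ((LinearMap.toContinuousLinearMap (S ^ n).toLinearMap).le_opNorm v).trans ?_
  gcongr
  exact hC n

end Dichotomy
end BargmannFock
end

noncomputable section
namespace BargmannFock

/-! ### Correlation estimates in Hilbert space -/

section Hilbert

variable {H : Type*} [NormedAddCommGroup H] [InnerProductSpace ℂ H]

/-- The vectors whose inner products with the sequence `x` are `O(δ)`. -/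
def dominated (δ : ℕ → ℝ) (x : ℕ → H) : Submodule ℂ H where
  carrier := {y | ∃ C : ℝ, ∀ n, ‖(inner ℂ (x n) y : ℂ)‖ ≤ C * δ n}
  zero_mem' := ⟨0, fun n => by simp⟩
  add_mem' := by
    rintro y z ⟨C, hC⟩ ⟨D, hD⟩
    refine ⟨C + D, fun n => ?_⟩
    rw [inner_add_right, add_mul]
    exact (norm_add_le _ _).trans (add_le_add (hC n) (hD n))
  smul_mem' := by
    rintro c y ⟨C, hC⟩
    refine ⟨‖c‖ * C, fun n => ?_⟩
    rw [inner_smul_right, norm_mul, mul_assoc]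
    gcongr
    exact hC n

/-- Lets an estimate that is linear in one slot of the correlation be transferred to the other slot.
-/
theorem mem_dominated_comm {δ : ℕ → ℝ} (U : ℕ → H ≃ₗᵢ[ℂ] H) {x y : H} :
    y ∈ dominated δ (fun n => U n x) ↔ x ∈ dominated δ fun n => (U n).symm y := by
  have h : ∀ n, ‖(inner ℂ (U n x) y : ℂ)‖ = ‖(inner ℂ ((U n).symm y) x : ℂ)‖ := fun n => by
    rw [norm_inner_symm, ← LinearIsometryEquiv.inner_map_map (U n) ((U n).symm y),
      LinearIsometryEquiv.apply_symm_apply]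
  change (∃ C : ℝ, _) ↔ ∃ C : ℝ, _
  simp_rw [h]

/-- Expanding the square gives L diagonal terms equal to 1 and fewer than L² off-diagonal terms of
size at most q. -/
theorem norm_sq_mean_le {L : ℕ} (hL : 0 < L) {e : ℕ → H} {q : ℝ} (hq : 0 ≤ q)
    (he : ∀ j, ‖e j‖ = 1) (h : ∀ i j, i ≠ j → ‖(inner ℂ (e i) (e j) : ℂ)‖ ≤ q) :
    ‖(L : ℂ)⁻¹ • ∑ j ∈ Finset.range L, e j‖ ^ 2 ≤ (L : ℝ)⁻¹ + q := by
  have h1 : ‖∑ j ∈ Finset.range L, e j‖ ^ 2 ≤ L + L ^ 2 * q := by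
    have h2 : ‖∑ j ∈ Finset.range L, e j‖ ^ 2 =
        ‖(inner ℂ (∑ j ∈ Finset.range L, e j) (∑ j ∈ Finset.range L, e j) : ℂ)‖ := by
      rw [inner_self_eq_norm_sq_to_K]
      rw [norm_pow, RCLike.norm_ofReal, abs_norm]
    rw [h2, sum_inner]
    refine (norm_sum_le _ _).trans ?_
    have h3 : ∀ i ∈ Finset.range L,
        ‖(inner ℂ (e i) (∑ j ∈ Finset.range L, e j) : ℂ)‖ ≤ 1 + L * q := by
      intro i hi
      rw [inner_sum]
      refine (norm_sum_le _ _).trans ?_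
      have h4 : ∀ j ∈ Finset.range L, ‖(inner ℂ (e i) (e j) : ℂ)‖ ≤ (if i = j then 1 else 0) + q := by
        intro j hj
        split_ifs with hij
        · refine (norm_inner_le_norm _ _).trans ?_
          rw [he, he]
          linarith
        · rw [zero_add]
          exact h i j hij
      refine (Finset.sum_le_sum h4).trans_eq ?_
      rw [Finset.sum_add_distrib, Finset.sum_ite_eq, if_pos hi, Finset.sum_const,
        Finset.card_range, nsmul_eq_mul]
    refine (Finset.sum_le_sum h3).trans_eq ?_
    rw [Finset.sum_const, Finset.card_range, nsmul_eq_mul]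
    ring
  have hL' : (0 : ℝ) < L := Nat.cast_pos.2 hL
  rw [norm_smul, mul_pow, norm_inv, Complex.norm_natCast]
  refine (mul_le_mul_of_nonneg_left h1 (by positivity)).trans_eq ?_
  field_simp

/-- The algebra of the commutation argument: Z replaces Y, the identity `h` trades (X, Z) for (X',
Z'), and Z' and X' are then compared with g and X. -/
theorem norm_inner_sub_le_of_inner_eq {X X' Y Z Z' g : H}
    (h : (inner ℂ X Z : ℂ) = inner ℂ X' Z') :
    ‖(inner ℂ X (g - Y) : ℂ)‖ ≤ ‖X‖ * ‖Y - Z‖ + ‖X'‖ * ‖Z' - g‖ + ‖X' - X‖ * ‖g‖ := by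
  have h1 : (inner ℂ X (g - Y) : ℂ) =
      -(inner ℂ X (Y - Z) + inner ℂ X' (Z' - g) + inner ℂ (X' - X) g) := by
    simp only [inner_sub_right, inner_sub_left]
    linear_combination -h
  rw [h1, norm_neg]
  exact norm_add₃_le.trans (add_le_add (add_le_add (norm_inner_le_norm _ _)
    (norm_inner_le_norm _ _)) (norm_inner_le_norm _ _))

theorem summable_int_norm_sq_inner {W : H ≃ₗᵢ[ℂ] H} {y : H}
    (h : Summable fun n : ℕ => ‖(inner ℂ ((W ^ (n + 1)) y) y : ℂ)‖ ^ 2) :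
    Summable fun n : ℤ => ‖(inner ℂ y ((W ^ n) y) : ℂ)‖ ^ 2 := by
  have h1 : Summable fun n : ℕ => ‖(inner ℂ y ((W ^ (n : ℤ)) y) : ℂ)‖ ^ 2 := by
    refine (summable_nat_add_iff 1).1 (h.congr fun n => ?_)
    rw [norm_inner_symm, zpow_natCast]
  refine Summable.of_nat_of_neg h1 (h1.congr fun n => ?_)
  rw [inner_zpow_neg, RCLike.norm_conj]

end Hilbert

theorem norm_phase_sub_one_le (t : ℝ) : ‖phase t - 1‖ ≤ |t| := by
  rw [phase, mul_comm]
  exact Real.norm_exp_I_mul_ofReal_sub_one_le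

/-! ### The spectral type of the ground state -/

section Averages

variable {V : Type*} [NormedAddCommGroup V] [InnerProductSpace ℂ V] [FiniteDimensional ℂ V]
  [MeasurableSpace V] [BorelSpace V] {S : V ≃ₗ[ℝ] V} {W : fock V ≃ₗᵢ[ℂ] fock V}

theorem norm_tau_ground (z : V) : ‖tau z (ground V)‖ = 1 := by
  rw [LinearIsometry.norm_map, norm_ground]

theorem tau_add (z w : V) (F : fock V) : tau (z + w) F = phase (-sigma z w) • tau z (tau w F) := by
  rw [tau_tau, smul_smul, ← phase_add, neg_add_cancel, phase_zero, one_smul]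

theorem tau_comm (z w : V) (F : fock V) :
    tau z (tau w F) = phase (2 * sigma z w) • tau w (tau z F) := by
  rw [tau_tau, tau_tau, smul_smul, ← phase_add, sigma_swap z w, add_comm w z]
  congr 2
  ring

theorem norm_phase_smul_sub_le (t : ℝ) (F G : fock V) (hF : ‖F‖ ≤ 1) :
    ‖phase t • F - G‖ ≤ |t| + ‖F - G‖ := by
  have h : phase t • F - G = (phase t - 1) • F + (F - G) := by module
  rw [h]
  refine (norm_add_le _ _).trans ?_
  rw [norm_smul]
  gcongr
  exact (mul_le_of_le_one_right (norm_nonneg _) hF).trans (norm_phase_sub_one_le t)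

theorem norm_tau_ground_sub_le (b : V) : ‖tau b (ground V) - ground V‖ ≤ ‖b‖ := by
  have h : ‖tau b (ground V) - ground V‖ ^ 2 ≤ ‖b‖ ^ 2 := by
    have h1 := norm_sub_sq (𝕜 := ℂ) (tau b (ground V)) (ground V)
    have h2 : RCLike.re (inner ℂ (tau b (ground V)) (ground V) : ℂ) =
        Real.exp (-(1 / 2) * ‖b‖ ^ 2) := by
      refine (inner_re_symm (𝕜 := ℂ) (tau b (ground V)) (ground V)).trans ?_
      have h3 := congrArg Complex.re (inner_ground_tau_ground b)
      rw [Complex.ofReal_re] at h3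
      exact h3
    rw [h1, h2, norm_tau_ground, norm_ground]
    linarith [Real.add_one_le_exp (-(1 / 2) * ‖b‖ ^ 2)]
  exact (sq_le_sq₀ (norm_nonneg _) (norm_nonneg _)).1 h

theorem norm_tau_tau_ground_sub_le (a z : V) :
    ‖tau a (tau z (ground V)) - tau z (ground V)‖ ≤ (2 * ‖z‖ + 1) * ‖a‖ := by
  rw [tau_comm]
  refine (norm_phase_smul_sub_le _ _ _ ?_).trans ?_
  · rw [LinearIsometry.norm_map, norm_tau_ground]
  · rw [← map_sub, LinearIsometry.norm_map, abs_mul, abs_two]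
    nlinarith [norm_tau_ground_sub_le a, abs_sigma_le a z]

theorem norm_inner_tau_ground_tau_ground (z w : V) :
    ‖(inner ℂ (tau z (ground V)) (tau w (ground V)) : ℂ)‖ = Real.exp (-(1 / 2) * ‖w - z‖ ^ 2) := by
  have h : (inner ℂ (tau z (ground V)) (tau w (ground V)) : ℂ) =
      phase (sigma (-z) w) * Real.exp (-(1 / 2) * ‖w - z‖ ^ 2) := by
    have h1 := inner_tau_right (-z) (ground V) (tau w (ground V))
    rw [neg_neg] at h1
    rw [← h1, tau_tau, show -z + w = w - z by abel, ← inner_ground_tau_ground]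
    exact inner_smul_right (ground V) _ _
  rw [h, norm_mul, norm_phase, one_mul, Complex.norm_real, Real.norm_of_nonneg (Real.exp_pos _).le]

/-- Up to a phase within ‖u‖δ of 1, τ_u is τ_{Sa}τ_b. The factor τ_{Sa} moves to the left slot and,
through W, becomes τ_{-a}, which displaces τ_zΩ by at most (2‖z‖ + 1)δ; τ_b displaces Ω by at most
δ. -/
theorem Implements.norm_inner_sub_le (h : Implements W S) {δ : ℝ} {u a b : V} (hu : u = S a + b)
    (ha : ‖a‖ ≤ δ) (hb : ‖b‖ ≤ δ) (z : V) :
    ‖(inner ℂ (W (tau z (ground V))) (ground V - tau u (ground V)) : ℂ)‖ ≤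
      (‖u‖ + 2 * ‖z‖ + 2) * δ := by
  have e : tau (-S a) (W (tau z (ground V))) = W (tau (-a) (tau z (ground V))) := by
    rw [h.2 (-a), map_neg S]
  have h2 := inner_tau_right (S a) (W (tau z (ground V))) (tau b (ground V))
  rw [e] at h2
  have hs : sigma (S a) b = sigma u b := by
    rw [hu, sigma_add_left, sigma_self, add_zero]
  have b1 : ‖tau u (ground V) - tau (S a) (tau b (ground V))‖ ≤ ‖u‖ * δ := by
    have hu' : tau u (ground V) = phase (-sigma (S a) b) • tau (S a) (tau b (ground V)) := by
      rw [hu, tau_add]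
    rw [hu']
    refine (norm_phase_smul_sub_le _ _ _ ?_).trans ?_
    · rw [LinearIsometry.norm_map, norm_tau_ground]
    · rw [sub_self, norm_zero, add_zero, abs_neg, hs]
      exact (abs_sigma_le _ _).trans (by gcongr)
  have b3 : ‖W (tau (-a) (tau z (ground V))) - W (tau z (ground V))‖ ≤ (2 * ‖z‖ + 1) * δ := by
    rw [← map_sub, LinearIsometryEquiv.norm_map]
    refine (norm_tau_tau_ground_sub_le (-a) z).trans ?_
    rw [norm_neg]
    gcongr
  refine (norm_inner_sub_le_of_inner_eq h2).trans ?_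
  simp only [LinearIsometryEquiv.norm_map, LinearIsometry.norm_map, norm_ground]
  linarith [(norm_tau_ground_sub_le b).trans hb]

end Averages
end BargmannFock
end

noncomputable section
namespace BargmannFock

/-! ### The dichotomy: bounded powers give an atom, otherwise absolute continuity -/

section MainDichotomy

variable {V : Type*} [NormedAddCommGroup V] [InnerProductSpace ℂ V] [FiniteDimensional ℂ V]
  [MeasurableSpace V] [BorelSpace V] {S : V ≃ₗ[ℝ] V} {W : fock V ≃ₗᵢ[ℂ] fock V}

theorem Implements.sub_tau_mem_dominated (h : Implements W S) {δ : ℕ → ℝ} {u : V}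
    (hu : ∀ n, ∃ a b, u = (S ^ (n + 1)) a + b ∧ ‖a‖ ≤ δ n ∧ ‖b‖ ≤ δ n) (r : ℝ) (z : V) :
    ground V - tau (r • u) (ground V) ∈
      dominated δ fun n => (W ^ (n + 1)) (tau z (ground V)) := by
  refine ⟨(‖r • u‖ + 2 * ‖z‖ + 2) * |r|, fun n => ?_⟩
  obtain ⟨a, b, hab, ha, hb⟩ := hu n
  have hr : ∀ c : V, ‖c‖ ≤ δ n → ‖r • c‖ ≤ |r| * δ n := fun c hc => by
    rw [norm_smul, Real.norm_eq_abs]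
    gcongr
  have := (h.pow (n + 1)).norm_inner_sub_le (u := r • u) (a := r • a) (b := r • b)
    (by rw [map_smul, ← smul_add, ← hab]) (hr a ha) (hr b hb) z
  rwa [← mul_assoc] at this

theorem exists_exp_neg_le {ε : ℝ} (hε : 0 < ε) : ∃ c : ℝ, 0 < c ∧ Real.exp (-(1 / 2) * c ^ 2) ≤ ε := by
  refine ⟨1 + 2 * |Real.log ε|, by positivity, ?_⟩
  rw [← Real.le_log_iff_exp_le hε]
  nlinarith [neg_abs_le (Real.log ε), abs_nonneg (Real.log ε)]

/-- A square-small direction moves the ground state off itself: up to a small error the ground state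
is a vector with square-summable correlations. -/
theorem Implements.exists_approx (h : Implements W S) {u : V} (hu : u ≠ 0)
    (hs : IsSquareSmall S u) {ε : ℝ} (hε : 0 < ε) :
    ∃ y, ‖ground V - y‖ ^ 2 ≤ ε ∧
      Summable fun n : ℕ => ‖(inner ℂ ((W ^ (n + 1)) y) y : ℂ)‖ ^ 2 := by
  obtain ⟨δ, hδ, hab⟩ := hs
  obtain ⟨L, hL⟩ := exists_nat_gt (2 / ε)
  obtain ⟨c, hc, hcε⟩ := exists_exp_neg_le (half_pos hε)
  have hL0 : (0 : ℝ) < L := (by positivity : (0 : ℝ) < 2 / ε).trans hL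
  have hLn : 0 < L := Nat.cast_pos.1 hL0
  have hu' : 0 < ‖u‖ := norm_pos_iff.2 hu
  -- The points r_j u are at least c apart, so the translated ground states overlap by at most ε/2.
  -- With L > 2/ε of them, their mean has squared norm at most ε.
  let r : ℕ → ℝ := fun j => j * (c / ‖u‖)
  let e : ℕ → fock V := fun j => tau (r j • u) (ground V)
  have he : ∀ i j, i ≠ j → ‖(inner ℂ (e i) (e j) : ℂ)‖ ≤ ε / 2 := by
    intro i j hij
    refine (norm_inner_tau_ground_tau_ground _ _).trans_le (le_trans ?_ hcε)
    have h1 : ‖r j • u - r i • u‖ = |(j : ℝ) - i| * c := by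
      rw [← sub_smul, norm_smul, Real.norm_eq_abs, ← sub_mul, abs_mul,
        abs_of_pos (div_pos hc hu')]
      field_simp
    have h2 : (1 : ℝ) ≤ |(j : ℝ) - i| := by
      have : (1 : ℤ) ≤ |(j : ℤ) - i| := Int.one_le_abs (by omega)
      exact_mod_cast this
    rw [h1, Real.exp_le_exp]
    have h3 : c ^ 2 ≤ (|(j : ℝ) - i| * c) ^ 2 :=
      pow_le_pow_left₀ hc.le (le_mul_of_one_le_left hc.le h2) 2
    linarith
  let ψ : fock V := ground V - (L : ℂ)⁻¹ • ∑ j ∈ Finset.range L, e j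
  have hψ : ψ = (L : ℂ)⁻¹ • ∑ j ∈ Finset.range L, (ground V - e j) := by
    rw [Finset.sum_sub_distrib, Finset.sum_const, Finset.card_range, smul_sub,
      ← Nat.cast_smul_eq_nsmul ℂ, smul_smul, inv_mul_cancel₀ (Nat.cast_ne_zero.2 hLn.ne'), one_smul]
  have hmem : ∀ M : Submodule ℂ (fock V), (∀ j, ground V - e j ∈ M) → ψ ∈ M := by
    intro M hM
    rw [hψ]
    exact M.smul_mem _ (M.sum_mem fun j _ => hM j)
  -- The domination estimate treats one slot against translates of Ω. Swapping slots and using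
  -- linearity puts ψ, a mean of the vectors Ω - τ_{r_j u}Ω, first in one slot and then in both.
  have h1 : ∀ j z, tau z (ground V) ∈
      dominated δ fun n => (W ^ (n + 1)).symm (ground V - e j) := fun j z =>
    (mem_dominated_comm fun n => W ^ (n + 1)).1 (h.sub_tau_mem_dominated hab (r j) z)
  have h0 : tau (0 : V) (ground V) = ground V := Subtype.ext (weyl_zero 1 _)
  have h2 : ∀ j, ψ ∈ dominated δ fun n => (W ^ (n + 1)).symm (ground V - e j) := fun j =>
    hmem _ fun k => Submodule.sub_mem _ (by simpa only [h0] using h1 j 0) (h1 j _)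
  obtain ⟨C, hC⟩ : ψ ∈ dominated δ fun n => (W ^ (n + 1)) ψ :=
    hmem _ fun j => (mem_dominated_comm fun n => W ^ (n + 1)).2 (h2 j)
  refine ⟨ψ, ?_, ?_⟩
  · rw [sub_sub_cancel]
    refine (norm_sq_mean_le hLn (half_pos hε).le (fun j => norm_tau_ground _) he).trans ?_
    have : (L : ℝ)⁻¹ ≤ ε / 2 := by
      rw [inv_le_comm₀ hL0 (half_pos hε), inv_div]
      exact hL.le
    linarith
  · refine (hδ.mul_left (C ^ 2)).of_nonneg_of_le (fun n => sq_nonneg _) fun n => ?_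
    rw [← mul_pow]
    exact pow_le_pow_left₀ (norm_nonneg _) (hC n) 2

variable {μ : Measure (AddCircle (2 * Real.pi))}

theorem symm_pow_eq {H : Type*} [NormedAddCommGroup H] [InnerProductSpace ℂ H] (W : H ≃ₗᵢ[ℂ] H)
    (n : ℕ) : W.symm ^ n = (W ^ n).symm :=
  inv_pow W n

/-- If only S⁻¹ has a square-small direction, the same argument runs for W⁻¹, whose correlations
have the same moduli. -/
theorem Implements.absolutelyContinuous (h : Implements W S)
    (hμ : IsSpectralMeasure W (ground V) μ) {u : V} (hu : u ≠ 0)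
    (hs : IsSquareSmall S u ∨ IsSquareSmall S.symm u) : μ ≪ volume := by
  refine hμ.absolutelyContinuous fun ε hε => ?_
  rcases hs with hs | hs
  · obtain ⟨y, hy, hy'⟩ := h.exists_approx hu hs hε
    exact ⟨y, hy, summable_int_norm_sq_inner hy'⟩
  · obtain ⟨y, hy, hy'⟩ := h.symm.exists_approx hu hs hε
    refine ⟨y, hy, summable_int_norm_sq_inner (hy'.congr fun n => ?_)⟩
    rw [symm_pow_eq, ← LinearIsometryEquiv.inner_map_map (W ^ (n + 1)) ((W ^ (n + 1)).symm y),
      LinearIsometryEquiv.apply_symm_apply, norm_inner_symm]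

theorem le_overlap_of_bounded {C : ℝ} (hC : ∀ v, ‖S v‖ ≤ C * ‖v‖) :
    ∫ d, Real.exp (-((C ^ 2 + 1) / 2) * ‖d‖ ^ 2) ∂(dL V) ≤ overlap S := by
  refine integral_mono (integrable_exp_neg_mul_sq (by positivity)) (integrable_overlap S) fun d => ?_
  simp only
  rw [← Real.exp_add, Real.exp_le_exp]
  have := pow_le_pow_left₀ (norm_nonneg _) (hC d) 2
  rw [mul_pow] at this
  linarith

/-- Uniformly bounded powers keep |⟨WⁿΩ, Ω⟩|² above a fixed positive Gaussian integral, so its means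
cannot tend to 0 as Wiener's theorem would require without atoms. -/
theorem Implements.exists_atom (h : Implements W S) (hμ : IsSpectralMeasure W (ground V) μ)
    {C : ℝ} (hC : ∀ (n : ℕ) (v : V), ‖(S ^ n) v‖ ≤ C * ‖v‖) : ∃ θ, μ {θ} ≠ 0 := by
  by_contra! hcon
  have hlim := hμ.tendsto_mean_norm_sq hcon
  set κ := ∫ d, Real.exp (-((C ^ 2 + 1) / 2) * ‖d‖ ^ 2) ∂(dL V) with hκ
  have hpos : 0 < κ := by
    refine integral_exp_pos (integrable_exp_neg_mul_sq (by positivity))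
  refine hpos.not_ge (ge_of_tendsto hlim ?_)
  filter_upwards [eventually_gt_atTop 0] with N hN
  have hN' : (0 : ℝ) < N := Nat.cast_pos.2 hN
  rw [← div_eq_inv_mul, le_div_iff₀ hN', mul_comm, ← nsmul_eq_mul]
  nth_rewrite 1 [← Finset.card_range N]
  refine Finset.card_nsmul_le_sum _ _ _ fun n _ => ?_
  rw [(h.pow n).norm_inner_ground_sq]
  exact le_overlap_of_bounded (hC n)

/-- Fails for general measures, which may be singular continuous; the dichotomy for the powers of S
rules out a nonatomic singular part when there are no atoms. -/
theorem Implements.absolutelyContinuous_iff (h : Implements W S)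
    (hμ : IsSpectralMeasure W (ground V) μ) : μ ≪ volume ↔ ∀ θ, μ {θ} = 0 := by
  refine ⟨fun hac θ => singleton_eq_zero_of_absolutelyContinuous hac θ, fun hat => ?_⟩
  have : FiniteDimensional ℝ V := FiniteDimensional.complexToReal V
  rcases bounded_or_isSquareSmall S with ⟨C, hC⟩ | ⟨u, hu, hs⟩
  · obtain ⟨θ, hθ⟩ := h.exists_atom hμ hC
    exact absurd (hat θ) hθ
  · exact h.absolutelyContinuous hμ hu hs

end MainDichotomy
end BargmannFock
end

noncomputable section
namespace BargmannFock

/-! ### Atoms and jumps in terms of eigenvectors -/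

section Atoms

variable {V : Type*} [NormedAddCommGroup V] [InnerProductSpace ℂ V] [FiniteDimensional ℂ V]
  [MeasurableSpace V] [BorelSpace V] {W : fock V ≃ₗᵢ[ℂ] fock V} {ι : Type*} {s : ι → ℝ}
  {v : ι → fock V} {μ : Measure (AddCircle (2 * Real.pi))}

theorem norm_inner_right_ground (F : fock V) :
    ‖(inner ℂ F (ground V) : ℂ)‖ = ‖groundProj F‖ := by
  rw [norm_groundProj]
  exact norm_inner_symm F (ground V)

theorem IsEigenSystem.hasSum_real_singleton (hv : IsEigenSystem W s v)
    (hμ : IsSpectralMeasure W (ground V) μ) (θ : AddCircle (2 * Real.pi)) :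
    HasSum (fun k : {k : ι // Complex.exp (Complex.I * s k) = fourier 1 θ} =>
      ‖groundProj (v k)‖ ^ 2) (μ.real {θ}) := by
  rw [hμ.real_singleton]
  simp_rw [← norm_inner_right_ground]
  exact hv.hasSum (ground V) θ

theorem IsEigenSystem.hasSum_atom (hv : IsEigenSystem W s v)
    (hμ : IsSpectralMeasure W (ground V) μ) (l : ι) :
    HasSum (fun k : {k : ι // Complex.exp (Complex.I * s k) = Complex.exp (Complex.I * s l)} =>
      ‖groundProj (v k)‖ ^ 2) (μ.real {(s l : AddCircle (2 * Real.pi))}) := by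
  rw [exp_I_mul_eq_fourier (s l)]
  exact hv.hasSum_real_singleton hμ _

theorem IsEigenSystem.singleton_ne_zero_iff (hv : IsEigenSystem W s v)
    (hμ : IsSpectralMeasure W (ground V) μ) (θ : AddCircle (2 * Real.pi)) :
    μ {θ} ≠ 0 ↔ ∃ l, groundProj (v l) ≠ 0 ∧ θ = (s l : AddCircle (2 * Real.pi)) := by
  have := hμ.1
  have h := hv.hasSum_real_singleton hμ θ
  rw [← measureReal_ne_zero_iff]
  constructor
  · intro hne
    by_contra! hcon
    refine hne (h.unique ?_)
    convert hasSum_zero with k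
    have hk : groundProj (v k) = 0 := by
      by_contra h0
      exact hcon k h0 (fourier_one_injective.1 (k.2.symm.trans (exp_I_mul_eq_fourier _)))
    rw [hk, norm_zero]
    norm_num
  · rintro ⟨l, hl, rfl⟩ h0
    rw [h0, hasSum_zero_iff_of_nonneg fun k => sq_nonneg _] at h
    have := congrFun h ⟨l, exp_I_mul_eq_fourier (s l)⟩
    simp only [Pi.zero_apply] at this
    exact hl (norm_eq_zero.1 (pow_eq_zero_iff two_ne_zero |>.1 this))

theorem IsEigenSystem.jumpSet_eq (hv : IsEigenSystem W s v)
    (hμ : IsSpectralMeasure W (ground V) μ) {T : ℝ} (hT : 0 < T) :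
    jumpSet (Qfun W (ground V) T) =
      {lam | ∃ (l : ι) (j : ℤ), groundProj (v l) ≠ 0 ∧ lam = (2 * Real.pi * j - s l) / T} := by
  ext lam
  rw [hμ.mem_jumpSet hT, hv.singleton_ne_zero_iff hμ, Set.mem_ofPred_eq]
  refine exists_congr fun l => ?_
  rw [exists_and_left, and_congr_right_iff]
  intro _
  -- The congruence is oriented as s_l + λT ∈ 2πℤ, so that the resulting integer is the j of
  -- Λ_{l,j}.
  rw [eq_comm, ← sub_eq_zero, ← AddCircle.coe_sub, AddCircle.coe_eq_zero_iff]
  refine exists_congr fun j => ?_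
  rw [eq_div_iff hT.ne', zsmul_eq_mul]
  constructor <;> intro h <;> linarith

end Atoms
end BargmannFock
end

/-! ### Assembly of the proposition -/

theorem proposition1p5 {V : Type*} [NormedAddCommGroup V] [InnerProductSpace ℂ V]
    [FiniteDimensional ℂ V] [MeasurableSpace V] [BorelSpace V]
    (S : V ≃ₗ[ℝ] V) (hS : IsSymplectic S) (η : ℂ) (hη : IsMetaplecticFactor S η)
    (T : ℝ) (hT : 0 < T) :
    -- the metaplectic operator `W_J(S)` exists, as a unitary operator
    (∃! W : fock V ≃ₗᵢ[ℂ] fock V, IsMetaplectic S η W) ∧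
    ∀ W : fock V ≃ₗᵢ[ℂ] fock V, IsMetaplectic S η W →
      -- its spectral measure in the ground state exists
      (∃! μ : Measure (AddCircle (2 * Real.pi)), IsSpectralMeasure W (ground V) μ) ∧
      ∀ μ : Measure (AddCircle (2 * Real.pi)), IsSpectralMeasure W (ground V) μ →
        -- (1) the series converges, and its sum is an integral against the spectral measure
        (∀ lam : ℝ,
          Tendsto (QPartial W (ground V) T lam) atTop (𝓝 (Qfun W (ground V) T lam)) ∧
          Qfun W (ground V) T lam = -(1 / (2 * T)) *
            ∫ θ, residue ((AddCircle.equivIco (2 * Real.pi) 0 θ : ℝ) + lam * T - Real.pi) ∂μ) ∧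
        -- (2) uniform continuity
        (UniformContinuous (Qfun W (ground V) T) ↔ μ ≪ volume) ∧
        ∀ {ι : Type*} (s : ι → ℝ) (v : ι → fock V), IsEigenSystem W s v →
          -- (3) the atoms and their masses
          (∀ θ, μ {θ} ≠ 0 → ∃ l, θ = (s l : AddCircle (2 * Real.pi))) ∧
          (∀ l, HasSum
            (fun k : {k : ι // Complex.exp (Complex.I * s k) = Complex.exp (Complex.I * s l)} =>
              ‖groundProj (v k)‖ ^ 2)
            (μ.real {(s l : AddCircle (2 * Real.pi))})) ∧
          -- (4) the jumps
          jumpSet (Qfun W (ground V) T) =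
            {lam | ∃ (l : ι) (j : ℤ), groundProj (v l) ≠ 0 ∧ lam = (2 * Real.pi * j - s l) / T} := by
  refine ⟨existsUnique_isMetaplectic hS hη, fun W hW => ⟨?_, fun μ hμ => ⟨?_, ?_, ?_⟩⟩⟩
  · obtain ⟨μ, hμ⟩ := exists_isSpectralMeasure W (ground V)
    exact ⟨μ, hμ, fun ν hν => hν.unique hμ⟩
  · intro lam
    refine ⟨?_, hμ.Qfun_eq hT lam⟩
    rw [hμ.Qfun_eq hT lam]
    exact hμ.tendsto_QPartial hT lam
  · rw [hμ.uniformContinuous_Qfun_iff hT]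
    exact (Implements.absolutelyContinuous_iff ⟨hS, hW.map_tau hS⟩ hμ).symm
  · intro ι s v hv
    refine ⟨fun θ hθ => ?_, hv.hasSum_atom hμ, hv.jumpSet_eq hμ hT⟩
    obtain ⟨l, -, hl⟩ := (hv.singleton_ne_zero_iff hμ θ).1 hθ
    exact ⟨l, hl⟩
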